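/- Let $Q=\mathbb R^n$ with lattice $\mathbb Z^n$, and let $X_A=T^*Q/T^*_{\mathbb Z}Q=\mathbb R^n\times(\mathbb R/\mathbb Z)^n$ with coordinates $(q,p)$, symplectic form $\sum_i dq_i\wedge dp_i$ and projection $\pi\colon X_A\to Q$. A rational convex polyhedral domain is a finite intersection of half-spaces $\{q:\langle a,q\rangle\ge\lambda\}$ with $a\in\mathbb Z^n$, $\lambda\in\mathbb R$. Let $V=\{V_s\}$ be a weight-$1$ rational polyhedral complex of dimension $k$: a locally finite family of nonempty $k$-dimensional rational convex polyhedral domains in $Q$ such that for $s\ne t$ the intersection $V_s\cap V_t$ is empty or a common proper face of both. Let $V^{(1)}$ be the union of the relative interiors of the facets of the $V_s$, and let $B_\varepsilon(V^{(1)})$ be its open $\varepsilon$-neighbourhood. Let $L_{V^{(0)}}=\bigcup_s L_{V_s}$, where $L_{V_s}$ is the image in $X_A$ of the conormal bundle of the relative interior of $V_s$ (the periodized conormal bundle). Fix an orientation of $\mathbb R^n$; then $L_{V_s}$ is oriented by $dq_1\wedge\dots\wedge dq_k\wedge dp_{k+1}\wedge\dots\wedge dp_n$, in the linear coordinates given by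 any positively oriented basis whose first $k$ vectors are tangent to $V_s$, and its dual basis. Suppose that there is a family $L^\varepsilon_V$, $\varepsilon>0$, of oriented Lagrangian submanifolds of $X_A$ (without boundary, properly embedded or, more generally, properly immersed) such that (i) the $L^\varepsilon_V$ are all Hamiltonian isotopic to each other; (ii) for every $\varepsilon>0$, $\;L^\varepsilon_V\setminus\pi^{-1}(B_\varepsilon(V^{(1)}))=L_{V^{(0)}}\setminus\pi^{-1}(B_\varepsilon(V^{(1)}))$ as oriented submanifolds. Then $V$ is a tropical subvariety, i.e. it satisfies the balancing condition: for every facet $W$ of a member of $V$, if $V_1,\dots,V_m$ are the members of $V$ containing $W$, and $v_i\in T_{\mathbb Z}V_i$ points from $W$ into $V_i$ and satisfies $T_{\mathbb Z}V_i=T_{\mathbb Z}W\oplus\mathbb Z v_i$ for each $i$, then $\sum_{i=1}^m v_i\in T_{\mathbb Z}W$. Here $T_{\mathbb Z}P$ denotes the lattice of integral vectors tangent to $P$. -/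

import Mathlib

open scoped Manifold ContDiff

universe u

/-! ### Rational polyhedral complexes and tropical subvarieties in `Q = ℝⁿ` -/

/-- The integral affine manifold `Q = ℝⁿ`, with its Euclidean distance. -/
abbrev BaseSpace (n : ℕ) : Type := EuclideanSpace ℝ (Fin n)

/-- A rational convex polyhedral domain: a finite intersection of closed half-spaces
`{q | λᵢ ≤ ⟨aᵢ, q⟩}` with integral `aᵢ` and real `λᵢ`. -/
def IsRationalPolyhedron {n : ℕ} (P : Set (BaseSpace n)) : Prop :=
  ∃ (m : ℕ) (a : Fin m → Fin n → ℤ) (b : Fin m → ℝ),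
    P = {q | ∀ i, b i ≤ ∑ j, (a i j : ℝ) * q j}

/-- The dimension of (the affine span of) a set. -/
noncomputable def polyDim {n : ℕ} (P : Set (BaseSpace n)) : ℕ :=
  Module.finrank ℝ (vectorSpan ℝ P)

/-- `F` is a boundary face of the polyhedron `P`: the locus where some linear functional attains
its maximum on `P`, and not all of `P`. -/
def IsBoundaryFace {n : ℕ} (F P : Set (BaseSpace n)) : Prop :=
  F.Nonempty ∧ IsExposed ℝ P F ∧ F ≠ P

/-- `W` is a facet (a face of codimension one) of the polyhedron `P`. -/
def IsFacet {n : ℕ} (W P : Set (BaseSpace n)) : Prop :=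
  W.Nonempty ∧ IsExposed ℝ P W ∧ polyDim W + 1 = polyDim P

/-- A (locally finite) family of nonempty `k`-dimensional rational convex polyhedral domains, any
two of which are disjoint or meet along a common boundary face. -/
structure IsRationalPolyhedralComplex {n : ℕ} (k : ℕ) {ι : Type*} (V : ι → Set (BaseSpace n)) :
    Prop where
  polyhedron : ∀ s, IsRationalPolyhedron (V s)
  nonempty : ∀ s, (V s).Nonempty
  dim_eq : ∀ s, polyDim (V s) = k
  locallyFinite : LocallyFinite V
  inter : ∀ s t, s ≠ t → (V s ∩ V t).Nonempty →
    IsBoundaryFace (V s ∩ V t) (V s) ∧ IsBoundaryFace (V s ∩ V t) (V t)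

/-- The lattice `ℤⁿ` of integral tangent vectors. -/
noncomputable def integralVectors (n : ℕ) : AddSubgroup (BaseSpace n) where
  carrier := {v | ∀ i, ∃ m : ℤ, v i = m}
  zero_mem' := fun _ => ⟨0, by simp⟩
  add_mem' := fun {a b} ha hb i => by
    obtain ⟨x, hx⟩ := ha i
    obtain ⟨y, hy⟩ := hb i
    exact ⟨x + y, by simp [hx, hy]⟩
  neg_mem' := fun {a} ha i => by
    obtain ⟨x, hx⟩ := ha i
    exact ⟨-x, by simp [hx]⟩

/-- `T_ℤ P`: the integral vectors tangent to `P`. -/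
noncomputable def tangentLattice {n : ℕ} (P : Set (BaseSpace n)) : AddSubgroup (BaseSpace n) :=
  (vectorSpan ℝ P).toAddSubgroup ⊓ integralVectors n

/-- For a facet `W` of `P`: the vector `v` satisfies `T_ℤ P = T_ℤ W ⊕ ℤ v`, and it points from `W`
into `P`. -/
def IsPrimitiveNormal {n : ℕ} (W P : Set (BaseSpace n)) (v : BaseSpace n) : Prop :=
  tangentLattice W ⊔ AddSubgroup.zmultiples v = tangentLattice P ∧
  tangentLattice W ⊓ AddSubgroup.zmultiples v = ⊥ ∧
  ∃ x ∈ W, ∃ δ : ℝ, 0 < δ ∧ x + δ • v ∈ P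

/-- The balancing condition at every facet: `∑ wₜ vₜ ≡ 0` modulo `T_ℤ W`, the sum being over
all members of the family which contain `W`. -/
def IsBalanced {n : ℕ} {ι : Type*} (V : ι → Set (BaseSpace n)) (w : ι → ℕ) : Prop :=
  ∀ (s : ι) (W : Set (BaseSpace n)), IsFacet W (V s) →
    ∀ S : Finset ι, (∀ t, t ∈ S ↔ W ⊆ V t) →
      ∀ v : ι → BaseSpace n, (∀ t ∈ S, IsPrimitiveNormal W (V t) (v t)) →
        ∑ t ∈ S, w t • v t ∈ tangentLattice W

/-- A `k`-dimensional tropical subvariety of `ℝⁿ` with weights `w`. -/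
def IsTropicalSubvariety {n : ℕ} (k : ℕ) {ι : Type*} (V : ι → Set (BaseSpace n)) (w : ι → ℕ) :
    Prop :=
  IsRationalPolyhedralComplex k V ∧ IsBalanced V w

/-- `V⁽¹⁾`: the union of the relative interiors of the facets of the members of the family. -/
def codimOneStrata {n : ℕ} {ι : Type*} (V : ι → Set (BaseSpace n)) : Set (BaseSpace n) :=
  {q | ∃ s W, IsFacet W (V s) ∧ q ∈ intrinsicInterior ℝ W}

/-! ### The symplectic manifold `X_A = T*Q / T*_ℤ Q` -/

/-- `T*Q = ℝⁿ × ℝⁿ`, with coordinates `(q, p)`; the pairing of a covector with a vector is the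
standard inner product. It is the universal cover of `X_A`. -/
abbrev CotangentCover (n : ℕ) : Type := BaseSpace n × BaseSpace n

/-- `X_A = T*Q / T*_ℤ Q = ℝⁿ × (ℝ/ℤ)ⁿ`; the first projection is the Lagrangian torus fibration. -/
abbrev XA (n : ℕ) : Type := BaseSpace n × UnitAddTorus (Fin n)

/-- The covering map `T*Q → X_A`. It is a local diffeomorphism, and the smooth structure and the
symplectic form of `X_A` are those induced by it. -/
def coverMap {n : ℕ} (x : CotangentCover n) : XA n :=
  (x.1, fun i => ((x.2 i : ℝ) : UnitAddCircle))

/-- The canonical symplectic form `∑ dqᵢ ∧ dpᵢ`. -/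
noncomputable def symplecticForm {n : ℕ} (a b : CotangentCover n) : ℝ :=
  inner ℝ a.1 b.2 - inner ℝ b.1 a.2

/-- The periodized conormal bundle `N*P / N*_ℤ P` over the relative interior of `P`. -/
def periodizedConormal {n : ℕ} (P : Set (BaseSpace n)) : Set (XA n) :=
  coverMap '' {x | x.1 ∈ intrinsicInterior ℝ P ∧ ∀ v ∈ vectorSpan ℝ P, inner ℝ x.2 v = 0}

/-- A smooth lift `F` to `T*Q`, over an open set `O` of a chart `e`, of a map `f : M → X_A`. -/
structure IsLocalLift {n : ℕ} {M : Type u} [TopologicalSpace M] (f : M → XA n)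
    (e : OpenPartialHomeomorph M (EuclideanSpace ℝ (Fin n)))
    (O : Set (EuclideanSpace ℝ (Fin n)))
    (F : EuclideanSpace ℝ (Fin n) → CotangentCover n) : Prop where
  isOpen : IsOpen O
  subset_target : O ⊆ e.target
  contDiffOn : ContDiffOn ℝ ∞ F O
  lift : ∀ y ∈ O, coverMap (F y) = f (e.symm y)

/-- An oriented Lagrangian submanifold of `X_A`, without boundary and possibly immersed: a proper
Lagrangian immersion of a smooth `n`-manifold (Hausdorff, second countable). The orientation is
given by an atlas all of whose transition maps preserve the orientation of `ℝⁿ`. -/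
structure OrientedLagrangian (n : ℕ) where
  carrier : Type u
  [topologicalSpace : TopologicalSpace carrier]
  [chartedSpace : ChartedSpace (EuclideanSpace ℝ (Fin n)) carrier]
  [isManifold : IsManifold (𝓡 n) ∞ carrier]
  [t2Space : T2Space carrier]
  [secondCountable : SecondCountableTopology carrier]
  oriented : ∀ e ∈ atlas (EuclideanSpace ℝ (Fin n)) carrier,
    ∀ e' ∈ atlas (EuclideanSpace ℝ (Fin n)) carrier,
      ∀ y ∈ (e.symm.trans e').source, 0 < (fderiv ℝ (e.symm.trans e') y).det
  toFun : carrier → XA n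
  proper : IsProperMap toFun
  smooth : ∀ e ∈ atlas (EuclideanSpace ℝ (Fin n)) carrier, ∀ y ∈ e.target,
    ∃ O F, y ∈ O ∧ IsLocalLift toFun e O F
  immersion : ∀ e ∈ atlas (EuclideanSpace ℝ (Fin n)) carrier, ∀ O F,
    IsLocalLift toFun e O F → ∀ y ∈ O, Function.Injective (fderiv ℝ F y)
  lagrangian : ∀ e ∈ atlas (EuclideanSpace ℝ (Fin n)) carrier, ∀ O F,
    IsLocalLift toFun e O F → ∀ y ∈ O, ∀ a b,
      symplecticForm (fderiv ℝ F y a) (fderiv ℝ F y b) = 0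

attribute [instance] OrientedLagrangian.topologicalSpace
attribute [instance] OrientedLagrangian.chartedSpace
attribute [instance] OrientedLagrangian.isManifold
attribute [instance] OrientedLagrangian.t2Space
attribute [instance] OrientedLagrangian.secondCountable

/-- A Hamiltonian isotopy of `X_A`: the flow, starting at the identity, of a smooth time-dependent
Hamiltonian `H`. The field `lift` is the lift of the flow to `T*Q`. -/
structure HamiltonianIsotopy (n : ℕ) where
  hamiltonian : ℝ → XA n → ℝ
  hamiltonian_smooth :
    ContDiff ℝ ∞ (fun z : ℝ × CotangentCover n => hamiltonian z.1 (coverMap z.2))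
  flow : ℝ → XA n ≃ₜ XA n
  lift : ℝ → CotangentCover n → CotangentCover n
  lift_smooth : ContDiff ℝ ∞ (fun z : ℝ × CotangentCover n => lift z.1 z.2)
  lift_zero : ∀ x, lift 0 x = x
  coverMap_lift : ∀ t x, coverMap (lift t x) = flow t (coverMap x)
  hamilton : ∀ t x a,
    symplecticForm (deriv (fun r => lift r x) t) a =
      fderiv ℝ (fun y => hamiltonian t (coverMap y)) (lift t x) a

/-- Two (immersed) Lagrangians are Hamiltonian isotopic: the time-one map of a Hamiltonian isotopy
carries one to the other, up to reparametrization by a diffeomorphism. -/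
def HamiltonianIsotopic {n : ℕ} (L L' : OrientedLagrangian.{u} n) : Prop :=
  ∃ (φ : HamiltonianIsotopy n) (ψ : Diffeomorph (𝓡 n) (𝓡 n) L.carrier L'.carrier ∞),
    ∀ x, φ.flow 1 (L.toFun x) = L'.toFun (ψ x)

/-- The value of `dq₁ ∧ ⋯ ∧ dqₖ ∧ dpₖ₊₁ ∧ ⋯ ∧ dpₙ` on `n` vectors of `T*Q`, in the linear
coordinates `(q, p)` given by a basis `b` of `ℝⁿ` and its dual basis. -/
noncomputable def conormalForm {n : ℕ} (k : ℕ) (b : Module.Basis (Fin n) ℝ (BaseSpace n))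
    (a : Fin n → CotangentCover n) : ℝ :=
  Matrix.det (Matrix.of fun i j : Fin n =>
    if (i : ℕ) < k then b.repr (a j).1 i else inner ℝ (a j).2 (b i))

/-- A family `L ε`, `ε > 0`, of oriented Lagrangian submanifolds of `X_A` which are all Hamiltonian
isotopic, and such that, outside the preimage of the `ε`-neighbourhood of `V⁽¹⁾`, the Lagrangian
`L ε` agrees with the union of the periodized conormal bundles of the members of `V`, as an
oriented submanifold. The orientation `o` of `ℝⁿ`, equivalently of the fibres `F_q`, fixes the
orientation of the periodized conormal bundle of `P`: it is that of
`dq₁ ∧ ⋯ ∧ dqₖ ∧ dpₖ₊₁ ∧ ⋯ ∧ dpₙ` in the coordinates of any basis of orientation `o` whose first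
`k` members are tangent to `P`. -/
structure IsLagrangianLift {n : ℕ} (o : Orientation ℝ (BaseSpace n) (Fin n)) (k : ℕ) {ι : Type*}
    (V : ι → Set (BaseSpace n)) (L : Set.Ioi (0 : ℝ) → OrientedLagrangian.{u} n) : Prop where
  hamiltonianIsotopic : ∀ ε ε', HamiltonianIsotopic (L ε) (L ε')
  image_eq : ∀ ε : Set.Ioi (0 : ℝ),
    Set.range (L ε).toFun \ Prod.fst ⁻¹' Metric.thickening ε (codimOneStrata V) =
      (⋃ s, periodizedConormal (V s)) \ Prod.fst ⁻¹' Metric.thickening ε (codimOneStrata V)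
  injOn : ∀ ε : Set.Ioi (0 : ℝ),
    Set.InjOn (L ε).toFun {x | ((L ε).toFun x).1 ∉ Metric.thickening ε (codimOneStrata V)}
  orientation : ∀ ε : Set.Ioi (0 : ℝ),
    ∀ e ∈ atlas (EuclideanSpace ℝ (Fin n)) (L ε).carrier,
      ∀ O F, IsLocalLift (L ε).toFun e O F → ∀ y ∈ O,
        (F y).1 ∉ Metric.thickening ε (codimOneStrata V) →
          ∀ s, (F y).1 ∈ V s →
            ∀ b : Module.Basis (Fin n) ℝ (BaseSpace n), b.orientation = o →
              (∀ i : Fin n, (i : ℕ) < k → b i ∈ vectorSpan ℝ (V s)) →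
                0 < conormalForm k b (fun j => fderiv ℝ F y (EuclideanSpace.single j 1))

/-!
The balancing condition at a facet `W` is local near a relative interior point `x₀` of `W`, and it
is obtained by comparing the degrees of the parts of a Lagrangian `L ε` which lie over the members
`V t` containing `W`. Of `L ε`, only the properness, the orientation and its shape away from the
facets matter.

Choose a lattice basis `b` of `ℤⁿ` such that the `b i`, `i < l`, span the directions of `W`
(`IsRationalPolyhedron.exists_isLatticeBasis_face`), and write `q = x₀ + ∑ yᵢ bᵢ`, `pᵢ = ⟨p, bᵢ⟩`.
It suffices to prove that the `l`-th coordinates of the normal vectors `v t` sum up to zero, for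
any such basis. Let `G` be the map `degreeMap` from `X_A` to `ℝⁿ` with components `yᵢ` for
`i < l`, the squared transverse distance `N = ∑ yⱼ²`, `j ≥ l`, and `sin (2π pᵢ)` for `i > l`. Let `R`
be a cutoff function, locally a function of `G`, which is constant near `W` in the `N` direction.
As `L ε` is properly mapped to `X_A`, the integral over `L ε` of `dR ∧ ⋀_{i ≠ l} dGᵢ` vanishes by
Stokes' theorem (`sum_chartIntegral_update_eq_zero`). The integrand is `φ(G) dG₁ ∧ ⋯ ∧ dGₙ` for a
density `φ` of nonzero integral, and it is supported over a shell `c ≤ N ≤ 2c`. For `ε` small, the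
shell does not meet the `ε`-neighbourhood of the facets, so that `L ε` is there the union of the
periodized conormal bundles of the `V t` (`IsRayModel`, `exists_isRayModel`).

The conormal bundle of `V t` consists of points with `y` on the ray spanned by `v t`, modulo `W`,
and with integral values of `p` on `W` and on `v t`. If the `l`-th coordinate `m` of `v t` is
zero, the differentials of the `pᵢ`, `i > l`, are dependent there, and the integrand vanishes.
Otherwise `p_l` is determined by the other `pᵢ` and by the value `r` of `p` on `v t`, and changing
`p_l` by integers changes `r` by multiples of `m`: there are exactly `|m|` sheets (`sheet`), each
of which is embedded by `G` onto a set containing the support of `φ`. With the orientation of the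
conormal bundle, the Jacobian determinant of `G` has the sign of `m` on these sheets
(`IsRayModel.sign_mul_chartJacobian_pos`). Each sheet hence contributes `sign m ∫ φ`, the member
`V t` contributes `m ∫ φ`, and the vanishing of the total is the required relation
(`IsRayModel.sum_repr_eq_zero`).
-/

/-! ### Stokes' theorem for products of exact one-forms on `ℝⁿ` -/

/-- The determinant of the partial derivatives of `n` functions on `ℝⁿ`: the coefficient of
`dg₁ ∧ ⋯ ∧ dgₙ` with respect to the standard volume form. -/
noncomputable def jacobianDet {n : ℕ} (g : Fin n → EuclideanSpace ℝ (Fin n) → ℝ)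
    (y : EuclideanSpace ℝ (Fin n)) : ℝ :=
  Matrix.det (Matrix.of fun i j : Fin n => fderiv ℝ (g i) y (EuclideanSpace.single j 1))

/-- The rows of the cofactor matrix of a Jacobian matrix are divergence free: after expansion over
permutations, the terms containing a second derivative of `g m` cancel in pairs. -/
theorem sum_sign_smul_prod_mul_fderiv_fderiv_eq_zero {n : ℕ}
    {g : Fin n → EuclideanSpace ℝ (Fin n) → ℝ} (hg : ∀ i, ContDiff ℝ ∞ (g i)) {i₀ m : Fin n}
    (hm : m ≠ i₀) (y : EuclideanSpace ℝ (Fin n)) :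
    ∑ σ : Equiv.Perm (Fin n), ((Equiv.Perm.sign σ : ℤ) : ℝ) *
      ((∏ j ∈ (Finset.univ.erase i₀).erase m,
          fderiv ℝ (g j) y (EuclideanSpace.single (σ j) 1)) *
        fderiv ℝ (fderiv ℝ (g m)) y (EuclideanSpace.single (σ i₀) 1)
          (EuclideanSpace.single (σ m) 1)) = 0 := by
  have hsym : IsSymmSndFDerivAt ℝ (g m) y :=
    (contDiff_infty.mp (hg m) 2).contDiffAt.isSymmSndFDerivAt (by simp)
  refine self_eq_neg.mp ?_
  conv_lhs => rw [← Equiv.sum_comp (Equiv.mulRight (Equiv.swap i₀ m))]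
  rw [← Finset.sum_neg_distrib]
  refine Finset.sum_congr rfl fun σ _ => ?_
  have hprod : ∏ j ∈ (Finset.univ.erase i₀).erase m,
        fderiv ℝ (g j) y (EuclideanSpace.single ((σ * Equiv.swap i₀ m) j) (1 : ℝ)) =
      ∏ j ∈ (Finset.univ.erase i₀).erase m,
        fderiv ℝ (g j) y (EuclideanSpace.single (σ j) 1) := by
    refine Finset.prod_congr rfl fun j hj => ?_
    simp only [Finset.mem_erase, Finset.mem_univ, and_true] at hj
    rw [Equiv.Perm.mul_apply, Equiv.swap_apply_of_ne_of_ne hj.2 hj.1]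
  simp only [Equiv.coe_mulRight]
  rw [hprod, Equiv.Perm.mul_apply, Equiv.Perm.mul_apply, Equiv.swap_apply_left,
    Equiv.swap_apply_right, hsym.eq, Equiv.Perm.sign_mul, Equiv.Perm.sign_swap hm.symm]
  simp

/-- Stokes' theorem on `ℝⁿ` for the exact form `d (g i₀) ∧ ⋯`, whose primitive has compact
support. -/
theorem integral_jacobianDet_eq_zero {n : ℕ} {g : Fin n → EuclideanSpace ℝ (Fin n) → ℝ}
    (hg : ∀ i, ContDiff ℝ ∞ (g i)) {i₀ : Fin n} (hc : HasCompactSupport (g i₀)) :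
    ∫ y, jacobianDet g y = 0 := by
  have hD : ∀ i j : Fin n, ContDiff ℝ ∞
      fun y => fderiv ℝ (g i) y (EuclideanSpace.single j (1 : ℝ)) := fun i j =>
    ((hg i).fderiv_right (by simp)).clm_apply contDiff_const
  have hcD : ∀ j : Fin n, HasCompactSupport
      fun y => fderiv ℝ (g i₀) y (EuclideanSpace.single j (1 : ℝ)) := fun j =>
    hc.fderiv_apply ℝ _
  have hf : ∀ σ : Equiv.Perm (Fin n), ContDiff ℝ ∞
      (fun y => ∏ j ∈ Finset.univ.erase i₀,
        fderiv ℝ (g j) y (EuclideanSpace.single (σ j) (1 : ℝ))) := fun σ =>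
    contDiff_prod fun j _ => hD j (σ j)
  have hf' : ∀ σ : Equiv.Perm (Fin n), ∀ y v, fderiv ℝ (fun y => ∏ j ∈ Finset.univ.erase i₀,
        fderiv ℝ (g j) y (EuclideanSpace.single (σ j) (1 : ℝ))) y v =
      ∑ m ∈ Finset.univ.erase i₀, (∏ j ∈ (Finset.univ.erase i₀).erase m,
          fderiv ℝ (g j) y (EuclideanSpace.single (σ j) 1)) *
        fderiv ℝ (fderiv ℝ (g m)) y v (EuclideanSpace.single (σ m) 1) := by
    intro σ y v
    have h1 := HasFDerivAt.finsetProd (u := Finset.univ.erase i₀) (x := y)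
      (g := fun j y => fderiv ℝ (g j) y (EuclideanSpace.single (σ j) (1 : ℝ)))
      (fun j _ => ((hD j (σ j)).differentiable (by simp) y).hasFDerivAt)
    have h3 : ∀ m, fderiv ℝ (fun y => fderiv ℝ (g m) y (EuclideanSpace.single (σ m) (1 : ℝ))) y v
        = fderiv ℝ (fderiv ℝ (g m)) y v (EuclideanSpace.single (σ m) 1) := by
      intro m
      have hdd : DifferentiableAt ℝ (fderiv ℝ (g m)) y :=
        (((hg m).fderiv_right (m := ∞) (by simp)).differentiable (by simp)) y
      rw [fderiv_clm_apply hdd (differentiableAt_const _)]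
      simp
    rw [h1.fderiv]
    simp [h3]
  have hterm : ∀ σ : Equiv.Perm (Fin n), MeasureTheory.Integrable fun y =>
      ((Equiv.Perm.sign σ : ℤ) : ℝ) * ((∏ j ∈ Finset.univ.erase i₀,
        fderiv ℝ (g j) y (EuclideanSpace.single (σ j) (1 : ℝ))) *
          fderiv ℝ (g i₀) y (EuclideanSpace.single (σ i₀) 1)) := fun σ =>
    (((hf σ).continuous.mul (hD _ _).continuous).integrable_of_hasCompactSupport
      (hcD _).mul_left).const_mul _
  have hint2 : ∀ σ : Equiv.Perm (Fin n), MeasureTheory.Integrable fun y =>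
      fderiv ℝ (fun y => ∏ j ∈ Finset.univ.erase i₀,
        fderiv ℝ (g j) y (EuclideanSpace.single (σ j) (1 : ℝ))) y
          (EuclideanSpace.single (σ i₀) 1) * g i₀ y := fun σ =>
    ((((hf σ).fderiv_right (m := ∞) (by simp)).clm_apply contDiff_const).continuous.mul
      (hg i₀).continuous).integrable_of_hasCompactSupport hc.mul_left
  have hparts : ∀ σ : Equiv.Perm (Fin n), ∫ y, (∏ j ∈ Finset.univ.erase i₀,
        fderiv ℝ (g j) y (EuclideanSpace.single (σ j) (1 : ℝ))) *
          fderiv ℝ (g i₀) y (EuclideanSpace.single (σ i₀) 1) =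
      - ∫ y, fderiv ℝ (fun y => ∏ j ∈ Finset.univ.erase i₀,
        fderiv ℝ (g j) y (EuclideanSpace.single (σ j) (1 : ℝ))) y
          (EuclideanSpace.single (σ i₀) 1) * g i₀ y := by
    intro σ
    refine integral_mul_fderiv_eq_neg_fderiv_mul_of_integrable (hint2 σ) ?_ ?_ ?_ ?_
    · exact ((hf σ).continuous.mul (hD _ _).continuous).integrable_of_hasCompactSupport
        (hcD _).mul_left
    · exact ((hf σ).continuous.mul (hg i₀).continuous).integrable_of_hasCompactSupport hc.mul_left
    · exact fun x _ => (hf σ).differentiable (by simp) x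
    · exact fun x _ => (hg i₀).differentiable (by simp) x
  have hdet : ∀ y, jacobianDet g y = ∑ σ : Equiv.Perm (Fin n),
      ((Equiv.Perm.sign σ : ℤ) : ℝ) * ((∏ j ∈ Finset.univ.erase i₀,
        fderiv ℝ (g j) y (EuclideanSpace.single (σ j) (1 : ℝ))) *
          fderiv ℝ (g i₀) y (EuclideanSpace.single (σ i₀) 1)) := by
    intro y
    rw [jacobianDet, ← Matrix.det_transpose, Matrix.det_apply']
    refine Finset.sum_congr rfl fun σ _ => ?_
    rw [Finset.prod_erase_mul _ _ (Finset.mem_univ i₀)]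
    simp
  simp_rw [hdet]
  rw [MeasureTheory.integral_finsetSum _ fun σ _ => hterm σ]
  simp_rw [MeasureTheory.integral_const_mul, hparts, mul_neg, Finset.sum_neg_distrib,
    ← MeasureTheory.integral_const_mul]
  rw [← MeasureTheory.integral_finsetSum _ fun σ _ => (hint2 σ).const_mul _, neg_eq_zero]
  refine MeasureTheory.integral_eq_zero_of_ae (Filter.Eventually.of_forall fun y => ?_)
  simp only [hf', Finset.sum_mul, Finset.mul_sum, Pi.zero_apply]
  rw [Finset.sum_comm]
  refine Finset.sum_eq_zero fun m hm => ?_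
  have := sum_sign_smul_prod_mul_fderiv_fderiv_eq_zero hg (Finset.ne_of_mem_erase hm) y
  simp_rw [← mul_assoc] at this ⊢
  rw [← Finset.sum_mul, this, zero_mul]

theorem jacobianDet_congr {n : ℕ} {g g' : Fin n → EuclideanSpace ℝ (Fin n) → ℝ}
    {y : EuclideanSpace ℝ (Fin n)} (h : ∀ i, g i =ᶠ[nhds y] g' i) :
    jacobianDet g y = jacobianDet g' y := by
  have : ∀ i, fderiv ℝ (g i) y = fderiv ℝ (g' i) y := fun i => (h i).fderiv_eq
  simp only [jacobianDet, this]

theorem det_eq_det_of_proj {n : ℕ}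
    (A : EuclideanSpace ℝ (Fin n) →L[ℝ] EuclideanSpace ℝ (Fin n)) :
    A.det = Matrix.det (Matrix.of fun i j : Fin n => A (EuclideanSpace.single j 1) i) := by
  rw [ContinuousLinearMap.det,
    ← LinearMap.det_toMatrix (EuclideanSpace.basisFun (Fin n) ℝ).toBasis]
  rfl

theorem det_of_clm_comp {n : ℕ} (l : Fin n → EuclideanSpace ℝ (Fin n) →L[ℝ] ℝ)
    (A : EuclideanSpace ℝ (Fin n) →L[ℝ] EuclideanSpace ℝ (Fin n)) :
    Matrix.det (Matrix.of fun i j => l i (A (EuclideanSpace.single j 1))) =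
      Matrix.det (Matrix.of fun i j => l i (EuclideanSpace.single j 1)) * A.det := by
  rw [det_eq_det_of_proj, ← Matrix.det_mul]
  congr 1
  ext i j
  simp only [Matrix.of_apply, Matrix.mul_apply]
  conv_lhs => rw [← (EuclideanSpace.basisFun (Fin n) ℝ).sum_repr (A (EuclideanSpace.single j 1))]
  simp [mul_comm]

/-- The Jacobian determinant is linear in the differential of each function: it is given by Cramer's
rule in terms of the others. -/
theorem jacobianDet_update {n : ℕ} (g : Fin n → EuclideanSpace ℝ (Fin n) → ℝ) (i₀ : Fin n)
    (f : EuclideanSpace ℝ (Fin n) → ℝ) (y : EuclideanSpace ℝ (Fin n)) :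
    jacobianDet (Function.update g i₀ f) y =
      (Matrix.of fun i j : Fin n => fderiv ℝ (g i) y (EuclideanSpace.single j 1)).transpose.cramer
        (fun j => fderiv ℝ f y (EuclideanSpace.single j 1)) i₀ := by
  rw [Matrix.cramer_transpose_apply, jacobianDet]
  congr 1
  ext i j
  by_cases h : i = i₀
  · subst h; simp
  · simp [h]

theorem jacobianDet_update_eq_zero {n : ℕ} (g : Fin n → EuclideanSpace ℝ (Fin n) → ℝ) (i₀ : Fin n)
    {f : EuclideanSpace ℝ (Fin n) → ℝ} {y : EuclideanSpace ℝ (Fin n)} (hf : fderiv ℝ f y = 0) :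
    jacobianDet (Function.update g i₀ f) y = 0 := by
  have : (fun j : Fin n => fderiv ℝ f y (EuclideanSpace.single j 1)) = 0 := by
    ext j; simp [hf]
  rw [jacobianDet_update, this, map_zero, Pi.zero_apply]

theorem continuousOn_jacobianDet {n : ℕ} {g : Fin n → EuclideanSpace ℝ (Fin n) → ℝ}
    {O : Set (EuclideanSpace ℝ (Fin n))} (hO : IsOpen O) (hg : ∀ i, ContDiffOn ℝ ∞ (g i) O) :
    ContinuousOn (jacobianDet g) O := by
  have h : ContinuousOn (fun y => Matrix.of fun i j : Fin n =>
      fderiv ℝ (g i) y (EuclideanSpace.single j 1)) O := by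
    refine continuousOn_pi.2 fun i => continuousOn_pi.2 fun j => ?_
    exact ((hg i).continuousOn_fderiv_of_isOpen hO (by simp)).clm_apply continuousOn_const
  exact (Continuous.matrix_det continuous_id).comp_continuousOn h

/-! ### Integration of `n`-forms on an oriented `n`-manifold -/

section Manifold

variable {n : ℕ} {M : Type*} [TopologicalSpace M]

/-- The coefficient of `dh₁ ∧ ⋯ ∧ dhₙ` in the coordinates of a chart. -/
noncomputable def chartJacobian (h : Fin n → M → ℝ)
    (e : OpenPartialHomeomorph M (EuclideanSpace ℝ (Fin n))) (y : EuclideanSpace ℝ (Fin n)) : ℝ :=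
  jacobianDet (fun i => h i ∘ e.symm) y

/-- The integral of the `n`-form `ψ • dh₁ ∧ ⋯ ∧ dhₙ` over the domain of a chart. -/
noncomputable def chartIntegral (e : OpenPartialHomeomorph M (EuclideanSpace ℝ (Fin n)))
    (ψ : M → ℝ) (h : Fin n → M → ℝ) : ℝ :=
  ∫ y in e.target, ψ (e.symm y) * chartJacobian h e y

theorem chartJacobian_update (h : Fin n → M → ℝ) (i₀ : Fin n) (f : M → ℝ)
    (e : OpenPartialHomeomorph M (EuclideanSpace ℝ (Fin n))) (y : EuclideanSpace ℝ (Fin n)) :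
    chartJacobian (Function.update h i₀ f) e y =
      jacobianDet (Function.update (fun i => h i ∘ e.symm) i₀ (f ∘ e.symm)) y := by
  rw [chartJacobian]
  congr 1
  ext i z
  by_cases hi : i = i₀
  · subst hi; simp
  · simp [hi]

/-- A continuous function on the target of a chart which vanishes off a compact subset of the chart
domain is integrable. -/
theorem integrableOn_target_of_continuousOn
    (e : OpenPartialHomeomorph M (EuclideanSpace ℝ (Fin n))) {f : EuclideanSpace ℝ (Fin n) → ℝ}
    (hf : ContinuousOn f e.target) {K : Set M} (hK : IsCompact K) (hKe : K ⊆ e.source)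
    (h0 : ∀ y ∈ e.target, e.symm y ∉ K → f y = 0) :
    MeasureTheory.IntegrableOn f e.target := by
  have hKt : e '' K ⊆ e.target := by
    rintro _ ⟨x, hx, rfl⟩
    exact e.map_source (hKe hx)
  have hc : IsCompact (e '' K) := hK.image_of_continuousOn (e.continuousOn.mono hKe)
  refine ((hf.mono hKt).integrableOn_compact hc).of_forall_sdiff_eq_zero
    e.open_target.measurableSet fun y hy => h0 y hy.1 fun hyK => hy.2 ⟨_, hyK, e.right_inv hy.1⟩

variable [ChartedSpace (EuclideanSpace ℝ (Fin n)) M]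

variable (n M) in
/-- An atlas all of whose transition maps have positive Jacobian determinant. -/
def IsOrientedAtlas : Prop :=
  ∀ e ∈ atlas (EuclideanSpace ℝ (Fin n)) M, ∀ e' ∈ atlas (EuclideanSpace ℝ (Fin n)) M,
    ∀ y ∈ (e.symm.trans e').source, 0 < (fderiv ℝ (e.symm.trans e') y).det

/-- A finite smooth partition of unity on `K`, subordinate to domains of charts. -/
structure ChartPartition (K : Set M) (α : Type*) [Fintype α] where
  chart : α → OpenPartialHomeomorph M (EuclideanSpace ℝ (Fin n))
  chart_mem : ∀ a, chart a ∈ atlas (EuclideanSpace ℝ (Fin n)) M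
  weight : α → M → ℝ
  smooth : ∀ a, ContMDiff (𝓡 n) 𝓘(ℝ, ℝ) ∞ (weight a)
  nonneg : ∀ a x, 0 ≤ weight a x
  le_one : ∀ a x, weight a x ≤ 1
  tsupport_subset : ∀ a, tsupport (weight a) ⊆ (chart a).source
  sum_eq_one : ∀ x ∈ K, ∑ a, weight a x = 1

section smooth

variable [IsManifold (𝓡 n) ∞ M]

theorem ContMDiff.contDiffOn_comp_symm {f : M → ℝ} (hf : ContMDiff (𝓡 n) 𝓘(ℝ, ℝ) ∞ f)
    {e : OpenPartialHomeomorph M (EuclideanSpace ℝ (Fin n))}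
    (he : e ∈ atlas (EuclideanSpace ℝ (Fin n)) M) : ContDiffOn ℝ ∞ (f ∘ e.symm) e.target :=
  contMDiffOn_iff_contDiffOn.1 <| hf.comp_contMDiffOn <|
    contMDiffOn_symm_of_mem_maximalAtlas (IsManifold.subset_maximalAtlas he)

theorem differentiableAt_trans_symm {e e' : OpenPartialHomeomorph M (EuclideanSpace ℝ (Fin n))}
    (he : e ∈ atlas (EuclideanSpace ℝ (Fin n)) M) (he' : e' ∈ atlas (EuclideanSpace ℝ (Fin n)) M)
    {y : EuclideanSpace ℝ (Fin n)} (hy : y ∈ (e.symm.trans e').source) :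
    DifferentiableAt ℝ (e.symm.trans e') y := by
  have h1 : ContMDiffOn (𝓡 n) (𝓡 n) ∞ (e.symm.trans e') (e.symm.trans e').source := by
    refine (contMDiffOn_of_mem_maximalAtlas (IsManifold.subset_maximalAtlas he')).comp
      ((contMDiffOn_symm_of_mem_maximalAtlas (I := 𝓡 n) (n := ∞)
        (IsManifold.subset_maximalAtlas he)).mono fun z hz => ?_) fun z hz => ?_
    · simp only [OpenPartialHomeomorph.trans_source, Set.mem_inter_iff] at hz
      exact hz.1
    · simp only [OpenPartialHomeomorph.trans_source, Set.mem_inter_iff] at hz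
      exact hz.2
  have h2 := (contMDiffOn_iff_contDiffOn.1 h1).contDiffAt
    ((e.symm.trans e').open_source.mem_nhds hy)
  exact h2.differentiableAt (by simp)

theorem continuousOn_chartJacobian {h : Fin n → M → ℝ}
    (hh : ∀ i, ContMDiff (𝓡 n) 𝓘(ℝ, ℝ) ∞ (h i))
    {e : OpenPartialHomeomorph M (EuclideanSpace ℝ (Fin n))}
    (he : e ∈ atlas (EuclideanSpace ℝ (Fin n)) M) :
    ContinuousOn (chartJacobian h e) e.target :=
  continuousOn_jacobianDet e.open_target fun i => (hh i).contDiffOn_comp_symm he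

theorem chartJacobian_eq_mul_det {h : Fin n → M → ℝ} (hh : ∀ i, ContMDiff (𝓡 n) 𝓘(ℝ, ℝ) ∞ (h i))
    {e e' : OpenPartialHomeomorph M (EuclideanSpace ℝ (Fin n))}
    (he : e ∈ atlas (EuclideanSpace ℝ (Fin n)) M) (he' : e' ∈ atlas (EuclideanSpace ℝ (Fin n)) M)
    {y : EuclideanSpace ℝ (Fin n)} (hy : y ∈ (e.symm.trans e').source) :
    chartJacobian h e y =
      chartJacobian h e' (e.symm.trans e' y) * (fderiv ℝ (e.symm.trans e') y).det := by
  have hT := differentiableAt_trans_symm he he' hy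
  have hev : ∀ i, h i ∘ e.symm =ᶠ[nhds y] (h i ∘ e'.symm) ∘ (e.symm.trans e') := by
    intro i
    filter_upwards [(e.symm.trans e').open_source.mem_nhds hy] with z hz
    simp only [OpenPartialHomeomorph.trans_source, Set.mem_inter_iff, Set.mem_preimage] at hz
    simp [e'.left_inv hz.2]
  have hmem : (e.symm.trans e') y ∈ e'.target := by
    simp only [OpenPartialHomeomorph.trans_source, Set.mem_inter_iff, Set.mem_preimage] at hy
    exact e'.map_source hy.2
  have hd : ∀ i, fderiv ℝ (h i ∘ e.symm) y =
      (fderiv ℝ (h i ∘ e'.symm) (e.symm.trans e' y)).comp (fderiv ℝ (e.symm.trans e') y) := by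
    intro i
    rw [(hev i).fderiv_eq, fderiv_comp _ _ hT]
    exact (((hh i).contDiffOn_comp_symm he').contDiffAt
      (e'.open_target.mem_nhds hmem)).differentiableAt (by simp)
  rw [chartJacobian, jacobianDet, chartJacobian, jacobianDet, ← det_of_clm_comp]
  simp only [hd, ContinuousLinearMap.comp_apply]

/-- The integral of an `n`-form supported in the intersection of the domains of two charts can be
computed in either of them. -/
theorem chartIntegral_eq_chartIntegral (hor : IsOrientedAtlas n M) {h : Fin n → M → ℝ}
    (hh : ∀ i, ContMDiff (𝓡 n) 𝓘(ℝ, ℝ) ∞ (h i))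
    {e e' : OpenPartialHomeomorph M (EuclideanSpace ℝ (Fin n))}
    (he : e ∈ atlas (EuclideanSpace ℝ (Fin n)) M) (he' : e' ∈ atlas (EuclideanSpace ℝ (Fin n)) M)
    {ψ : M → ℝ}
    (h1 : ∀ y ∈ e.target, e.symm y ∉ e'.source → ψ (e.symm y) * chartJacobian h e y = 0)
    (h2 : ∀ y ∈ e'.target, e'.symm y ∉ e.source → ψ (e'.symm y) * chartJacobian h e' y = 0) :
    chartIntegral e ψ h = chartIntegral e' ψ h := by
  have hs : (e.symm.trans e').source = e.target ∩ e.symm ⁻¹' e'.source := by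
    simp
  have ht : (e.symm.trans e').target = e'.target ∩ e'.symm ⁻¹' e.source := by
    simp
  rw [chartIntegral, chartIntegral,
    MeasureTheory.setIntegral_eq_of_subset_of_forall_sdiff_eq_zero
      (s := (e.symm.trans e').source) e.open_target.measurableSet (by rw [hs]; simp) ?_,
    MeasureTheory.setIntegral_eq_of_subset_of_forall_sdiff_eq_zero
      (s := (e.symm.trans e').target) e'.open_target.measurableSet (by rw [ht]; simp) ?_,
    MeasureTheory.integral_target_eq_integral_abs_det_fderiv_smul MeasureTheory.volume
      fun x hx => (differentiableAt_trans_symm he he' hx).hasFDerivAt]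
  · refine MeasureTheory.setIntegral_congr_fun (e.symm.trans e').open_source.measurableSet
      fun y hy => ?_
    have hpos := hor e he e' he' y hy
    rw [chartJacobian_eq_mul_det hh he he' hy, abs_of_pos hpos, smul_eq_mul]
    have : e'.symm ((e.symm.trans e') y) = e.symm y := by
      rw [hs] at hy
      simp [e'.left_inv hy.2]
    rw [this]
    ring
  · intro y hy
    rw [ht] at hy
    exact h2 y hy.1 fun hc => hy.2 ⟨hy.1, hc⟩
  · intro y hy
    rw [hs] at hy
    exact h1 y hy.1 fun hc => hy.2 ⟨hy.1, hc⟩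

/-- Stokes' theorem for an exact form whose primitive is supported in the domain of a chart. -/
theorem integral_chartJacobian_update_eq_zero [T2Space M] {h : Fin n → M → ℝ}
    (hh : ∀ i, ContMDiff (𝓡 n) 𝓘(ℝ, ℝ) ∞ (h i))
    {e : OpenPartialHomeomorph M (EuclideanSpace ℝ (Fin n))}
    (he : e ∈ atlas (EuclideanSpace ℝ (Fin n)) M) (i₀ : Fin n) {ψ : M → ℝ}
    (hψ : ContMDiff (𝓡 n) 𝓘(ℝ, ℝ) ∞ ψ) (hc : HasCompactSupport ψ) (hs : tsupport ψ ⊆ e.source) :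
    ∫ y in e.target, chartJacobian (Function.update h i₀ ψ) e y = 0 := by
  -- a cutoff function `χ` extends the functions in the chart to smooth functions on `ℝⁿ`
  set K := e '' tsupport ψ with hK
  have hKt : K ⊆ e.target := by
    rintro _ ⟨x, hx, rfl⟩
    exact e.map_source (hs hx)
  have hKc : IsCompact K := IsCompact.image_of_continuousOn hc (e.continuousOn.mono hs)
  obtain ⟨t, htc, hKt', htt⟩ := exists_compact_between hKc e.open_target hKt
  obtain ⟨χ, hχ1, hχ0, -⟩ := exists_contMDiffMap_one_nhds_of_subset_interior
    (𝓡 n) (n := ⊤) (s := K) (t := t) hKc.isClosed hKt'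
  have hχs : ContDiff ℝ ∞ χ := contMDiff_iff_contDiff.1 χ.contMDiff
  set g : Fin n → EuclideanSpace ℝ (Fin n) → ℝ := fun i y =>
    χ y * (Function.update h i₀ ψ i ∘ e.symm) y with hg
  have hupd : ∀ i, ContMDiff (𝓡 n) 𝓘(ℝ, ℝ) ∞ (Function.update h i₀ ψ i) := by
    intro i
    by_cases hi : i = i₀
    · subst hi; simpa using hψ
    · simpa [hi] using hh i
  have hgs : ∀ i, ContDiff ℝ ∞ (g i) := by
    intro i
    rw [contDiff_iff_contDiffAt]
    intro y
    by_cases hy : y ∈ e.target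
    · exact hχs.contDiffAt.mul (((hupd i).contDiffOn_comp_symm he).contDiffAt
        (e.open_target.mem_nhds hy))
    · have : g i =ᶠ[nhds y] fun _ => 0 := by
        filter_upwards [htc.isClosed.isOpen_compl.mem_nhds fun hyt => hy (htt hyt)] with z hz
        simp [hg, hχ0 z hz]
      exact contDiffAt_const.congr_of_eventuallyEq this
  have hgc : HasCompactSupport (g i₀) :=
    HasCompactSupport.intro htc fun y hy => by simp [hg, hχ0 y hy]
  rw [← integral_jacobianDet_eq_zero hgs hgc,
    ← MeasureTheory.setIntegral_eq_integral_of_forall_compl_eq_zero (s := e.target)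
      (f := jacobianDet g)]
  · refine MeasureTheory.setIntegral_congr_fun e.open_target.measurableSet fun y hy => ?_
    by_cases hyK : y ∈ K
    · refine jacobianDet_congr fun i => ?_
      have := hχ1.filter_mono (nhds_le_nhdsSet hyK)
      filter_upwards [this] with z hz
      simp [hg, hz]
    · have hz : ψ ∘ e.symm =ᶠ[nhds y] fun _ => 0 := by
        have hopen := e.isOpen_inter_preimage_symm (isClosed_tsupport ψ).isOpen_compl
        filter_upwards [hopen.mem_nhds ⟨hy, fun hc => hyK ⟨_, hc, e.right_inv hy⟩⟩] with z hz
        exact image_eq_zero_of_notMem_tsupport (f := ψ) hz.2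
      have hz' : g i₀ =ᶠ[nhds y] fun _ => 0 := by
        filter_upwards [hz] with z hz
        simp only [Function.comp_apply] at hz
        simp [hg, hz]
      have hd : fderiv ℝ (ψ ∘ e.symm) y = 0 := by rw [hz.fderiv_eq]; simp
      have hd' : fderiv ℝ (g i₀) y = 0 := by rw [hz'.fderiv_eq]; simp
      rw [chartJacobian_update, jacobianDet_update_eq_zero _ _ hd,
        ← Function.update_eq_self i₀ g, jacobianDet_update_eq_zero _ _ hd']
  · intro y hy
    have hz' : g i₀ =ᶠ[nhds y] fun _ => 0 := by
      filter_upwards [htc.isClosed.isOpen_compl.mem_nhds fun hyt => hy (htt hyt)] with z hz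
      simp [hg, hχ0 z hz]
    have hd' : fderiv ℝ (g i₀) y = 0 := by rw [hz'.fderiv_eq]; simp
    rw [← Function.update_eq_self i₀ g, jacobianDet_update_eq_zero _ _ hd']

theorem exists_chartPartition [T2Space M] [SigmaCompactSpace M] {K : Set M} (hK : IsCompact K) :
    ∃ t : Finset M, Nonempty (ChartPartition (n := n) K t) := by
  obtain ⟨t, ht⟩ := hK.elim_finite_subcover
    (fun x : M => (chartAt (EuclideanSpace ℝ (Fin n)) x).source)
    (fun x => (chartAt _ x).open_source)
    fun x _ => Set.mem_iUnion.2 ⟨x, mem_chart_source _ x⟩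
  obtain ⟨f, hf⟩ := SmoothPartitionOfUnity.exists_isSubordinate (𝓡 n) (ι := t) hK.isClosed
    (fun x : t => (chartAt (EuclideanSpace ℝ (Fin n)) (x : M)).source)
    (fun x => (chartAt _ (x : M)).open_source) fun x hx => by
      obtain ⟨i, hi, hxi⟩ := Set.mem_iUnion₂.1 (ht hx)
      exact Set.mem_iUnion.2 ⟨⟨i, hi⟩, hxi⟩
  exact ⟨t, ⟨{
    chart := fun a => chartAt _ (a : M)
    chart_mem := fun a => chart_mem_atlas _ _
    weight := fun a => f a
    smooth := fun a => (f a).contMDiff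
    nonneg := fun a x => f.nonneg a x
    le_one := fun a x => f.le_one a x
    tsupport_subset := hf
    sum_eq_one := fun x hx => by
      rw [← finsum_eq_sum_of_fintype]
      exact f.sum_eq_one hx }⟩⟩

end smooth

end Manifold

section Manifold

variable {n : ℕ} {M : Type*} [TopologicalSpace M]

theorem chartJacobian_update_eq_zero_of_notMem_tsupport (h : Fin n → M → ℝ) (i₀ : Fin n)
    {f : M → ℝ} {e : OpenPartialHomeomorph M (EuclideanSpace ℝ (Fin n))}
    {y : EuclideanSpace ℝ (Fin n)} (hy : y ∈ e.target) (hf : e.symm y ∉ tsupport f) :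
    chartJacobian (Function.update h i₀ f) e y = 0 := by
  rw [chartJacobian_update]
  apply jacobianDet_update_eq_zero
  have hz : f ∘ e.symm =ᶠ[nhds y] fun _ => 0 := by
    have hopen := e.isOpen_inter_preimage_symm (isClosed_tsupport f).isOpen_compl
    filter_upwards [hopen.mem_nhds ⟨hy, hf⟩] with z hz
    exact image_eq_zero_of_notMem_tsupport (f := f) hz.2
  rw [hz.fderiv_eq]
  simp

variable [ChartedSpace (EuclideanSpace ℝ (Fin n)) M]

theorem contMDiff_update {h : Fin n → M → ℝ} (hh : ∀ i, ContMDiff (𝓡 n) 𝓘(ℝ, ℝ) ∞ (h i))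
    {f : M → ℝ} (hf : ContMDiff (𝓡 n) 𝓘(ℝ, ℝ) ∞ f) (i₀ i : Fin n) :
    ContMDiff (𝓡 n) 𝓘(ℝ, ℝ) ∞ (Function.update h i₀ f i) := by
  by_cases hi : i = i₀
  · subst hi; simpa using hf
  · simpa [hi] using hh i

variable [IsManifold (𝓡 n) ∞ M]

theorem differentiableAt_comp_symm {f : M → ℝ} (hf : ContMDiff (𝓡 n) 𝓘(ℝ, ℝ) ∞ f)
    {e : OpenPartialHomeomorph M (EuclideanSpace ℝ (Fin n))}
    (he : e ∈ atlas (EuclideanSpace ℝ (Fin n)) M) {y : EuclideanSpace ℝ (Fin n)}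
    (hy : y ∈ e.target) : DifferentiableAt ℝ (f ∘ e.symm) y :=
  ((hf.contDiffOn_comp_symm he).contDiffAt (e.open_target.mem_nhds hy)).differentiableAt (by simp)

/-- The Leibniz rule `d(fg) ∧ ⋯ = f dg ∧ ⋯ + g df ∧ ⋯`. -/
theorem chartJacobian_update_mul (h : Fin n → M → ℝ) (i₀ : Fin n) {f g : M → ℝ}
    (hf : ContMDiff (𝓡 n) 𝓘(ℝ, ℝ) ∞ f) (hg : ContMDiff (𝓡 n) 𝓘(ℝ, ℝ) ∞ g)
    {e : OpenPartialHomeomorph M (EuclideanSpace ℝ (Fin n))}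
    (he : e ∈ atlas (EuclideanSpace ℝ (Fin n)) M) {y : EuclideanSpace ℝ (Fin n)}
    (hy : y ∈ e.target) :
    chartJacobian (Function.update h i₀ (f * g)) e y =
      f (e.symm y) * chartJacobian (Function.update h i₀ g) e y +
        g (e.symm y) * chartJacobian (Function.update h i₀ f) e y := by
  have hd := fderiv_mul (differentiableAt_comp_symm hf he hy) (differentiableAt_comp_symm hg he hy)
  have hfun : (f * g) ∘ e.symm = (f ∘ e.symm) * (g ∘ e.symm) := rfl
  have hrow : (fun j => fderiv ℝ ((f * g) ∘ e.symm) y (EuclideanSpace.single j 1)) =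
      f (e.symm y) • (fun j : Fin n => fderiv ℝ (g ∘ e.symm) y (EuclideanSpace.single j 1)) +
        g (e.symm y) • (fun j => fderiv ℝ (f ∘ e.symm) y (EuclideanSpace.single j 1)) := by
    ext j
    rw [hfun, hd]
    simp
  simp only [chartJacobian_update, jacobianDet_update]
  rw [hrow, map_add, map_smul, map_smul]
  simp

/-- Functions which sum up to a constant near a point have differentials which sum up to zero. -/
theorem sum_chartJacobian_update_eq_zero {α : Type*} [Fintype α] (h : Fin n → M → ℝ) (i₀ : Fin n)
    {f : α → M → ℝ} (hf : ∀ a, ContMDiff (𝓡 n) 𝓘(ℝ, ℝ) ∞ (f a))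
    {e : OpenPartialHomeomorph M (EuclideanSpace ℝ (Fin n))}
    (he : e ∈ atlas (EuclideanSpace ℝ (Fin n)) M) {y : EuclideanSpace ℝ (Fin n)}
    (hy : y ∈ e.target) {U : Set M} (hU : IsOpen U) (hyU : e.symm y ∈ U)
    (hsum : ∀ x ∈ U, ∑ a, f a x = 1) :
    ∑ a, chartJacobian (Function.update h i₀ (f a)) e y = 0 := by
  have hd : ∑ a, fderiv ℝ (f a ∘ e.symm) y = 0 := by
    rw [← fderiv_fun_sum fun a _ => differentiableAt_comp_symm (hf a) he hy]
    have hz : (fun z => ∑ a, (f a ∘ e.symm) z) =ᶠ[nhds y] fun _ => 1 := by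
      filter_upwards [(e.isOpen_inter_preimage_symm hU).mem_nhds ⟨hy, hyU⟩] with z hz
      exact hsum _ hz.2
    rw [hz.fderiv_eq]
    simp
  simp only [chartJacobian_update, jacobianDet_update]
  rw [← Finset.sum_apply, ← map_sum]
  have : ∑ a, (fun j : Fin n => fderiv ℝ (f a ∘ e.symm) y (EuclideanSpace.single j 1)) = 0 := by
    ext j
    rw [Finset.sum_apply, ← sum_apply, hd]
    simp
  rw [this, map_zero, Pi.zero_apply]

/-- Stokes' theorem on an oriented manifold, for the form `dR ∧ ⋯`: its integral, computed with a
partition of unity, vanishes when `R` has compact support. -/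
theorem sum_chartIntegral_update_eq_zero [T2Space M] (hor : IsOrientedAtlas n M)
    {h : Fin n → M → ℝ} (hh : ∀ i, ContMDiff (𝓡 n) 𝓘(ℝ, ℝ) ∞ (h i)) (i₀ : Fin n) {R : M → ℝ}
    (hR : ContMDiff (𝓡 n) 𝓘(ℝ, ℝ) ∞ R) (hc : HasCompactSupport R) {α : Type*} [Fintype α]
    {K : Set M} (hRK : Function.support R ⊆ K) (P : ChartPartition (n := n) K α) :
    ∑ a, chartIntegral (P.chart a) (P.weight a) (Function.update h i₀ R) = 0 := by
  have hsub : ∀ a, tsupport R ∩ tsupport (P.weight a) ⊆ (P.chart a).source := fun a =>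
    Set.inter_subset_right.trans (P.tsupport_subset a)
  have hcomp : ∀ a, IsCompact (tsupport R ∩ tsupport (P.weight a)) := fun a =>
    IsCompact.inter_right hc (isClosed_tsupport _)
  have hcont : ∀ (f : M → ℝ), ContMDiff (𝓡 n) 𝓘(ℝ, ℝ) ∞ f → ∀ a,
      ContinuousOn (fun y => f ((P.chart a).symm y)) (P.chart a).target := fun f hf a =>
    hf.continuous.comp_continuousOn (P.chart a).continuousOn_symm
  have hJ : ∀ (f : M → ℝ), ContMDiff (𝓡 n) 𝓘(ℝ, ℝ) ∞ f → ∀ a,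
      ContinuousOn (chartJacobian (Function.update h i₀ f) (P.chart a)) (P.chart a).target :=
    fun f hf a => continuousOn_chartJacobian (contMDiff_update hh hf i₀) (P.chart_mem a)
  -- integration by parts in each chart
  have h1 : ∀ a, chartIntegral (P.chart a) (P.weight a) (Function.update h i₀ R) =
      - chartIntegral (P.chart a) R (Function.update h i₀ (P.weight a)) := by
    intro a
    have hprod : HasCompactSupport (P.weight a * R) := hc.mul_left
    have hps : tsupport (P.weight a * R) ⊆ (P.chart a).source :=
      (tsupport_mul_subset_left (f := P.weight a) (g := R)).trans (P.tsupport_subset a)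
    have h0 := integral_chartJacobian_update_eq_zero hh (P.chart_mem a) i₀
      ((P.smooth a).mul hR) hprod hps
    have hexp : ∀ y ∈ (P.chart a).target,
        chartJacobian (Function.update h i₀ (P.weight a * R)) (P.chart a) y =
          P.weight a ((P.chart a).symm y) *
            chartJacobian (Function.update h i₀ R) (P.chart a) y +
          R ((P.chart a).symm y) *
            chartJacobian (Function.update h i₀ (P.weight a)) (P.chart a) y := fun y hy =>
      chartJacobian_update_mul h i₀ (P.smooth a) hR (P.chart_mem a) hy
    rw [MeasureTheory.setIntegral_congr_fun (P.chart a).open_target.measurableSet hexp,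
      MeasureTheory.integral_add] at h0
    · exact eq_neg_of_add_eq_zero_left h0
    · refine integrableOn_target_of_continuousOn _ ((hcont _ (P.smooth a) a).mul (hJ R hR a))
        (hcomp a) (hsub a) fun y hy hyK => ?_
      by_cases hyR : (P.chart a).symm y ∈ tsupport R
      · rw [image_eq_zero_of_notMem_tsupport fun hw => hyK ⟨hyR, hw⟩, zero_mul]
      · rw [chartJacobian_update_eq_zero_of_notMem_tsupport h i₀ hy hyR, mul_zero]
    · refine integrableOn_target_of_continuousOn _ ((hcont _ hR a).mul (hJ _ (P.smooth a) a))
        (hcomp a) (hsub a) fun y hy hyK => ?_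
      by_cases hyR : (P.chart a).symm y ∈ tsupport R
      · rw [chartJacobian_update_eq_zero_of_notMem_tsupport h i₀ hy fun hw => hyK ⟨hyR, hw⟩,
          mul_zero]
      · rw [image_eq_zero_of_notMem_tsupport hyR, zero_mul]
  -- the integral of `ψ_b R dψ_a ∧ ⋯` is the same in the chart `a` and in the chart `b`, where the
  -- sum over `a` is zero
  have hint : ∀ a b c, c = a ∨ c = b → MeasureTheory.IntegrableOn
      (fun y => (P.weight b * R) ((P.chart c).symm y) *
        chartJacobian (Function.update h i₀ (P.weight a)) (P.chart c) y) (P.chart c).target := by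
    intro a b c habc
    refine integrableOn_target_of_continuousOn (P.chart c)
      ((hcont _ ((P.smooth b).mul hR) c).mul (hJ _ (P.smooth a) c))
      (hcomp c) (hsub c) fun y hy hyK => ?_
    by_cases hyR : (P.chart c).symm y ∈ tsupport R
    · have hw : (P.chart c).symm y ∉ tsupport (P.weight c) := fun hw => hyK ⟨hyR, hw⟩
      rcases habc with rfl | rfl
      · rw [chartJacobian_update_eq_zero_of_notMem_tsupport h i₀ hy hw, mul_zero]
      · rw [Pi.mul_apply, image_eq_zero_of_notMem_tsupport hw, zero_mul, zero_mul]
    · rw [Pi.mul_apply, image_eq_zero_of_notMem_tsupport hyR, mul_zero, zero_mul]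
  have hsumR : ∀ x, ∑ b, (P.weight b * R) x = R x := by
    intro x
    by_cases hx : R x = 0
    · simp [hx]
    · simp only [Pi.mul_apply]
      rw [← Finset.sum_mul, P.sum_eq_one x (hRK hx), one_mul]
  have h2 : ∀ a, chartIntegral (P.chart a) R (Function.update h i₀ (P.weight a)) =
      ∑ b, chartIntegral (P.chart a) (P.weight b * R) (Function.update h i₀ (P.weight a)) := by
    intro a
    simp only [chartIntegral]
    rw [← MeasureTheory.integral_finsetSum _ fun b _ => hint a b a (Or.inl rfl)]
    simp only [← Finset.sum_mul, hsumR]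
  have h3 : ∀ a b,
      chartIntegral (P.chart a) (P.weight b * R) (Function.update h i₀ (P.weight a)) =
      chartIntegral (P.chart b) (P.weight b * R) (Function.update h i₀ (P.weight a)) := by
    intro a b
    refine chartIntegral_eq_chartIntegral hor (contMDiff_update hh (P.smooth a) i₀)
      (P.chart_mem a) (P.chart_mem b) (fun y _ hy => ?_) fun y hyt hy => ?_
    · rw [Pi.mul_apply, image_eq_zero_of_notMem_tsupport fun hw => hy (P.tsupport_subset b hw),
        zero_mul, zero_mul]
    · rw [chartJacobian_update_eq_zero_of_notMem_tsupport h i₀ hyt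
        fun hw => hy (P.tsupport_subset a hw), mul_zero]
  simp only [h1, h2, Finset.sum_neg_distrib]
  rw [Finset.sum_comm, neg_eq_zero]
  refine Finset.sum_eq_zero fun b _ => ?_
  rw [Finset.sum_congr rfl fun a _ => h3 a b]
  simp only [chartIntegral]
  rw [← MeasureTheory.integral_finsetSum _ fun a _ => hint a b b (Or.inr rfl)]
  simp only [← Finset.mul_sum]
  refine MeasureTheory.setIntegral_eq_zero_of_forall_eq_zero fun y hy => ?_
  by_cases hx : R ((P.chart b).symm y) = 0
  · rw [Pi.mul_apply, hx, mul_zero, zero_mul]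
  · rw [sum_chartJacobian_update_eq_zero h i₀ P.smooth (P.chart_mem b) hy
      (hR.continuous.isOpen_support) hx fun x hx => P.sum_eq_one x (hRK hx), mul_zero]

/-- The form `φ(G) dG₁ ∧ ⋯ ∧ dGₙ`, restricted to an open set `Z` on which `G` is injective and
`σ dG₁ ∧ ⋯ ∧ dGₙ` is positive, with `σ = ±1`, has integral `σ ∫ φ` as soon as `G(Z)` contains the
support of `φ`. -/
theorem sum_chartIntegral_indicator {Z : Set M} (hZ : IsOpen Z) {G : Fin n → M → ℝ}
    (hG : ∀ i, ContMDiff (𝓡 n) 𝓘(ℝ, ℝ) ∞ (G i))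
    (hinj : Set.InjOn (fun x => WithLp.toLp 2 fun i => G i x : M → EuclideanSpace ℝ (Fin n)) Z)
    {σ : ℝ} (hσ : |σ| = 1)
    (hpos : ∀ e ∈ atlas (EuclideanSpace ℝ (Fin n)) M, ∀ y ∈ e.target, e.symm y ∈ Z →
      0 < σ * chartJacobian G e y)
    {φ : EuclideanSpace ℝ (Fin n) → ℝ} (hφ : MeasureTheory.Integrable φ)
    (hsurj : ∀ z, φ z ≠ 0 → ∃ x ∈ Z, WithLp.toLp 2 (fun i => G i x) = z) {α : Type*} [Fintype α]
    {K : Set M} (hK : ∀ x ∈ Z, φ (WithLp.toLp 2 fun i => G i x) ≠ 0 → x ∈ K)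
    (P : ChartPartition (n := n) K α) :
    (∀ a, MeasureTheory.IntegrableOn (fun y => P.weight a ((P.chart a).symm y) *
      Z.indicator (fun x => φ (WithLp.toLp 2 fun i => G i x)) ((P.chart a).symm y) *
        chartJacobian G (P.chart a) y) (P.chart a).target) ∧
    ∑ a, chartIntegral (P.chart a)
      (fun x => P.weight a x * Z.indicator (fun x => φ (WithLp.toLp 2 fun i => G i x)) x) G =
        σ * ∫ z, φ z := by
  classical
  rcases isEmpty_or_nonempty M with hM | hM
  · have hφ0 : φ = 0 := by
      ext z
      by_contra hz
      obtain ⟨x, -⟩ := hsurj z hz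
      exact hM.elim x
    refine ⟨fun a => ?_, ?_⟩
    · have : (P.chart a).target = ∅ := by
        ext y
        simpa using fun _ => hM.elim ((P.chart a).symm y)
      rw [this]
      exact MeasureTheory.integrableOn_empty
    · refine (Finset.sum_eq_zero fun a _ => ?_).trans (by simp [hφ0])
      refine MeasureTheory.setIntegral_eq_zero_of_forall_eq_zero fun y hy => ?_
      exact hM.elim ((P.chart a).symm y)
  set Γ : M → EuclideanSpace ℝ (Fin n) := fun x => WithLp.toLp 2 fun i => G i x with hΓ
  -- the weights are transported to `ℝⁿ` by the inverse `τ` of `Γ` on `Z`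
  set τ := Function.invFunOn Γ Z with hτ
  have hτΓ : ∀ x ∈ Z, τ (Γ x) = x := fun x hx => hinj.leftInvOn_invFunOn hx
  set s : α → Set (EuclideanSpace ℝ (Fin n)) := fun a =>
    (P.chart a).target ∩ (P.chart a).symm ⁻¹' Z with hs
  have hsm : ∀ a, MeasurableSet (s a) := fun a =>
    ((P.chart a).isOpen_inter_preimage_symm hZ).measurableSet
  have hd : ∀ a, ∀ y ∈ s a, HasFDerivWithinAt (fun y => Γ ((P.chart a).symm y))
      (fderiv ℝ (fun y => Γ ((P.chart a).symm y)) y) (s a) y := by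
    intro a y hy
    have hdiff : DifferentiableAt ℝ (fun y => Γ ((P.chart a).symm y)) y := by
      rw [differentiableAt_euclidean]
      exact fun i => differentiableAt_comp_symm (hG i) (P.chart_mem a) hy.1
    exact hdiff.hasFDerivAt.hasFDerivWithinAt
  have hdet : ∀ a, ∀ y ∈ s a, (fderiv ℝ (fun y => Γ ((P.chart a).symm y)) y).det =
      chartJacobian G (P.chart a) y := by
    intro a y hy
    rw [det_eq_det_of_proj, chartJacobian, jacobianDet]
    congr 1
    ext i j
    have h1 : HasFDerivAt (G i ∘ (P.chart a).symm) ((EuclideanSpace.proj (𝕜 := ℝ) i).comp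
        (fderiv ℝ (fun y => Γ ((P.chart a).symm y)) y)) y :=
      (EuclideanSpace.proj (𝕜 := ℝ) i).hasFDerivAt.comp y
        ((hd a y hy).hasFDerivAt (((P.chart a).isOpen_inter_preimage_symm hZ).mem_nhds hy))
    simp [h1.fderiv]
  have hsinj : ∀ a, Set.InjOn (fun y => Γ ((P.chart a).symm y)) (s a) := by
    intro a y hy y' hy' hyy
    exact (P.chart a).symm.injOn hy.1 hy'.1 (hinj hy.2 hy'.2 hyy)
  have habs : ∀ a, ∀ y ∈ s a, |chartJacobian G (P.chart a) y| =
      σ * chartJacobian G (P.chart a) y := by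
    intro a y hy
    have := hpos _ (P.chart_mem a) y hy.1 hy.2
    rw [← abs_of_pos this, abs_mul, hσ, one_mul]
  have hσ2 : σ * σ = 1 := by
    rw [← abs_mul_abs_self, hσ, one_mul]
  -- the integrand on the part of the chart lying in `Z`
  have hI1 : ∀ a, MeasureTheory.IntegrableOn (fun y =>
      |(fderiv ℝ (fun y => Γ ((P.chart a).symm y)) y).det| •
        (P.weight a (τ (Γ ((P.chart a).symm y))) * φ (Γ ((P.chart a).symm y)))) (s a) := by
    intro a
    have h1 := (MeasureTheory.integrableOn_image_iff_integrableOn_abs_det_fderiv_smul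
      MeasureTheory.volume (hsm a) (hd a) (hsinj a) φ).1 hφ.integrableOn
    have h2 : MeasureTheory.Integrable (fun y => P.weight a ((P.chart a).symm y) *
        (|(fderiv ℝ (fun y => Γ ((P.chart a).symm y)) y).det| • φ (Γ ((P.chart a).symm y))))
        (MeasureTheory.volume.restrict (s a)) := by
      refine MeasureTheory.Integrable.bdd_mul (c := 1) h1 ?_ ?_
      · refine ContinuousOn.aestronglyMeasurable ?_ (hsm a)
        exact (P.smooth a).continuous.comp_continuousOn
          ((P.chart a).continuousOn_symm.mono Set.inter_subset_left)
      · refine Filter.Eventually.of_forall fun y => ?_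
        rw [Real.norm_of_nonneg (P.nonneg a _)]
        exact P.le_one a _
    refine MeasureTheory.IntegrableOn.congr_fun h2 (fun y hy => ?_) (hsm a)
    simp only [smul_eq_mul]
    rw [hτΓ _ hy.2]
    ring
  have hI2 : ∀ a, MeasureTheory.IntegrableOn (fun z => P.weight a (τ z) * φ z)
      ((fun y => Γ ((P.chart a).symm y)) '' s a) := fun a =>
    (MeasureTheory.integrableOn_image_iff_integrableOn_abs_det_fderiv_smul
      MeasureTheory.volume (hsm a) (hd a) (hsinj a) fun z => P.weight a (τ z) * φ z).2 (hI1 a)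
  have hzero : ∀ a, ∀ z ∉ (fun y => Γ ((P.chart a).symm y)) '' s a,
      P.weight a (τ z) * φ z = 0 := by
    intro a z hz
    by_contra hne
    obtain ⟨x, hx, rfl⟩ := hsurj z (right_ne_zero_of_mul hne)
    have hw : P.weight a x ≠ 0 := by
      have := left_ne_zero_of_mul hne
      rwa [show τ (WithLp.toLp 2 fun i => G i x) = x from hτΓ x hx] at this
    have hxs : x ∈ (P.chart a).source := P.tsupport_subset a (subset_tsupport _ hw)
    refine hz ⟨P.chart a x, ⟨(P.chart a).map_source hxs, ?_⟩, ?_⟩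
    · simpa [(P.chart a).left_inv hxs] using hx
    · simp [(P.chart a).left_inv hxs, hΓ]
  have hI3 : ∀ a, MeasureTheory.Integrable (fun z => P.weight a (τ z) * φ z) := fun a =>
    (hI2 a).integrable_of_forall_notMem_eq_zero (hzero a)
  have hfun : ∀ a, ∀ y ∈ s a, P.weight a ((P.chart a).symm y) *
      Z.indicator (fun x => φ (Γ x)) ((P.chart a).symm y) * chartJacobian G (P.chart a) y =
      σ * (|(fderiv ℝ (fun y => Γ ((P.chart a).symm y)) y).det| •
        (P.weight a (τ (Γ ((P.chart a).symm y))) * φ (Γ ((P.chart a).symm y)))) := by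
    intro a y hy
    have hyZ : (P.chart a).symm y ∈ Z := hy.2
    rw [hdet a y hy, habs a y hy, hτΓ _ hyZ, Set.indicator_of_mem hyZ, smul_eq_mul]
    linear_combination (-(P.weight a ((P.chart a).symm y) * φ (Γ ((P.chart a).symm y)) *
      chartJacobian G (P.chart a) y)) * hσ2
  have hoff : ∀ a, ∀ y ∈ (P.chart a).target \ s a, P.weight a ((P.chart a).symm y) *
      Z.indicator (fun x => φ (Γ x)) ((P.chart a).symm y) * chartJacobian G (P.chart a) y = 0 := by
    intro a y hy
    have hyZ : (P.chart a).symm y ∉ Z := fun hc => hy.2 ⟨hy.1, hc⟩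
    rw [Set.indicator_of_notMem hyZ]
    ring
  refine ⟨fun a => ?_, ?_⟩
  · refine MeasureTheory.IntegrableOn.of_forall_sdiff_eq_zero (s := s a) ?_
      (P.chart a).open_target.measurableSet (hoff a)
    exact MeasureTheory.IntegrableOn.congr_fun ((hI1 a).const_mul σ)
      (fun y hy => (hfun a y hy).symm) (hsm a)
  · have hint : ∀ a, chartIntegral (P.chart a)
        (fun x => P.weight a x * Z.indicator (fun x => φ (Γ x)) x) G =
        σ * ∫ z, P.weight a (τ z) * φ z := by
      intro a
      rw [chartIntegral, MeasureTheory.setIntegral_eq_of_subset_of_forall_sdiff_eq_zero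
        (s := s a) (P.chart a).open_target.measurableSet Set.inter_subset_left (hoff a),
        MeasureTheory.setIntegral_congr_fun (hsm a) (hfun a), MeasureTheory.integral_const_mul,
        ← MeasureTheory.integral_image_eq_integral_abs_det_fderiv_smul MeasureTheory.volume
          (hsm a) (hd a) (hsinj a) fun z => P.weight a (τ z) * φ z,
        MeasureTheory.setIntegral_eq_integral_of_forall_compl_eq_zero (hzero a)]
    refine (Finset.sum_congr rfl fun a _ => hint a).trans ?_
    rw [← Finset.mul_sum, ← MeasureTheory.integral_finsetSum _ fun a _ => hI3 a]
    congr 2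
    ext z
    rw [← Finset.sum_mul]
    by_cases hz : φ z = 0
    · rw [hz, mul_zero]
    · obtain ⟨x, hx, rfl⟩ := hsurj z hz
      rw [show τ (WithLp.toLp 2 fun i => G i x) = x from hτΓ x hx, P.sum_eq_one x (hK x hx hz),
        one_mul]

end Manifold

/-! ### Bases of the lattice `ℤⁿ` -/

/-- The linear functional on `ℝⁿ` with given integral coefficients. -/
noncomputable def intForm {n : ℕ} (a : Fin n → ℤ) : BaseSpace n →L[ℝ] ℝ :=
  ∑ j, (a j : ℝ) • EuclideanSpace.proj (𝕜 := ℝ) j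

theorem intForm_apply {n : ℕ} (a : Fin n → ℤ) (q : BaseSpace n) :
    intForm a q = ∑ j, (a j : ℝ) * q j := by
  simp [intForm, sum_apply]

/-- A basis of `ℝⁿ` which is a `ℤ`-basis of `ℤⁿ`. -/
structure IsLatticeBasis {n : ℕ} (b : Module.Basis (Fin n) ℝ (BaseSpace n)) : Prop where
  mem_integralVectors : ∀ i, b i ∈ integralVectors n
  repr_eq_int : ∀ v ∈ integralVectors n, ∀ i, ∃ m : ℤ, b.repr v i = m

theorem IsLatticeBasis.reindex {n : ℕ} {b : Module.Basis (Fin n) ℝ (BaseSpace n)}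
    (hb : IsLatticeBasis b) (e : Equiv.Perm (Fin n)) : IsLatticeBasis (b.reindex e) where
  mem_integralVectors i := by simpa using hb.mem_integralVectors _
  repr_eq_int v hv i := by simpa using hb.repr_eq_int v hv _

theorem int_smul_mem_integralVectors {n : ℕ} {v : BaseSpace n} (hv : v ∈ integralVectors n)
    (m : ℤ) : (m : ℝ) • v ∈ integralVectors n := by
  intro i
  obtain ⟨c, hc⟩ := hv i
  exact ⟨m * c, by simp [hc]⟩

/-- The dual basis of a lattice basis is a lattice basis. -/
theorem IsLatticeBasis.exists_inner_eq {n : ℕ} {b : Module.Basis (Fin n) ℝ (BaseSpace n)}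
    (hb : IsLatticeBasis b) (c : Fin n → ℤ) :
    ∃ ζ ∈ integralVectors n, ∀ j, inner ℝ ζ (b j) = c j := by
  have hs : ∀ j : Fin n, (EuclideanSpace.single j 1 : BaseSpace n) ∈ integralVectors n := by
    intro j i
    refine ⟨if i = j then 1 else 0, ?_⟩
    by_cases h : i = j <;> simp [h]
  choose C hC using fun i j => hb.repr_eq_int _ (hs j) i
  have hrepr : ∀ i v, b.repr v i = ∑ j, (C i j : ℝ) * v j := by
    intro i v
    conv_lhs => rw [← (EuclideanSpace.basisFun (Fin n) ℝ).sum_repr v]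
    simp [map_sum, hC, mul_comm, Finsupp.finsetSum_apply]
  refine ⟨WithLp.toLp 2 fun j => ∑ i, (c i : ℝ) * C i j, fun j => ⟨∑ i, c i * C i j, ?_⟩,
    fun l => ?_⟩
  · simp
  · have h1 : inner ℝ (WithLp.toLp 2 fun j => ∑ i, (c i : ℝ) * C i j : BaseSpace n) (b l) =
        ∑ i, (c i : ℝ) * b.repr (b l) i := by
      simp only [hrepr, PiLp.inner_apply, Finset.mul_sum]
      rw [Finset.sum_comm]
      refine Finset.sum_congr rfl fun j _ => ?_
      simp only [RCLike.inner_apply, conj_trivial, Finset.mul_sum]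
      refine Finset.sum_congr rfl fun i _ => by ring
    rw [h1]
    simp [Finsupp.single_apply]

theorem mem_submodule_of_repr_eq_zero {n : ℕ} {b : Module.Basis (Fin n) ℝ (BaseSpace n)}
    (J : Set (Fin n)) {v : BaseSpace n} (hv : ∀ j ∈ J, b.repr v j = 0)
    (p : Submodule ℝ (BaseSpace n)) (hp : ∀ i ∉ J, b i ∈ p) : v ∈ p := by
  rw [← b.sum_repr v]
  refine Submodule.sum_mem _ fun i _ => ?_
  by_cases hi : i ∈ J
  · simp [hv i hi]
  · exact p.smul_mem _ (hp i hi)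

/-- The common kernel of integral linear forms is spanned by part of a basis of `ℤⁿ`, by the Smith
normal form. -/
theorem exists_isLatticeBasis {n : ℕ} {I : Type*} (a : I → Fin n → ℤ) :
    ∃ b : Module.Basis (Fin n) ℝ (BaseSpace n), IsLatticeBasis b ∧ ∃ J : Set (Fin n),
      ∀ v, (∀ i, intForm (a i) v = 0) ↔ ∀ j ∈ J, b.repr v j = 0 := by
  classical
  obtain ⟨r, bM, bN, f, d, hsnf⟩ :=
    (Submodule.span ℤ (Set.range a)).smithNormalForm (Pi.basisFun ℤ (Fin n))
  -- the dual of the Smith basis of the lattice spanned by the forms is a basis of the vectors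
  set C : Matrix (Fin n) (Fin n) ℤ := Matrix.of fun i j => bM i j with hC
  set D : Matrix (Fin n) (Fin n) ℤ := Matrix.of fun j i => bM.repr (Pi.single j 1) i with hD
  have hDC : D * C = 1 := by
    ext j l
    have h := congrFun (bM.sum_repr (Pi.single j 1)) l
    simp only [Finset.sum_apply, Pi.smul_apply, smul_eq_mul] at h
    simp [Matrix.mul_apply, hC, hD, h, Matrix.one_apply, Pi.single_apply, eq_comm]
  have hCD : C * D = 1 := mul_eq_one_comm.1 hDC
  have hDC' : ∀ j l, ∑ i, (D j i : ℝ) * (C i l : ℝ) = if j = l then 1 else 0 := by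
    intro j l
    have := congrFun (congrFun hDC j) l
    rw [Matrix.mul_apply, Matrix.one_apply] at this
    exact_mod_cast this
  have hCD' : ∀ j l, ∑ i, (C j i : ℝ) * (D i l : ℝ) = if j = l then 1 else 0 := by
    intro j l
    have := congrFun (congrFun hCD j) l
    rw [Matrix.mul_apply, Matrix.one_apply] at this
    exact_mod_cast this
  let φ : BaseSpace n ≃ₗ[ℝ] (Fin n → ℝ) :=
    { toFun := fun v i => intForm (fun j => C i j) v
      map_add' := fun v w => by ext i; simp
      map_smul' := fun c v => by ext i; simp
      invFun := fun w => WithLp.toLp 2 fun j => ∑ i, (D j i : ℝ) * w i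
      left_inv := fun v => by
        ext j
        simp only [intForm_apply, Finset.mul_sum]
        rw [Finset.sum_comm]
        simp only [← mul_assoc, ← Finset.sum_mul, hDC']
        simp
      right_inv := fun w => by
        ext j
        simp only [intForm_apply, Finset.mul_sum]
        rw [Finset.sum_comm]
        simp only [← mul_assoc, ← Finset.sum_mul, hCD']
        simp }
  have hrepr : ∀ v i, (Module.Basis.ofEquivFun φ).repr v i = intForm (fun j => C i j) v := by
    intro v i
    rw [Module.Basis.ofEquivFun_repr_apply]
    rfl
  refine ⟨Module.Basis.ofEquivFun φ, ⟨fun i j => ⟨D j i, ?_⟩, fun v hv i => ?_⟩,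
    Set.range f, fun v => ?_⟩
  · rw [Module.Basis.coe_ofEquivFun]
    change ∑ l, (D j l : ℝ) * (Pi.single i 1 : Fin n → ℝ) l = _
    simp [Pi.single_apply]
  · choose w hw using hv
    exact ⟨∑ j, C i j * w j, by simp [hrepr, intForm_apply, hw]⟩
  · let ev : (Fin n → ℤ) →ₗ[ℤ] ℝ :=
      { toFun := fun x => intForm x v
        map_add' := fun x y => by
          simp only [intForm_apply, Pi.add_apply, Int.cast_add, add_mul, Finset.sum_add_distrib]
        map_smul' := fun c x => by
          simp [intForm_apply, Finset.mul_sum, mul_assoc] }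
    have h1 : (∀ i, intForm (a i) v = 0) ↔ Submodule.span ℤ (Set.range a) ≤ LinearMap.ker ev := by
      rw [Submodule.span_le]
      constructor
      · rintro h _ ⟨i, rfl⟩
        exact h i
      · exact fun h i => h ⟨i, rfl⟩
    have h2 : Submodule.span ℤ (Set.range a) ≤ LinearMap.ker ev ↔
        ∀ i, ev (bN i : Fin n → ℤ) = 0 := by
      constructor
      · exact fun h i => h (bN i).2
      · intro h x hx
        have : (ev.comp (Submodule.span ℤ (Set.range a)).subtype) = 0 := bN.ext fun i => h i
        exact LinearMap.congr_fun this ⟨x, hx⟩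
    rw [h1, h2, Set.forall_mem_range]
    refine forall_congr' fun i => ?_
    have hd : d i ≠ 0 := by
      intro h0
      have := hsnf i
      rw [h0, zero_smul] at this
      exact bN.ne_zero i (Subtype.ext this)
    rw [hsnf, map_smul, hrepr, smul_eq_zero_iff_right hd]
    rfl

/-! ### Faces of rational polyhedra near a point -/

theorem exists_pos_add_mem_of_mem_intrinsicInterior {n : ℕ} {W : Set (BaseSpace n)}
    {x : BaseSpace n} (hx : x ∈ intrinsicInterior ℝ W) :
    ∃ δ > 0, ∀ v ∈ vectorSpan ℝ W, ‖v‖ < δ → x + v ∈ W := by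
  obtain ⟨y, hy, rfl⟩ := mem_intrinsicInterior.1 hx
  obtain ⟨δ, hδ, hball⟩ := Metric.mem_nhds_iff.1 (mem_interior_iff_mem_nhds.1 hy)
  refine ⟨δ, hδ, fun v hv hvδ => ?_⟩
  have hmem : (y : BaseSpace n) + v ∈ affineSpan ℝ W := by
    rw [add_comm]
    exact AffineSubspace.vadd_mem_of_mem_direction (by rwa [direction_affineSpan]) y.2
  have hm : (⟨(y : BaseSpace n) + v, hmem⟩ : affineSpan ℝ W) ∈ Metric.ball y δ := by
    rw [Metric.mem_ball, Subtype.dist_eq, dist_eq_norm, add_sub_cancel_left]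
    exact hvδ
  exact hball hm

theorem mem_intrinsicInterior_of_forall_add_mem {n : ℕ} {W : Set (BaseSpace n)}
    {x : BaseSpace n} {δ : ℝ} (hδ : 0 < δ)
    (h : ∀ v ∈ vectorSpan ℝ W, ‖v‖ < δ → x + v ∈ W) : x ∈ intrinsicInterior ℝ W := by
  have hx : x ∈ W := by simpa using h 0 (Submodule.zero_mem _) (by simpa using hδ)
  have hxs : x ∈ affineSpan ℝ W := subset_affineSpan ℝ W hx
  refine mem_intrinsicInterior.2 ⟨⟨x, hxs⟩, ?_, rfl⟩
  rw [mem_interior_iff_mem_nhds, Metric.mem_nhds_iff]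
  refine ⟨δ, hδ, fun z hz => ?_⟩
  have hv : (z : BaseSpace n) - x ∈ vectorSpan ℝ W := by
    rw [← direction_affineSpan]
    exact AffineSubspace.vsub_mem_direction z.2 hxs
  have := h _ hv (by simpa [Metric.mem_ball, Subtype.dist_eq, dist_eq_norm] using hz)
  simpa using this

theorem IsExposed.exists_functional {n : ℕ} {F P : Set (BaseSpace n)} (hF : IsExposed ℝ P F)
    (hne : F.Nonempty) : ∃ (l : StrongDual ℝ (BaseSpace n)) (c : ℝ), (∀ x ∈ P, l x ≤ c) ∧
      ∀ x, x ∈ F ↔ x ∈ P ∧ l x = c := by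
  obtain ⟨l, hl⟩ := hF hne
  obtain ⟨x₀, hx₀⟩ := hne
  have hx₀' := hx₀
  rw [hl] at hx₀'
  refine ⟨l, l x₀, hx₀'.2, fun x => ⟨fun hx => ?_, fun hx => ?_⟩⟩
  · rw [hl] at hx
    exact ⟨hx.1, le_antisymm (hx₀'.2 x hx.1) (hx.2 x₀ hx₀'.1)⟩
  · rw [hl]
    exact ⟨hx.1, fun y hy => (hx₀'.2 y hy).trans hx.2.ge⟩

/-- A linear functional whose level set contains `W` vanishes on the directions of `W`. -/
theorem apply_eq_zero_of_mem_vectorSpan {n : ℕ} {W : Set (BaseSpace n)}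
    (l : BaseSpace n →L[ℝ] ℝ) {c : ℝ} (h : ∀ x ∈ W, l x = c) {v : BaseSpace n}
    (hv : v ∈ vectorSpan ℝ W) : l v = 0 := by
  have : vectorSpan ℝ W ≤ LinearMap.ker (l : BaseSpace n →ₗ[ℝ] ℝ) := by
    rw [vectorSpan_def, Submodule.span_le]
    rintro _ ⟨x, hx, y, hy, rfl⟩
    simp [h x hx, h y hy]
  simpa using this hv

/-- A face which contains a relative interior point of a subset contains the whole subset. -/
theorem subset_of_mem_intrinsicInterior_of_mem_isExposed {n : ℕ} {W F P : Set (BaseSpace n)}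
    (hF : IsExposed ℝ P F) (hWP : W ⊆ P) {x : BaseSpace n} (hx : x ∈ intrinsicInterior ℝ W)
    (hxF : x ∈ F) : W ⊆ F := by
  obtain ⟨l, c, hle, hiff⟩ := hF.exists_functional ⟨x, hxF⟩
  obtain ⟨δ, hδ, h⟩ := exists_pos_add_mem_of_mem_intrinsicInterior hx
  intro w hw
  have hv : w - x ∈ vectorSpan ℝ W := vsub_mem_vectorSpan ℝ hw (intrinsicInterior_subset hx)
  -- a small multiple of `x - w` can be added to `x` without leaving `W`
  set t : ℝ := δ / (2 * (‖w - x‖ + 1)) with ht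
  have hpos : 0 < ‖w - x‖ + 1 := by positivity
  have htpos : 0 < t := by positivity
  have hmem := h ((-t) • (w - x)) (Submodule.smul_mem _ _ hv) (by
    rw [norm_smul, Real.norm_eq_abs, abs_neg, abs_of_pos htpos, ht, div_mul_eq_mul_div,
      div_lt_iff₀ (by positivity)]
    nlinarith [norm_nonneg (w - x)])
  have h1 := hle _ (hWP hmem)
  have h2 := ((hiff x).1 hxF).2
  have h3 := hle _ (hWP hw)
  simp only [map_add, map_smul, map_sub, smul_eq_mul, h2] at h1
  refine (hiff w).2 ⟨hWP hw, le_antisymm h3 ?_⟩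
  nlinarith

/-- Two faces of the same dimension, one of which contains the other, are equal. -/
theorem IsExposed.eq_of_subset_of_polyDim_eq {n : ℕ} {F F' P : Set (BaseSpace n)}
    (hF : IsExposed ℝ P F) (hne : F.Nonempty) (hF' : F' ⊆ P) (hsub : F ⊆ F')
    (hdim : polyDim F = polyDim F') : F = F' := by
  obtain ⟨l, c, -, hiff⟩ := hF.exists_functional hne
  have hspan : vectorSpan ℝ F = vectorSpan ℝ F' :=
    Submodule.eq_of_le_of_finrank_eq (vectorSpan_mono ℝ hsub) hdim
  obtain ⟨x, hx⟩ := hne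
  refine hsub.antisymm fun w hw => (hiff w).2 ⟨hF' hw, ?_⟩
  have hv : w - x ∈ vectorSpan ℝ F := by
    rw [hspan]
    exact vsub_mem_vectorSpan ℝ hw (hsub hx)
  have := apply_eq_zero_of_mem_vectorSpan l (fun y hy => ((hiff y).1 hy).2) hv
  rw [map_sub, ((hiff x).1 hx).2] at this
  linarith

section Polyhedron

variable {n m : ℕ} {a : Fin m → Fin n → ℤ} {b : Fin m → ℝ} {P : Set (BaseSpace n)}

theorem isRationalPolyhedron_iff {P : Set (BaseSpace n)} : IsRationalPolyhedron P ↔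
    ∃ (m : ℕ) (a : Fin m → Fin n → ℤ) (b : Fin m → ℝ), P = {q | ∀ i, b i ≤ intForm (a i) q} := by
  simp only [IsRationalPolyhedron, intForm_apply]

theorem IsRationalPolyhedron.isClosed (hP : IsRationalPolyhedron P) : IsClosed P := by
  obtain ⟨m, a, b, rfl⟩ := isRationalPolyhedron_iff.1 hP
  simp only [Set.ofPred_forall]
  exact isClosed_iInter fun i => isClosed_le continuous_const (intForm (a i)).continuous

theorem IsRationalPolyhedron.convex (hP : IsRationalPolyhedron P) : Convex ℝ P := by
  obtain ⟨m, a, b, rfl⟩ := isRationalPolyhedron_iff.1 hP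
  simp only [Set.ofPred_forall]
  exact convex_iInter fun i => convex_halfSpace_ge (intForm (a i)).isLinear _

/-- Near one of its points, a polyhedron is a cone, cut out by the constraints which are active at
that point. -/
theorem exists_pos_add_mem_iff (hP : P = {q | ∀ i, b i ≤ intForm (a i) q}) {x : BaseSpace n}
    (hx : x ∈ P) : ∃ r > 0, ∀ u, ‖u‖ < r →
      (x + u ∈ P ↔ ∀ i, intForm (a i) x = b i → 0 ≤ intForm (a i) u) := by
  subst hP
  have hev : ∀ᶠ u in nhds (0 : BaseSpace n), ∀ i, intForm (a i) x ≠ b i →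
      b i < intForm (a i) (x + u) := by
    rw [Filter.eventually_all]
    intro i
    by_cases hi : intForm (a i) x = b i
    · exact Filter.Eventually.of_forall fun u h => absurd hi h
    · have hlt : b i < intForm (a i) (x + 0) := by
        rw [add_zero]
        exact lt_of_le_of_ne (hx i) (Ne.symm hi)
      have hc : Continuous fun u => intForm (a i) (x + u) := by fun_prop
      filter_upwards [hc.continuousAt.eventually (lt_mem_nhds hlt)] with u hu _ using hu
  obtain ⟨r, hr, hball⟩ := Metric.eventually_nhds_iff.1 hev
  refine ⟨r, hr, fun u hu => ⟨fun h i hi => ?_, fun h i => ?_⟩⟩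
  · have := h i
    rw [map_add, hi] at this
    linarith
  · by_cases hi : intForm (a i) x = b i
    · rw [map_add, hi]
      linarith [h i hi]
    · exact (hball (by simpa using hu) i hi).le

/-- The faces of a polyhedron which come close to a point of it contain that point. -/
theorem IsRationalPolyhedron.exists_pos_mem_face (hP : IsRationalPolyhedron P) {x : BaseSpace n}
    (hx : x ∈ P) : ∃ r > 0, ∀ F, IsExposed ℝ P F → ∀ q ∈ F, dist q x < r → x ∈ F := by
  obtain ⟨m, a, b, hPe⟩ := isRationalPolyhedron_iff.1 hP
  obtain ⟨r, hr, h⟩ := exists_pos_add_mem_iff hPe hx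
  refine ⟨r / 2, by positivity, fun F hF q hq hd => ?_⟩
  rw [dist_eq_norm] at hd
  obtain ⟨l, c, hle, hiff⟩ := hF.exists_functional ⟨q, hq⟩
  have hqP := (hF.subset hq)
  have h1 : ∀ i, intForm (a i) x = b i → 0 ≤ intForm (a i) (q - x) :=
    (h (q - x) (by linarith)).1 (by simpa using hqP)
  -- the segment from `x` to `q` can be prolonged to twice its length
  have h2 : x + (2 : ℝ) • (q - x) ∈ P := by
    refine (h _ (by rw [norm_smul]; norm_num; linarith)).2 fun i hi => ?_
    rw [map_smul, smul_eq_mul]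
    linarith [h1 i hi]
  have h3 := hle _ h2
  have h4 := hle _ hx
  have h5 := ((hiff q).1 hq).2
  simp only [map_add, map_smul, map_sub, smul_eq_mul, h5] at h3
  exact (hiff x).2 ⟨hx, by linarith⟩

/-- The directions of a face are those which annihilate the constraints active at a relative
interior point. -/
theorem mem_vectorSpan_face_iff (hP : P = {q | ∀ i, b i ≤ intForm (a i) q})
    {F : Set (BaseSpace n)} (hF : IsExposed ℝ P F) {x : BaseSpace n}
    (hx : x ∈ intrinsicInterior ℝ F) (v : BaseSpace n) :
    v ∈ vectorSpan ℝ F ↔ ∀ i : {i // intForm (a i) x = b i}, intForm (a i) v = 0 := by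
  have hxF := intrinsicInterior_subset hx
  obtain ⟨r, hr, h⟩ := exists_pos_add_mem_iff hP (hF.subset hxF)
  obtain ⟨l, c, hle, hiff⟩ := hF.exists_functional ⟨x, hxF⟩
  constructor
  · rintro hv ⟨i, hi⟩
    have hFi : F ⊆ {q | intForm (a i) q = b i} := by
      have hexp : IsExposed ℝ P {q ∈ P | intForm (a i) q = b i} := fun _ => by
        refine ⟨-intForm (a i), ?_⟩
        ext q
        simp only [Set.mem_ofPred_eq, neg_apply, neg_le_neg_iff]
        refine and_congr_right fun hq => ⟨fun hqi y hy => ?_, fun hq' => ?_⟩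
        · rw [hqi]
          rw [hP] at hy
          exact hy i
        · refine le_antisymm ?_ ?_
          · rw [← hi]
            exact hq' x (hF.subset hxF)
          · rw [hP] at hq
            exact hq i
      exact fun q hq => (subset_of_mem_intrinsicInterior_of_mem_isExposed hexp hF.subset hx
        ⟨hF.subset hxF, hi⟩ hq).2
    exact apply_eq_zero_of_mem_vectorSpan _ hFi hv
  · intro hv
    by_cases hv0 : v = 0
    · rw [hv0]
      exact Submodule.zero_mem _
    set t : ℝ := r / (2 * ‖v‖) with ht
    have hvpos : 0 < ‖v‖ := norm_pos_iff.2 hv0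
    have htpos : 0 < t := by positivity
    have hnorm : ‖t • v‖ < r := by
      rw [norm_smul, Real.norm_of_nonneg htpos.le, ht]
      field_simp
      linarith
    have h1 : x + t • v ∈ P := (h _ hnorm).2 fun i hi => by
      rw [map_smul, hv ⟨i, hi⟩, smul_zero]
    have h2 : x + -(t • v) ∈ P := (h _ (by rwa [norm_neg])).2 fun i hi => by
      rw [map_neg, map_smul, hv ⟨i, hi⟩, smul_zero, neg_zero]
    have h3 := hle _ h1
    have h4 := hle _ h2
    have h5 := ((hiff x).1 hxF).2
    rw [map_add, h5] at h3 h4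
    rw [map_neg] at h4
    have h6 : x + t • v ∈ F := (hiff _).2 ⟨h1, by rw [map_add, h5]; linarith⟩
    have h7 := vsub_mem_vectorSpan ℝ h6 hxF
    simp only [vsub_eq_sub, add_sub_cancel_left] at h7
    exact (Submodule.smul_mem_iff _ htpos.ne').1 h7

/-- The directions of a face of a rational polyhedron are spanned by part of a lattice basis. -/
theorem IsRationalPolyhedron.exists_isLatticeBasis_face (hP : IsRationalPolyhedron P)
    {F : Set (BaseSpace n)} (hF : IsExposed ℝ P F) (hne : F.Nonempty) :
    ∃ b : Module.Basis (Fin n) ℝ (BaseSpace n), IsLatticeBasis b ∧ ∃ J : Set (Fin n),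
      ∀ v, v ∈ vectorSpan ℝ F ↔ ∀ j ∈ J, b.repr v j = 0 := by
  obtain ⟨m, a, c, hPe⟩ := isRationalPolyhedron_iff.1 hP
  obtain ⟨x, hx⟩ := hne.intrinsicInterior (hF.convex hP.convex)
  obtain ⟨b, hb, J, hJ⟩ := exists_isLatticeBasis fun i : {i // intForm (a i) x = c i} => a i
  exact ⟨b, hb, J, fun v => (mem_vectorSpan_face_iff hPe hF hx v).trans (hJ v)⟩

/-- The directions of a face of a rational polyhedron are spanned by integral vectors. -/
theorem IsRationalPolyhedron.vectorSpan_face_le (hP : IsRationalPolyhedron P)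
    {F : Set (BaseSpace n)} (hF : IsExposed ℝ P F) (hne : F.Nonempty)
    {p : Submodule ℝ (BaseSpace n)} (hp : ∀ v ∈ tangentLattice F, v ∈ p) :
    vectorSpan ℝ F ≤ p := by
  obtain ⟨b, hb, J, hJ⟩ := hP.exists_isLatticeBasis_face hF hne
  intro v hv
  refine mem_submodule_of_repr_eq_zero J ((hJ v).1 hv) p fun i hi => hp _ ⟨?_, ?_⟩
  · refine (hJ _).2 fun j hj => ?_
    rw [b.repr_self, Finsupp.single_apply, if_neg]
    rintro rfl
    exact hi hj
  · exact hb.mem_integralVectors i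

end Polyhedron

/-! ### A polyhedral complex near a relative interior point of a facet -/

section Complex

variable {n k : ℕ} {ι : Type*} {V : ι → Set (BaseSpace n)}

/-- A relative interior point of a member of the complex lies in no other member. -/
theorem IsRationalPolyhedralComplex.eq_of_mem_intrinsicInterior
    (hV : IsRationalPolyhedralComplex k V) {s t : ι} {q : BaseSpace n}
    (hs : q ∈ intrinsicInterior ℝ (V s)) (ht : q ∈ V t) : s = t := by
  by_contra hne
  have hmem : q ∈ V s ∩ V t := ⟨intrinsicInterior_subset hs, ht⟩
  obtain ⟨-, hexp, hneq⟩ := (hV.inter s t hne ⟨q, hmem⟩).1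
  exact hneq (hexp.subset.antisymm
    (subset_of_mem_intrinsicInterior_of_mem_isExposed hexp subset_rfl hs hmem))

theorem IsRationalPolyhedralComplex.subset_of_mem_intrinsicInterior_facet
    (hV : IsRationalPolyhedralComplex k V) {s t : ι} {W : Set (BaseSpace n)}
    (hW : IsFacet W (V s)) {q : BaseSpace n} (hq : q ∈ intrinsicInterior ℝ W) (ht : q ∈ V t) :
    W ⊆ V t := by
  by_cases hst : s = t
  · rw [← hst]
    exact hW.2.1.subset
  have hqs : q ∈ V s := hW.2.1.subset (intrinsicInterior_subset hq)
  have hexp := (hV.inter s t hst ⟨q, hqs, ht⟩).1.2.1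
  exact (subset_of_mem_intrinsicInterior_of_mem_isExposed hexp hW.2.1.subset hq ⟨hqs, ht⟩).trans
    Set.inter_subset_right

/-- A facet of a member of the complex is a facet of every member which contains it. -/
theorem IsRationalPolyhedralComplex.isFacet_of_subset
    (hV : IsRationalPolyhedralComplex k V) {s t : ι} {W : Set (BaseSpace n)}
    (hW : IsFacet W (V s)) (ht : W ⊆ V t) : IsFacet W (V t) := by
  by_cases hst : s = t
  · rwa [← hst]
  obtain ⟨hne, hexp, hdim⟩ := hW
  have hsub : W ⊆ V s ∩ V t := Set.subset_inter hexp.subset ht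
  obtain ⟨⟨hne', hexp1, hneq1⟩, ⟨-, hexp2, -⟩⟩ := hV.inter s t hst (hne.mono hsub)
  have hlt : polyDim (V s ∩ V t) < polyDim (V s) := by
    refine lt_of_le_of_ne (Submodule.finrank_mono (vectorSpan_mono ℝ Set.inter_subset_left))
      fun heq => hneq1 ?_
    exact hexp1.eq_of_subset_of_polyDim_eq hne' subset_rfl Set.inter_subset_left heq
  have hle : polyDim W ≤ polyDim (V s ∩ V t) :=
    Submodule.finrank_mono (vectorSpan_mono ℝ hsub)
  have heq : W = V s ∩ V t := hexp.eq_of_subset_of_polyDim_eq hne Set.inter_subset_left hsub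
    (by omega)
  refine ⟨hne, ?_, ?_⟩
  · rwa [← heq] at hexp2
  · rw [hV.dim_eq t, ← hV.dim_eq s, hdim]

/-- Near a relative interior point of a facet `W`, the complex consists of the members containing
`W`, and `W` is the only facet. -/
theorem IsRationalPolyhedralComplex.exists_pos_forall_dist_lt
    (hV : IsRationalPolyhedralComplex k V) {s : ι} {W : Set (BaseSpace n)}
    (hW : IsFacet W (V s)) {x : BaseSpace n} (hx : x ∈ intrinsicInterior ℝ W) :
    ∃ r > 0, (∀ q t, dist q x < r → q ∈ V t → W ⊆ V t) ∧
      ∀ q ∈ codimOneStrata V, dist q x < r → q ∈ W := by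
  have h1 := hV.locallyFinite.iInter_compl_mem_nhds (fun t => (hV.polyhedron t).isClosed) x
  obtain ⟨r₁, hr₁, hball⟩ := Metric.mem_nhds_iff.1 h1
  have hmem : ∀ q t, dist q x < r₁ → q ∈ V t → x ∈ V t := by
    intro q t hq hqt
    by_contra hxt
    exact Set.mem_iInter₂.1 (hball hq) t hxt hqt
  have hfin : {t | x ∈ V t}.Finite := hV.locallyFinite.point_finite x
  have h2 : ∀ᶠ r in nhdsWithin (0 : ℝ) (Set.Ioi 0), ∀ t ∈ {t | x ∈ V t},
      ∀ F, IsExposed ℝ (V t) F → ∀ q ∈ F, dist q x < r → x ∈ F := by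
    rw [hfin.eventually_all]
    intro t ht
    obtain ⟨r, hr, h⟩ := (hV.polyhedron t).exists_pos_mem_face ht
    filter_upwards [Ioo_mem_nhdsGT hr] with r' hr' F hF q hq hd
    exact h F hF q hq (hd.trans hr'.2)
  obtain ⟨r₂, ⟨hr₂, h₂⟩⟩ := ((eventually_mem_nhdsWithin).and h2).exists
  refine ⟨min r₁ r₂, lt_min hr₁ hr₂, fun q t hq hqt => ?_, ?_⟩
  · exact hV.subset_of_mem_intrinsicInterior_facet hW hx
      (hmem q t (hq.trans_le (min_le_left _ _)) hqt)
  · rintro q ⟨t, W', hW', hq⟩ hd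
    have hqt : q ∈ V t := hW'.2.1.subset (intrinsicInterior_subset hq)
    have hxt := hmem q t (hd.trans_le (min_le_left _ _)) hqt
    have hxW' : x ∈ W' := h₂ t hxt W' hW'.2.1 q (intrinsicInterior_subset hq)
      (hd.trans_le (min_le_right _ _))
    have hWt := hV.isFacet_of_subset hW (hV.subset_of_mem_intrinsicInterior_facet hW hx hxt)
    have hsub : W ⊆ W' :=
      subset_of_mem_intrinsicInterior_of_mem_isExposed hW'.2.1 hWt.2.1.subset hx hxW'
    have := hWt.2.1.eq_of_subset_of_polyDim_eq hWt.1 hW'.2.1.subset hsub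
      (by have := hWt.2.2; have := hW'.2.2; omega)
    rw [this]
    exact intrinsicInterior_subset hq

end Complex

/-- The properties of a primitive normal vector `v` of a facet `W` of a polyhedron `P` which depend
only on the class of `v` modulo the directions of `W`: `v` is indivisible modulo these directions,
and near the relative interior point `x` of `W`, the polyhedron `P` is a half-space of its affine
span, on the side of `v`. -/
structure IsInwardNormal {n : ℕ} (W P : Set (BaseSpace n)) (x v : BaseSpace n) : Prop where
  mem_integralVectors : v ∈ integralVectors n
  mem_vectorSpan : v ∈ vectorSpan ℝ P
  notMem_vectorSpan : v ∉ vectorSpan ℝ W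
  exists_eq_add_smul : ∀ u ∈ vectorSpan ℝ P, ∃ τ ∈ vectorSpan ℝ W, ∃ σ : ℝ, u = τ + σ • v
  isUnit : ∀ u ∈ tangentLattice P, ∀ d : ℤ, v - (d : ℝ) • u ∈ vectorSpan ℝ W → IsUnit d
  exists_pos : ∃ r > 0, ∀ τ ∈ vectorSpan ℝ W, ∀ σ : ℝ, ‖τ + σ • v‖ < r →
    (x + (τ + σ • v) ∈ P → 0 ≤ σ) ∧ (0 < σ → x + (τ + σ • v) ∈ intrinsicInterior ℝ P)

theorem IsInwardNormal.sub {n : ℕ} {W P : Set (BaseSpace n)} {x v w : BaseSpace n}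
    (h : IsInwardNormal W P x v) (hWP : W ⊆ P) (hw : w ∈ tangentLattice W) :
    IsInwardNormal W P x (v - w) where
  mem_integralVectors := sub_mem h.mem_integralVectors hw.2
  mem_vectorSpan := sub_mem h.mem_vectorSpan (vectorSpan_mono ℝ hWP hw.1)
  notMem_vectorSpan hv := h.notMem_vectorSpan (by simpa using add_mem hv hw.1)
  exists_eq_add_smul u hu := by
    obtain ⟨τ, hτ, σ, rfl⟩ := h.exists_eq_add_smul u hu
    exact ⟨τ + σ • w, add_mem hτ (Submodule.smul_mem _ _ hw.1), σ, by module⟩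
  isUnit u hu d hd := h.isUnit u hu d <| by
    have := add_mem hd hw.1
    rwa [show v - w - (d : ℝ) • u + w = v - (d : ℝ) • u by abel] at this
  exists_pos := by
    obtain ⟨r, hr, hloc⟩ := h.exists_pos
    refine ⟨r, hr, fun τ hτ σ hσ => ?_⟩
    have heq : τ + σ • (v - w) = (τ - σ • w) + σ • v := by module
    rw [heq] at hσ ⊢
    exact hloc _ (sub_mem hτ (Submodule.smul_mem _ _ hw.1)) σ hσ

theorem vectorSpan_eq_of_isPrimitiveNormal {n : ℕ} {W P : Set (BaseSpace n)} {v : BaseSpace n}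
    (hP : IsRationalPolyhedron P) (hW : IsFacet W P) (hv : IsPrimitiveNormal W P v) :
    vectorSpan ℝ P = vectorSpan ℝ W ⊔ Submodule.span ℝ {v} := by
  have hvP : v ∈ tangentLattice P := by
    rw [← hv.1]
    exact AddSubgroup.mem_sup_right (AddSubgroup.mem_zmultiples v)
  refine le_antisymm (hP.vectorSpan_face_le (IsExposed.refl P) (hW.1.mono hW.2.1.subset)
    fun u hu => ?_) (sup_le (vectorSpan_mono ℝ hW.2.1.subset) ?_)
  · rw [← hv.1] at hu
    obtain ⟨w, hw, z, hz, rfl⟩ := AddSubgroup.mem_sup.1 hu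
    obtain ⟨m, rfl⟩ := AddSubgroup.mem_zmultiples_iff.1 hz
    refine add_mem (Submodule.mem_sup_left hw.1) (Submodule.mem_sup_right ?_)
    exact zsmul_mem (Submodule.mem_span_singleton_self v) m
  · rw [Submodule.span_singleton_le_iff_mem]
    exact hvP.1

theorem IsPrimitiveNormal.isInwardNormal {n : ℕ} {W P : Set (BaseSpace n)} {x v : BaseSpace n}
    (hP : IsRationalPolyhedron P) (hW : IsFacet W P) (hv : IsPrimitiveNormal W P v)
    (hx : x ∈ intrinsicInterior ℝ W) : IsInwardNormal W P x v := by
  have hspan := vectorSpan_eq_of_isPrimitiveNormal hP hW hv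
  have hvP : v ∈ tangentLattice P := by
    rw [← hv.1]
    exact AddSubgroup.mem_sup_right (AddSubgroup.mem_zmultiples v)
  have hvW : v ∉ vectorSpan ℝ W := by
    intro hmem
    have : vectorSpan ℝ P = vectorSpan ℝ W := by
      rw [hspan, sup_eq_left, Submodule.span_singleton_le_iff_mem]
      exact hmem
    have hdim := hW.2.2
    rw [polyDim, polyDim, this] at hdim
    omega
  have hxW := intrinsicInterior_subset hx
  have hxP := hW.2.1.subset hxW
  obtain ⟨y, hy, δ, hδ, hyδ⟩ := hv.2.2
  obtain ⟨m, a, c, hPe⟩ := isRationalPolyhedron_iff.1 hP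
  obtain ⟨r, hr, hloc⟩ := exists_pos_add_mem_iff hPe hxP
  obtain ⟨l, d, hle, hiff⟩ := hW.2.1.exists_functional hW.1
  have hlW : ∀ τ ∈ vectorSpan ℝ W, l τ = 0 := fun τ hτ =>
    apply_eq_zero_of_mem_vectorSpan l (fun z hz => ((hiff z).1 hz).2) hτ
  have hlx := ((hiff x).1 hxW).2
  have hlv : l v < 0 := by
    have h1 := hle _ hyδ
    have h2 := ((hiff y).1 hy).2
    rw [map_add, h2, map_smul, smul_eq_mul] at h1
    refine lt_of_le_of_ne (by nlinarith) fun h0 => hvW ?_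
    have h3 : y + δ • v ∈ W := (hiff _).2 ⟨hyδ, by rw [map_add, h2, map_smul, h0]; simp⟩
    have h4 := vsub_mem_vectorSpan ℝ h3 hy
    simp only [vsub_eq_sub, add_sub_cancel_left] at h4
    exact (Submodule.smul_mem_iff _ hδ.ne').1 h4
  have hdec : ∀ u ∈ vectorSpan ℝ P, ∃ τ ∈ vectorSpan ℝ W, ∃ σ : ℝ, u = τ + σ • v := by
    intro u hu
    rw [hspan] at hu
    obtain ⟨τ, hτ, z, hz, rfl⟩ := Submodule.mem_sup.1 hu
    obtain ⟨σ, rfl⟩ := Submodule.mem_span_singleton.1 hz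
    exact ⟨τ, hτ, σ, rfl⟩
  -- the constraints active at `x` are constant on `W` and nonnegative on `v`
  have hcone : ∀ τ ∈ vectorSpan ℝ W, ∀ σ : ℝ, 0 ≤ σ → ‖τ + σ • v‖ < r →
      x + (τ + σ • v) ∈ P := by
    intro τ hτ σ hσ hnorm
    refine (hloc _ hnorm).2 fun i hi => ?_
    have hW0 : ∀ u ∈ vectorSpan ℝ W, intForm (a i) u = 0 := fun u hu =>
      (mem_vectorSpan_face_iff hPe hW.2.1 hx u).1 hu ⟨i, hi⟩
    have hyx : intForm (a i) y = c i := by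
      have := hW0 (y - x) (vsub_mem_vectorSpan ℝ hy hxW)
      rw [map_sub, hi] at this
      linarith
    have h1 : c i ≤ intForm (a i) (y + δ • v) := by
      rw [hPe] at hyδ
      exact hyδ i
    rw [map_add, hyx, map_smul, smul_eq_mul] at h1
    have h2 : 0 ≤ intForm (a i) v := by
      by_contra hneg
      nlinarith
    rw [map_add, hW0 τ hτ, map_smul, smul_eq_mul, zero_add]
    positivity
  refine ⟨hvP.2, hvP.1, hvW, hdec, fun u hu e he => ?_, r, hr, fun τ hτ σ hnorm => ⟨fun hmem => ?_,
    fun hσ => ?_⟩⟩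
  · rw [← hv.1] at hu
    obtain ⟨w, hw, z, hz, rfl⟩ := AddSubgroup.mem_sup.1 hu
    obtain ⟨m, rfl⟩ := AddSubgroup.mem_zmultiples_iff.1 hz
    have h1 : ((1 - e * m : ℤ) : ℝ) • v ∈ vectorSpan ℝ W := by
      have := add_mem he (Submodule.smul_mem _ (e : ℝ) hw.1)
      convert this using 1
      rw [← Int.cast_smul_eq_zsmul ℝ]
      push_cast
      module
    by_contra hnu
    refine hvW ((Submodule.smul_mem_iff _ ?_).1 h1)
    intro h0
    have h0' : (1 - e * m : ℤ) = 0 := by exact_mod_cast h0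
    exact hnu (IsUnit.of_mul_eq_one m (by linarith))
  · have h1 := hle _ hmem
    rw [map_add, map_add, hlW τ hτ, hlx, map_smul, smul_eq_mul] at h1
    by_contra hneg
    nlinarith
  · have hlneg : l (τ + σ • v) < 0 := by
      rw [map_add, hlW τ hτ, map_smul, smul_eq_mul, zero_add]
      nlinarith
    have hev : ∀ᶠ u in nhds (0 : BaseSpace n), ‖τ + σ • v + u‖ < r ∧ l (τ + σ • v + u) < 0 := by
      have hc1 : Continuous fun u : BaseSpace n => ‖τ + σ • v + u‖ := by fun_prop
      have hc2 : Continuous fun u : BaseSpace n => l (τ + σ • v + u) := by fun_prop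
      exact (hc1.continuousAt.eventually (gt_mem_nhds (by simpa using hnorm))).and
        (hc2.continuousAt.eventually (gt_mem_nhds (by simpa using hlneg)))
    obtain ⟨ε, hε, hball⟩ := Metric.eventually_nhds_iff.1 hev
    refine mem_intrinsicInterior_of_forall_add_mem hε fun u hu hun => ?_
    obtain ⟨h1, h2⟩ := hball (by simpa using hun)
    obtain ⟨τ', hτ', σ', rfl⟩ := hdec u hu
    have heq : τ + σ • v + (τ' + σ' • v) = (τ + τ') + (σ + σ') • v := by module
    rw [heq] at h1 h2
    rw [map_add, hlW _ (add_mem hτ hτ'), map_smul, smul_eq_mul, zero_add] at h2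
    have := hcone (τ + τ') (add_mem hτ hτ') (σ + σ') (by nlinarith) h1
    rwa [add_assoc, heq]

/-! ### Functions on `X_A` adapted to a facet -/

section Functions

variable {n : ℕ} (b : Module.Basis (Fin n) ℝ (BaseSpace n)) (x₀ : BaseSpace n) (l : Fin n) (c : ℝ)

/-- The affine coordinates of `ℝⁿ` centred at `x₀`. -/
noncomputable def baseCoord (i : Fin n) (q : BaseSpace n) : ℝ := b.repr (q - x₀) i

/-- The sum of the squares of the coordinates with index at least `l`. -/
noncomputable def transverseSq (q : BaseSpace n) : ℝ :=
  ∑ j ∈ Finset.Ici l, baseCoord b x₀ j q ^ 2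

/-- The map `T*Q → ℝⁿ` whose degree is computed: the base coordinates of index less than `l`, the
function `transverseSq`, and the functions `sin (2π pᵢ)` of the fibre coordinates of index greater
than `l`. -/
noncomputable def degreeMap (i : Fin n) (z : CotangentCover n) : ℝ :=
  if i < l then baseCoord b x₀ i z.1
  else if i = l then transverseSq b x₀ l z.1
  else Real.sin (2 * Real.pi * inner ℝ z.2 (b i))

/-- The factors of a cutoff function on `T*Q`. Each of them is locally a function of the
corresponding component of `degreeMap`. Their product vanishes unless `yᵢ² < 2c` for the base
coordinates `yᵢ` with `i < l`, `transverseSq < 2c`, and `cos (2π pᵢ) > 1/2` for the fibre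
coordinates `pᵢ` with `i > l`. -/
noncomputable def cutoffFactor (i : Fin n) (z : CotangentCover n) : ℝ :=
  if i < l then Real.smoothTransition (2 - baseCoord b x₀ i z.1 ^ 2 / c)
  else if i = l then Real.smoothTransition (2 - transverseSq b x₀ l z.1 / c)
  else Real.smoothTransition (2 * Real.cos (2 * Real.pi * inner ℝ z.2 (b i)) - 1)

/-- The coefficient of `dG_l` in the differential of the cutoff function, where `G` is
`degreeMap`. -/
noncomputable def cutoffCoeff (z : CotangentCover n) : ℝ :=
  (∏ i ∈ Finset.univ.erase l, cutoffFactor b x₀ l c i z) *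
    deriv (fun t => Real.smoothTransition (2 - t / c)) (transverseSq b x₀ l z.1)

theorem hasFDerivAt_baseCoord (i : Fin n) (z : CotangentCover n) :
    HasFDerivAt (fun z : CotangentCover n => baseCoord b x₀ i z.1)
      ((LinearMap.toContinuousLinearMap (b.coord i)).comp
        (ContinuousLinearMap.fst ℝ (BaseSpace n) (BaseSpace n))) z := by
  have h := ((LinearMap.toContinuousLinearMap (b.coord i)).hasFDerivAt (x := z.1 - x₀)).comp z
    ((hasFDerivAt_fst (𝕜 := ℝ) (p := z)).sub_const x₀)
  exact h

theorem contDiff_baseCoord (i : Fin n) : ContDiff ℝ ∞ (baseCoord b x₀ i) :=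
  (LinearMap.toContinuousLinearMap (b.coord i)).contDiff.comp (contDiff_id.sub contDiff_const)

theorem contDiff_transverseSq : ContDiff ℝ ∞ (transverseSq b x₀ l) :=
  ContDiff.sum fun j _ => (contDiff_baseCoord b x₀ j).pow 2

variable {l} in
theorem degreeMap_of_lt {i : Fin n} (hi : i < l) :
    degreeMap b x₀ l i = fun z => baseCoord b x₀ i z.1 := by
  ext z
  simp [degreeMap, hi]

theorem degreeMap_self : degreeMap b x₀ l l = fun z => transverseSq b x₀ l z.1 := by
  ext z
  simp [degreeMap]

variable {l} in
theorem degreeMap_of_gt {i : Fin n} (hi : l < i) :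
    degreeMap b x₀ l i = fun z => Real.sin (2 * Real.pi * inner ℝ z.2 (b i)) := by
  ext z
  simp [degreeMap, hi.not_gt, hi.ne']

variable {l} in
theorem cutoffFactor_of_lt {i : Fin n} (hi : i < l) : cutoffFactor b x₀ l c i =
    fun z => Real.smoothTransition (2 - baseCoord b x₀ i z.1 ^ 2 / c) := by
  ext z
  simp [cutoffFactor, hi]

theorem cutoffFactor_self : cutoffFactor b x₀ l c l =
    fun z => Real.smoothTransition (2 - transverseSq b x₀ l z.1 / c) := by
  ext z
  simp [cutoffFactor]

variable {l} in
theorem cutoffFactor_of_gt {i : Fin n} (hi : l < i) : cutoffFactor b x₀ l c i =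
    fun z => Real.smoothTransition (2 * Real.cos (2 * Real.pi * inner ℝ z.2 (b i)) - 1) := by
  ext z
  simp [cutoffFactor, hi.not_gt, hi.ne']

theorem contDiff_degreeMap (i : Fin n) : ContDiff ℝ ∞ (degreeMap b x₀ l i) := by
  rcases lt_trichotomy i l with hi | rfl | hi
  · rw [degreeMap_of_lt b x₀ hi]
    exact (contDiff_baseCoord b x₀ i).comp contDiff_fst
  · rw [degreeMap_self]
    exact (contDiff_transverseSq b x₀ i).comp contDiff_fst
  · rw [degreeMap_of_gt b x₀ hi]
    exact Real.contDiff_sin.comp (contDiff_const.mul (contDiff_snd.inner ℝ contDiff_const))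

theorem contDiff_cutoffFactor (i : Fin n) : ContDiff ℝ ∞ (cutoffFactor b x₀ l c i) := by
  have hsT : ContDiff ℝ ∞ Real.smoothTransition := Real.smoothTransition.contDiff (n := ⊤)
  rcases lt_trichotomy i l with hi | rfl | hi
  · rw [cutoffFactor_of_lt b x₀ c hi]
    exact hsT.comp (contDiff_const.sub
      ((((contDiff_baseCoord b x₀ i).comp contDiff_fst).pow 2).div_const c))
  · rw [cutoffFactor_self]
    exact hsT.comp (contDiff_const.sub
      (((contDiff_transverseSq b x₀ i).comp contDiff_fst).div_const c))
  · rw [cutoffFactor_of_gt b x₀ c hi]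
    exact hsT.comp ((contDiff_const.mul
      (Real.contDiff_cos.comp (contDiff_const.mul (contDiff_snd.inner ℝ contDiff_const)))).sub
        contDiff_const)

theorem fderiv_degreeMap_of_lt {i : Fin n} (hi : i < l) (z w : CotangentCover n) :
    fderiv ℝ (degreeMap b x₀ l i) z w = b.repr w.1 i := by
  rw [degreeMap_of_lt b x₀ hi, (hasFDerivAt_baseCoord b x₀ i z).fderiv]
  simp

theorem fderiv_degreeMap_self (z w : CotangentCover n) :
    fderiv ℝ (degreeMap b x₀ l l) z w =
      ∑ j ∈ Finset.Ici l, 2 * baseCoord b x₀ j z.1 * b.repr w.1 j := by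
  have h1 : degreeMap b x₀ l l = fun z => ∑ j ∈ Finset.Ici l, baseCoord b x₀ j z.1 ^ 2 :=
    degreeMap_self b x₀ l
  have h2 := HasFDerivAt.fun_sum (u := Finset.Ici l)
    fun j _ => (hasFDerivAt_baseCoord b x₀ j z).pow 2
  rw [h1, h2.fderiv, sum_apply]
  simp

theorem hasFDerivAt_fibreCoord (i : Fin n) (z : CotangentCover n) :
    HasFDerivAt (fun z : CotangentCover n => inner ℝ z.2 (b i))
      ((innerSL ℝ (b i)).comp (ContinuousLinearMap.snd ℝ (BaseSpace n) (BaseSpace n))) z := by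
  have h := ((innerSL ℝ (b i)).comp
    (ContinuousLinearMap.snd ℝ (BaseSpace n) (BaseSpace n))).hasFDerivAt (x := z)
  have heq : (fun z : CotangentCover n => inner ℝ z.2 (b i)) =
      (innerSL ℝ (b i)).comp (ContinuousLinearMap.snd ℝ (BaseSpace n) (BaseSpace n)) := by
    ext z
    simp [real_inner_comm]
  rw [heq]
  exact h

theorem fderiv_degreeMap_of_gt {i : Fin n} (hi : l < i) (z w : CotangentCover n) :
    fderiv ℝ (degreeMap b x₀ l i) z w =
      2 * Real.pi * Real.cos (2 * Real.pi * inner ℝ z.2 (b i)) * inner ℝ w.2 (b i) := by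
  have h2 := ((hasFDerivAt_fibreCoord b i z).const_mul (2 * Real.pi)).sin
  rw [degreeMap_of_gt b x₀ hi, h2.fderiv]
  simp [real_inner_comm]
  ring

/-- Each factor of the cutoff function has a differential proportional to that of the
corresponding component of `degreeMap`. -/
theorem exists_hasFDerivAt_cutoffFactor (i : Fin n) (z : CotangentCover n) :
    ∃ d : ℝ, HasFDerivAt (cutoffFactor b x₀ l c i) (d • fderiv ℝ (degreeMap b x₀ l i) z) z ∧
      (i = l → d =
        deriv (fun t => Real.smoothTransition (2 - t / c)) (transverseSq b x₀ l z.1)) := by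
  have hdm : HasFDerivAt (degreeMap b x₀ l i) (fderiv ℝ (degreeMap b x₀ l i) z) z :=
    ((contDiff_degreeMap b x₀ l i).differentiable (by simp) z).hasFDerivAt
  have hsT : ContDiff ℝ ∞ Real.smoothTransition := Real.smoothTransition.contDiff (n := ⊤)
  rcases lt_trichotomy i l with hi | hi | hi
  · have hs : ContDiff ℝ ∞ fun t : ℝ => Real.smoothTransition (2 - t ^ 2 / c) :=
      hsT.comp (contDiff_const.sub ((contDiff_id.pow 2).div_const c))
    have hd := (hs.differentiable (by simp) (degreeMap b x₀ l i z)).hasDerivAt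
    refine ⟨deriv (fun t : ℝ => Real.smoothTransition (2 - t ^ 2 / c)) (degreeMap b x₀ l i z),
      ?_, fun h => absurd h hi.ne⟩
    have hcomp := hd.comp_hasFDerivAt z hdm
    have heq : cutoffFactor b x₀ l c i =
        (fun t : ℝ => Real.smoothTransition (2 - t ^ 2 / c)) ∘ degreeMap b x₀ l i := by
      rw [cutoffFactor_of_lt b x₀ c hi, degreeMap_of_lt b x₀ hi]
      rfl
    rw [heq]
    exact hcomp
  · subst hi
    have hs : ContDiff ℝ ∞ fun t : ℝ => Real.smoothTransition (2 - t / c) :=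
      hsT.comp (contDiff_const.sub (contDiff_id.div_const c))
    have hd := (hs.differentiable (by simp) (degreeMap b x₀ i i z)).hasDerivAt
    refine ⟨deriv (fun t : ℝ => Real.smoothTransition (2 - t / c)) (degreeMap b x₀ i i z), ?_,
      fun _ => by rw [degreeMap_self]⟩
    have hcomp := hd.comp_hasFDerivAt z hdm
    have heq : cutoffFactor b x₀ i c i =
        (fun t : ℝ => Real.smoothTransition (2 - t / c)) ∘ degreeMap b x₀ i i := by
      rw [cutoffFactor_self, degreeMap_self]
      rfl
    rw [heq]
    exact hcomp
  · have hs : ContDiff ℝ ∞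
        fun t : ℝ => Real.smoothTransition (2 * Real.cos (2 * Real.pi * t) - 1) :=
      hsT.comp ((contDiff_const.mul (Real.contDiff_cos.comp
        (contDiff_const.mul contDiff_id))).sub contDiff_const)
    set t₀ : ℝ := inner ℝ z.2 (b i) with ht₀
    have hd := (hs.differentiable (by simp) t₀).hasDerivAt
    have hcomp := hd.comp_hasFDerivAt z (hasFDerivAt_fibreCoord b i z)
    have heq : cutoffFactor b x₀ l c i = (fun t : ℝ =>
        Real.smoothTransition (2 * Real.cos (2 * Real.pi * t) - 1)) ∘
        fun z : CotangentCover n => inner ℝ z.2 (b i) := by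
      rw [cutoffFactor_of_gt b x₀ c hi]
      rfl
    rw [heq]
    by_cases hcos : Real.cos (2 * Real.pi * t₀) = 0
    · -- where the cosine vanishes, the cutoff is locally constant
      refine ⟨0, ?_, fun h => absurd h hi.ne'⟩
      have hzero : deriv (fun t : ℝ =>
          Real.smoothTransition (2 * Real.cos (2 * Real.pi * t) - 1)) t₀ = 0 := by
        have hev : (fun t : ℝ => Real.smoothTransition (2 * Real.cos (2 * Real.pi * t) - 1))
            =ᶠ[nhds t₀] fun _ => 0 := by
          have hc : Continuous fun t : ℝ => Real.cos (2 * Real.pi * t) := by fun_prop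
          have hlt : Real.cos (2 * Real.pi * t₀) < 1 / 2 := by rw [hcos]; norm_num
          filter_upwards [hc.continuousAt.eventually (gt_mem_nhds hlt)] with t ht
          exact Real.smoothTransition.zero_of_nonpos (by linarith)
        rw [hev.deriv_eq]
        simp
      rw [hzero] at hcomp
      simpa using hcomp
    · refine ⟨deriv (fun t : ℝ =>
          Real.smoothTransition (2 * Real.cos (2 * Real.pi * t) - 1)) t₀ /
            (2 * Real.pi * Real.cos (2 * Real.pi * t₀)), ?_, fun h => absurd h hi.ne'⟩
      refine hcomp.congr_fderiv ?_
      ext w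
      all_goals
        simp only [ContinuousLinearMap.comp_apply, smul_apply, smul_eq_mul,
          fderiv_degreeMap_of_gt b x₀ l hi, ContinuousLinearMap.inl_apply,
          ContinuousLinearMap.inr_apply, ContinuousLinearMap.coe_snd', innerSL_apply_apply]
        rw [← ht₀, real_inner_comm]
        have := Real.pi_ne_zero
        field_simp

/-- The differential of the cutoff function is a combination of those of the components of
`degreeMap`. -/
theorem exists_fderiv_prod_cutoffFactor (z : CotangentCover n) :
    ∃ d : Fin n → ℝ, d l = cutoffCoeff b x₀ l c z ∧
      fderiv ℝ (fun z => ∏ i, cutoffFactor b x₀ l c i z) z =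
        ∑ i, d i • fderiv ℝ (degreeMap b x₀ l i) z := by
  choose d hd hdl using fun i => exists_hasFDerivAt_cutoffFactor b x₀ l c i z
  refine ⟨fun i => (∏ j ∈ Finset.univ.erase i, cutoffFactor b x₀ l c j z) * d i, ?_, ?_⟩
  · simp only []
    rw [hdl l rfl, cutoffCoeff]
  · have := HasFDerivAt.finsetProd (u := Finset.univ) fun i _ => hd i
    rw [this.fderiv]
    simp [smul_smul]

end Functions

/-! ### Functions on `X_A` and their pullbacks to a Lagrangian -/

theorem coverMap_eq_coverMap_iff {n : ℕ} {z z' : CotangentCover n} :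
    coverMap z = coverMap z' ↔ z.1 = z'.1 ∧ z.2 - z'.2 ∈ integralVectors n := by
  have h : ∀ a b : ℝ, ((a : UnitAddCircle) = b) ↔ ∃ m : ℤ, a - b = m := by
    intro a b
    rw [← sub_eq_zero, ← AddCircle.coe_sub, AddCircle.coe_eq_zero_iff]
    simp [eq_comm]
  simp only [coverMap, Prod.mk.injEq, funext_iff, h]
  rfl

theorem coverMap_surjective {n : ℕ} : Function.Surjective (coverMap (n := n)) := by
  rintro ⟨q, θ⟩
  choose p hp using fun i => QuotientAddGroup.mk_surjective (θ i)
  exact ⟨(q, WithLp.toLp 2 p), Prod.ext rfl (funext hp)⟩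

/-- The function on `X_A` induced by a function on `T*Q` (which has to be periodic in the fibre
directions for this to be meaningful). -/
noncomputable def descend {n : ℕ} (g : CotangentCover n → ℝ) (x : XA n) : ℝ :=
  g (Function.surjInv coverMap_surjective x)

/-- Periodicity in the fibre directions of a function on `T*Q`. -/
def IsFibrePeriodic {n : ℕ} (g : CotangentCover n → ℝ) : Prop :=
  ∀ z z', coverMap z = coverMap z' → g z = g z'

theorem IsFibrePeriodic.descend_coverMap {n : ℕ} {g : CotangentCover n → ℝ}
    (hg : IsFibrePeriodic g) (z : CotangentCover n) : descend g (coverMap z) = g z :=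
  hg _ _ (Function.surjInv_eq _ _)

section LocalLift

variable {n : ℕ} {M : Type u} [TopologicalSpace M] {f : M → XA n}
  {e : OpenPartialHomeomorph M (EuclideanSpace ℝ (Fin n))} {O : Set (EuclideanSpace ℝ (Fin n))}
  {F : EuclideanSpace ℝ (Fin n) → CotangentCover n}

theorem IsLocalLift.differentiableAt (hF : IsLocalLift f e O F) {y : EuclideanSpace ℝ (Fin n)}
    (hy : y ∈ O) : DifferentiableAt ℝ F y :=
  (hF.contDiffOn.contDiffAt (hF.isOpen.mem_nhds hy)).differentiableAt (by simp)

theorem IsLocalLift.eventually_mem (hF : IsLocalLift f e O F) {y : EuclideanSpace ℝ (Fin n)}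
    (hy : y ∈ O) : ∀ᶠ y' in nhds y, y' ∈ O :=
  hF.isOpen.mem_nhds hy

theorem IsLocalLift.descend_comp_eventuallyEq (hF : IsLocalLift f e O F)
    {y : EuclideanSpace ℝ (Fin n)} (hy : y ∈ O) {g : CotangentCover n → ℝ}
    (hg : IsFibrePeriodic g) :
    (fun x => descend g (f x)) ∘ e.symm =ᶠ[nhds y] g ∘ F := by
  filter_upwards [hF.eventually_mem hy] with y' hy'
  rw [Function.comp_apply, ← hF.lift y' hy', hg.descend_coverMap, Function.comp_apply]

theorem IsLocalLift.fderiv_descend_comp (hF : IsLocalLift f e O F)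
    {y : EuclideanSpace ℝ (Fin n)} (hy : y ∈ O) {g : CotangentCover n → ℝ}
    (hg : IsFibrePeriodic g) (hgs : ContDiff ℝ ∞ g) :
    fderiv ℝ ((fun x => descend g (f x)) ∘ e.symm) y =
      (fderiv ℝ g (F y)).comp (fderiv ℝ F y) := by
  rw [(hF.descend_comp_eventuallyEq hy hg).fderiv_eq,
    fderiv_comp y (hgs.differentiable (by simp) _) (hF.differentiableAt hy)]

end LocalLift

/-- The pullback to a Lagrangian of a function on `X_A` is smooth when its lift to `T*Q` is. -/
theorem OrientedLagrangian.contMDiff_descend {n : ℕ} (L : OrientedLagrangian.{u} n)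
    {g : CotangentCover n → ℝ} (hg : IsFibrePeriodic g) (hgs : ContDiff ℝ ∞ g) :
    ContMDiff (𝓡 n) 𝓘(ℝ, ℝ) ∞ fun x => descend g (L.toFun x) := by
  intro x
  set e := chartAt (EuclideanSpace ℝ (Fin n)) x with he
  have hx : x ∈ e.source := mem_chart_source _ x
  obtain ⟨O, F, hy, hF⟩ := L.smooth e (chart_mem_atlas _ x) (e x) (e.map_source hx)
  have h1 : ContMDiffAt (𝓡 n) 𝓘(ℝ, ℝ) ∞ (g ∘ F) (e x) :=
    (hgs.contDiffAt.comp (e x) (hF.contDiffOn.contDiffAt (hF.isOpen.mem_nhds hy))).contMDiffAt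
  have h2 : ContMDiffAt (𝓡 n) (𝓡 n) ∞ e x :=
    (contMDiffOn_of_mem_maximalAtlas (IsManifold.chart_mem_maximalAtlas x)).contMDiffAt
      (e.open_source.mem_nhds hx)
  refine (h1.comp x h2).congr_of_eventuallyEq ?_
  filter_upwards [e.open_source.mem_nhds hx,
    (e.continuousAt hx).eventually (hF.eventually_mem hy)] with x' hx' hx'O
  have := hF.lift (e x') hx'O
  rw [e.left_inv hx'] at this
  rw [← this, hg.descend_coverMap]
  rfl

section Degree

variable {n : ℕ} {b : Module.Basis (Fin n) ℝ (BaseSpace n)} (x₀ : BaseSpace n) (l : Fin n) (c : ℝ)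

theorem IsLatticeBasis.exists_inner_sub_eq_int (hb : IsLatticeBasis b) {p p' : BaseSpace n}
    (h : p - p' ∈ integralVectors n) (i : Fin n) :
    ∃ m : ℤ, inner ℝ p (b i) = inner ℝ p' (b i) + m := by
  choose w hw using h
  choose v hv using hb.mem_integralVectors i
  refine ⟨∑ j, w j * v j, ?_⟩
  have h1 : inner ℝ (p - p') (b i) = ∑ j, (w j : ℝ) * v j := by
    rw [PiLp.inner_apply]
    refine Finset.sum_congr rfl fun j _ => ?_
    rw [hw, hv]
    simp [mul_comm]
  rw [inner_sub_left] at h1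
  push_cast
  linarith

theorem IsLatticeBasis.isFibrePeriodic_degreeMap (hb : IsLatticeBasis b) (i : Fin n) :
    IsFibrePeriodic (degreeMap b x₀ l i) := by
  intro z z' hz
  obtain ⟨h1, h2⟩ := coverMap_eq_coverMap_iff.1 hz
  obtain ⟨m, hm⟩ := hb.exists_inner_sub_eq_int h2 i
  rw [degreeMap, degreeMap, h1, hm]
  rw [show 2 * Real.pi * (inner ℝ z'.2 (b i) + (m : ℝ)) =
    2 * Real.pi * inner ℝ z'.2 (b i) + m * (2 * Real.pi) by ring, Real.sin_add_int_mul_two_pi]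

theorem IsLatticeBasis.isFibrePeriodic_prod_cutoffFactor (hb : IsLatticeBasis b) :
    IsFibrePeriodic fun z => ∏ i, cutoffFactor b x₀ l c i z := by
  intro z z' hz
  obtain ⟨h1, h2⟩ := coverMap_eq_coverMap_iff.1 hz
  refine Finset.prod_congr rfl fun i _ => ?_
  obtain ⟨m, hm⟩ := hb.exists_inner_sub_eq_int h2 i
  rw [cutoffFactor, cutoffFactor, h1, hm]
  rw [show 2 * Real.pi * (inner ℝ z'.2 (b i) + (m : ℝ)) =
    2 * Real.pi * inner ℝ z'.2 (b i) + m * (2 * Real.pi) by ring, Real.cos_add_int_mul_two_pi]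

theorem contDiff_prod_cutoffFactor :
    ContDiff ℝ ∞ fun z => ∏ i, cutoffFactor b x₀ l c i z :=
  contDiff_prod fun i _ => contDiff_cutoffFactor b x₀ l c i

variable {M : Type u} [TopologicalSpace M] {f : M → XA n}
  {e : OpenPartialHomeomorph M (EuclideanSpace ℝ (Fin n))} {O : Set (EuclideanSpace ℝ (Fin n))}
  {F : EuclideanSpace ℝ (Fin n) → CotangentCover n}

theorem chartJacobian_degreeMap (hb : IsLatticeBasis b) (hF : IsLocalLift f e O F)
    {y : EuclideanSpace ℝ (Fin n)} (hy : y ∈ O) :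
    chartJacobian (fun i x => descend (degreeMap b x₀ l i) (f x)) e y =
      Matrix.det (Matrix.of fun i j : Fin n =>
        fderiv ℝ (degreeMap b x₀ l i) (F y) (fderiv ℝ F y (EuclideanSpace.single j 1))) := by
  rw [chartJacobian, jacobianDet]
  congr 1
  ext i j
  rw [Matrix.of_apply, Matrix.of_apply, hF.fderiv_descend_comp hy
    (hb.isFibrePeriodic_degreeMap x₀ l i) (contDiff_degreeMap b x₀ l i)]
  rfl

/-- If `R` is the cutoff function and `G` is `degreeMap`, the form obtained from `dG₁ ∧ ⋯ ∧ dGₙ` by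
replacing `dG_l` with `dR` only retains the component of `dR` along `dG_l`. -/
theorem chartJacobian_update_cutoff (hb : IsLatticeBasis b) (hF : IsLocalLift f e O F)
    {y : EuclideanSpace ℝ (Fin n)} (hy : y ∈ O) :
    chartJacobian (Function.update (fun i x => descend (degreeMap b x₀ l i) (f x)) l
        fun x => descend (fun z => ∏ i, cutoffFactor b x₀ l c i z) (f x)) e y =
      cutoffCoeff b x₀ l c (F y) *
        chartJacobian (fun i x => descend (degreeMap b x₀ l i) (f x)) e y := by
  obtain ⟨d, hdl, hd⟩ := exists_fderiv_prod_cutoffFactor b x₀ l c (F y)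
  rw [chartJacobian_degreeMap x₀ l hb hF hy, ← hdl, ← smul_eq_mul, ← Matrix.det_updateRow_sum]
  rw [chartJacobian, jacobianDet]
  congr 1
  ext i j
  by_cases hi : i = l
  · subst hi
    rw [Matrix.of_apply, Matrix.updateRow_self, Function.update_self,
      hF.fderiv_descend_comp hy (hb.isFibrePeriodic_prod_cutoffFactor x₀ i c)
        (contDiff_prod_cutoffFactor x₀ i c), ContinuousLinearMap.comp_apply, hd]
    simp [sum_apply]
  · rw [Matrix.of_apply, Matrix.updateRow_ne hi, Function.update_of_ne hi,
      hF.fderiv_descend_comp hy (hb.isFibrePeriodic_degreeMap x₀ l i)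
        (contDiff_degreeMap b x₀ l i)]
    rfl

end Degree

/-! ### The density on `ℝⁿ` induced by the cutoff function -/

section Density

variable {n : ℕ} (l : Fin n) (c : ℝ)

/-- The function on `ℝⁿ` whose composition with `degreeMap` is `cutoffCoeff`, at the points where
the cosines of the fibre coordinates of index greater than `l` are nonnegative. -/
noncomputable def degreeDensity (w : EuclideanSpace ℝ (Fin n)) : ℝ :=
  (∏ i ∈ Finset.univ.erase l, if i < l then Real.smoothTransition (2 - w i ^ 2 / c)
    else Real.smoothTransition (2 * Real.sqrt (1 - w i ^ 2) - 1)) *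
    deriv (fun t => Real.smoothTransition (2 - t / c)) (w l)

theorem degreeDensity_degreeMap (b : Module.Basis (Fin n) ℝ (BaseSpace n)) (x₀ : BaseSpace n)
    {z : CotangentCover n}
    (hz : ∀ i, l < i → 0 ≤ Real.cos (2 * Real.pi * inner ℝ z.2 (b i))) :
    degreeDensity l c (WithLp.toLp 2 fun i => degreeMap b x₀ l i z) =
      cutoffCoeff b x₀ l c z := by
  rw [degreeDensity, cutoffCoeff]
  congr 1
  · refine Finset.prod_congr rfl fun i hi => ?_
    rcases lt_or_gt_of_ne (Finset.ne_of_mem_erase hi) with h | h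
    · simp [h, degreeMap, cutoffFactor]
    · simp only [h.not_gt, if_false, degreeMap_of_gt b x₀ h, cutoffFactor_of_gt b x₀ c h]
      rw [← Real.abs_cos_eq_sqrt_one_sub_sin_sq, abs_of_nonneg (hz i h)]
  · simp [degreeMap_self]

theorem contDiff_smoothTransition_profile :
    ContDiff ℝ ∞ fun t : ℝ => Real.smoothTransition (2 - t / c) :=
  (Real.smoothTransition.contDiff (n := ⊤)).comp (contDiff_const.sub (contDiff_id.div_const c))

theorem continuous_degreeDensity : Continuous (degreeDensity l c) := by
  have hd : Continuous (deriv fun t : ℝ => Real.smoothTransition (2 - t / c)) :=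
    (contDiff_smoothTransition_profile c).continuous_deriv (by simp)
  have hs := Real.smoothTransition.continuous
  refine Continuous.mul (continuous_finsetProd _ fun i _ => ?_) (hd.comp (by fun_prop))
  split_ifs
  · exact hs.comp (by fun_prop)
  · exact hs.comp (by fun_prop)

variable {c} in
theorem mem_Icc_of_deriv_profile_ne_zero (hc : 0 < c) {t : ℝ}
    (ht : deriv (fun t => Real.smoothTransition (2 - t / c)) t ≠ 0) : t ∈ Set.Icc c (2 * c) := by
  by_contra hmem
  apply ht
  rw [Set.mem_Icc, not_and_or, not_le, not_le] at hmem
  rcases hmem with h | h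
  · have hev : (fun t => Real.smoothTransition (2 - t / c)) =ᶠ[nhds t] fun _ => 1 := by
      filter_upwards [gt_mem_nhds h] with s hs
      refine Real.smoothTransition.one_of_one_le ?_
      have : s / c ≤ 1 := (div_le_one hc).2 hs.le
      linarith
    rw [hev.deriv_eq]
    simp
  · have hev : (fun t => Real.smoothTransition (2 - t / c)) =ᶠ[nhds t] fun _ => 0 := by
      filter_upwards [lt_mem_nhds h] with s hs
      refine Real.smoothTransition.zero_of_nonpos ?_
      have : 2 ≤ s / c := (le_div_iff₀ hc).2 hs.le
      linarith
    rw [hev.deriv_eq]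
    simp

variable {c} in
theorem sq_lt_of_profile_ne_zero (hc : 0 < c) {t : ℝ}
    (ht : Real.smoothTransition (2 - t / c) ≠ 0) : t < 2 * c := by
  by_contra h
  refine ht (Real.smoothTransition.zero_of_nonpos ?_)
  have : 2 ≤ t / c := (le_div_iff₀ hc).2 (not_lt.1 h)
  linarith

variable {l c} in
theorem bounds_of_degreeDensity_ne_zero (hc : 0 < c) {w : EuclideanSpace ℝ (Fin n)}
    (hw : degreeDensity l c w ≠ 0) :
    (∀ i, i < l → w i ^ 2 < 2 * c) ∧ w l ∈ Set.Icc c (2 * c) ∧ ∀ i, l < i → w i ^ 2 < 1 := by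
  have h1 := left_ne_zero_of_mul hw
  rw [Finset.prod_ne_zero_iff] at h1
  refine ⟨fun i hi => ?_, mem_Icc_of_deriv_profile_ne_zero hc (right_ne_zero_of_mul hw),
    fun i hi => ?_⟩
  · have := h1 i (Finset.mem_erase.2 ⟨hi.ne, Finset.mem_univ _⟩)
    rw [if_pos hi] at this
    exact sq_lt_of_profile_ne_zero hc this
  · have := h1 i (Finset.mem_erase.2 ⟨hi.ne', Finset.mem_univ _⟩)
    rw [if_neg hi.not_gt] at this
    by_contra h
    refine this (Real.smoothTransition.zero_of_nonpos ?_)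
    rw [Real.sqrt_eq_zero_of_nonpos (by linarith)]
    norm_num

variable {c} in
theorem hasCompactSupport_degreeDensity (hc : 0 < c) : HasCompactSupport (degreeDensity l c) := by
  have hK : IsCompact ((WithLp.toLp 2 : (Fin n → ℝ) → EuclideanSpace ℝ (Fin n)) ''
      Set.pi Set.univ fun _ => Set.Icc (-(2 * c + 1)) (2 * c + 1)) :=
    (isCompact_univ_pi fun _ => isCompact_Icc).image (PiLp.continuous_toLp 2 _)
  refine HasCompactSupport.intro hK fun w hw => ?_
  by_contra hne
  obtain ⟨h1, h2, h3⟩ := bounds_of_degreeDensity_ne_zero hc hne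
  refine hw ⟨w.ofLp, fun i _ => ?_, rfl⟩
  rcases lt_trichotomy i l with hi | rfl | hi
  · have := h1 i hi
    constructor <;> nlinarith
  · exact ⟨by linarith [h2.1], by linarith [h2.2]⟩
  · have := h3 i hi
    constructor <;> nlinarith

variable {c} in
/-- The density has constant sign, as the profile of the cutoff is monotone, and it is not
identically zero. -/
theorem integral_degreeDensity_ne_zero (hc : 0 < c) :
    ∫ w, degreeDensity l c w ≠ 0 := by
  have hanti : Antitone fun t : ℝ => Real.smoothTransition (2 - t / c) := fun s t hst =>
    Real.smoothTransition.monotone (by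
      have : s / c ≤ t / c := by gcongr
      linarith)
  obtain ⟨t, ht⟩ : ∃ t, deriv (fun t => Real.smoothTransition (2 - t / c)) t ≠ 0 := by
    by_contra! h
    have hconst := is_const_of_deriv_eq_zero
      ((contDiff_smoothTransition_profile c).differentiable (by simp)) h c (2 * c)
    simp only [div_self hc.ne', mul_div_assoc] at hconst
    norm_num at hconst
  have hpos : 0 < ∫ w, -degreeDensity l c w := by
    refine Continuous.integral_pos_of_hasCompactSupport_nonneg_nonzero
      (x := EuclideanSpace.single l t) (continuous_degreeDensity l c).neg
      (hasCompactSupport_degreeDensity l hc).neg (fun w => ?_) ?_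
    · simp only [Pi.zero_apply]
      rw [degreeDensity, ← mul_neg]
      refine mul_nonneg (Finset.prod_nonneg fun i _ => ?_) (neg_nonneg.2 hanti.deriv_nonpos)
      split_ifs <;> exact Real.smoothTransition.nonneg _
    · rw [neg_ne_zero, degreeDensity]
      refine mul_ne_zero (Finset.prod_ne_zero_iff.2 fun i hi => ?_) (by simpa using ht)
      have hil := Finset.ne_of_mem_erase hi
      have h0 : (EuclideanSpace.single l t : EuclideanSpace ℝ (Fin n)) i = 0 := by simp [hil]
      rw [h0]
      split_ifs <;> norm_num
  rw [MeasureTheory.integral_neg] at hpos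
  linarith

end Density

/-! ### The sign of the Jacobian of `degreeMap` along a conormal bundle -/

section Sign

variable {n : ℕ} (b : Module.Basis (Fin n) ℝ (BaseSpace n)) (x₀ : BaseSpace n) (l : Fin n)

/-- Replacing one vector of a basis by a vector with a positive coordinate in its direction gives
a basis with the same orientation. -/
theorem exists_basis_update {u : BaseSpace n} (hu : 0 < b.repr u l) :
    ∃ b' : Module.Basis (Fin n) ℝ (BaseSpace n), b'.orientation = b.orientation ∧ b' l = u ∧
      ∀ i, i ≠ l → b' i = b i := by
  have hdet : b.det (Function.update b l u) = b.repr u l := by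
    rw [Module.Basis.det_apply, Module.Basis.toMatrix_update, Module.Basis.toMatrix_self,
      ← Matrix.cramer_apply, Matrix.cramer_one]
    rfl
  obtain ⟨hli, hsp⟩ := (Module.Basis.is_basis_iff_det b).2 (hdet ▸ hu.ne'.isUnit)
  refine ⟨Module.Basis.mk hli hsp.ge, ?_, by simp, fun i hi => by simp [hi]⟩
  rw [eq_comm, Module.Basis.orientation_eq_iff_det_pos, Module.Basis.coe_mk, hdet]
  exact hu

/-- At a point of the conormal bundle of a polyhedron whose directions `T` are spanned by
`b i`, `i < l`, and by an inward normal vector `v`, the Jacobian determinant of `degreeMap` has the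
sign of the `l`-th coordinate of `v`, provided that the tangent vectors `w` are positive for the
orientation of the conormal bundle. -/
theorem sign_mul_det_fderiv_degreeMap_pos {k : ℕ} (hk : (l : ℕ) + 1 = k)
    {T : Submodule ℝ (BaseSpace n)} (hbT : ∀ i, i < l → b i ∈ T) {v : BaseSpace n} (hvT : v ∈ T)
    (hv : ∀ i, i < l → b.repr v i = 0)
    (hT : ∀ u ∈ T, ∃ σ : ℝ, ∀ i, l ≤ i → b.repr u i = σ * b.repr v i)
    {z : CotangentCover n} {s : ℝ} (hs : 0 < s)
    (hz : ∀ i, l ≤ i → baseCoord b x₀ i z.1 = s * b.repr v i)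
    (hcos : ∀ i, l < i → 0 < Real.cos (2 * Real.pi * inner ℝ z.2 (b i)))
    {w : Fin n → CotangentCover n} (hw : ∀ j, (w j).1 ∈ T)
    (hor : ∀ b' : Module.Basis (Fin n) ℝ (BaseSpace n), b'.orientation = b.orientation →
      (∀ i : Fin n, (i : ℕ) < k → b' i ∈ T) → 0 < conormalForm k b' w)
    (hvl : b.repr v l ≠ 0) :
    0 < (SignType.sign (b.repr v l) : ℝ) *
      Matrix.det (Matrix.of fun i j : Fin n => fderiv ℝ (degreeMap b x₀ l i) z (w j)) := by
  set ς : ℝ := (SignType.sign (b.repr v l) : ℝ) with hς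
  have hςς : ς * ς = 1 := by
    rcases lt_or_gt_of_ne hvl with h | h
    · simp [hς, sign_neg h]
    · simp [hς, sign_pos h]
  have hςv : 0 < b.repr (ς • v) l := by
    rw [map_smul, Finsupp.smul_apply, smul_eq_mul, hς, sign_mul_self]
    exact abs_pos.2 hvl
  obtain ⟨b', hb'o, hb'l, hb'i⟩ := exists_basis_update b l hςv
  have hlt : ∀ i : Fin n, (i : ℕ) < k ↔ i ≤ l := fun i => by
    rw [Fin.le_def]
    omega
  have hpos := hor b' hb'o fun i hi => by
    rcases eq_or_lt_of_le ((hlt i).1 hi) with rfl | h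
    · rw [hb'l]
      exact T.smul_mem _ hvT
    · rw [hb'i i h.ne]
      exact hbT i h
  choose σ hσ using fun j => hT _ (hw j)
  -- the coordinates of a vector of `T` in the basis `b'`
  have hrepr : ∀ j, b'.repr (w j).1 l = ς * σ j ∧
      ∀ i, i < l → b'.repr (w j).1 i = b.repr (w j).1 i := by
    intro j
    set a : Fin n → ℝ := fun i => if i < l then b.repr (w j).1 i else
      if i = l then ς * σ j else 0 with ha
    have hsum : (w j).1 = ∑ i, a i • b' i := by
      apply b.repr.injective
      ext i
      rw [map_sum, Finsupp.finsetSum_apply, ← Finset.sum_erase_add _ _ (Finset.mem_univ l)]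
      have h1 : ∀ m ∈ Finset.univ.erase l, b.repr (a m • b' m) i =
          if m = i then a m else 0 := by
        intro m hm
        rw [hb'i m (Finset.ne_of_mem_erase hm), map_smul, Finsupp.smul_apply, b.repr_self,
          Finsupp.single_apply]
        simp
      have hal : a l = ς * σ j := by simp [ha]
      rw [Finset.sum_congr rfl h1, hb'l, hal, smul_smul,
        show ς * σ j * ς = ς * ς * σ j by ring, hςς, one_mul, map_smul, Finsupp.smul_apply,
        smul_eq_mul, Finset.sum_ite_eq']
      rcases lt_trichotomy i l with hi | hi | hi
      · simp [ha, hi, hi.ne, hv i hi]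
      · subst hi
        simp [hσ j i le_rfl]
      · simp [ha, hi.not_gt, hi.ne', hσ j i hi.le]
    constructor
    · conv_lhs => rw [hsum]
      rw [b'.repr_sum_self]
      simp [ha]
    · intro i hi
      conv_lhs => rw [hsum]
      rw [b'.repr_sum_self]
      simp [ha, hi]
  set Q : ℝ := ∑ j ∈ Finset.Ici l, b.repr v j ^ 2 with hQ
  have hQpos : 0 < Q := Finset.sum_pos' (fun _ _ => sq_nonneg _)
    ⟨l, Finset.mem_Ici.2 le_rfl, by positivity⟩
  set scale : Fin n → ℝ := fun i => if i < l then 1 else if i = l then 2 * s * Q * ς else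
    2 * Real.pi * Real.cos (2 * Real.pi * inner ℝ z.2 (b i)) with hscale
  have hdet : Matrix.det (Matrix.of fun i j : Fin n => fderiv ℝ (degreeMap b x₀ l i) z (w j)) =
      (∏ i, scale i) * conormalForm k b' w := by
    rw [conormalForm, ← Matrix.det_mul_column]
    congr 1
    ext i j
    simp only [Matrix.of_apply]
    rcases lt_trichotomy i l with hi | hi | hi
    · rw [fderiv_degreeMap_of_lt b x₀ l hi, if_pos ((hlt i).2 hi.le), (hrepr j).2 i hi]
      simp [hscale, hi]
    · subst hi
      rw [fderiv_degreeMap_self, if_pos ((hlt i).2 le_rfl), (hrepr j).1]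
      have : ∀ m ∈ Finset.Ici i, 2 * baseCoord b x₀ m z.1 * b.repr (w j).1 m =
          2 * s * σ j * b.repr v m ^ 2 := by
        intro m hm
        rw [hz m (Finset.mem_Ici.1 hm), hσ j m (Finset.mem_Ici.1 hm)]
        ring
      rw [Finset.sum_congr rfl this, ← Finset.mul_sum, ← hQ]
      simp only [hscale, lt_self_iff_false, if_false, if_true]
      linear_combination (-(2 * s * σ j * Q)) * hςς
    · rw [fderiv_degreeMap_of_gt b x₀ l hi, if_neg (fun h => hi.not_ge ((hlt i).1 h)),
        hb'i i hi.ne']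
      simp [hscale, hi.not_gt, hi.ne']
  rw [hdet, ← Finset.prod_erase_mul _ _ (Finset.mem_univ l)]
  have h1 : 0 < ∏ i ∈ Finset.univ.erase l, scale i := by
    refine Finset.prod_pos fun i hi => ?_
    rcases lt_or_gt_of_ne (Finset.ne_of_mem_erase hi) with h | h
    · simp [hscale, h]
    · simp only [hscale, h.not_gt, h.ne', if_false]
      have := hcos i h
      positivity
  have h2 : scale l = 2 * s * Q * ς := by simp [hscale]
  rw [h2]
  have h3 : ς * ((∏ i ∈ Finset.univ.erase l, scale i) * (2 * s * Q * ς) * conormalForm k b' w) =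
      (∏ i ∈ Finset.univ.erase l, scale i) * (2 * s * Q) * conormalForm k b' w := by
    linear_combination ((∏ i ∈ Finset.univ.erase l, scale i) * (2 * s * Q) *
      conormalForm k b' w) * hςς
  rw [h3]
  positivity

/-- When the `l`-th coordinate of the normal vector `v` vanishes, the differentials of the
components of `degreeMap` of index greater than `l` are linearly dependent along the conormal
bundle. -/
theorem det_fderiv_degreeMap_eq_zero {v : BaseSpace n} (hv0 : v ≠ 0)
    (hv : ∀ i, i ≤ l → b.repr v i = 0) {z : CotangentCover n}
    (hcos : ∀ i, l < i → 0 < Real.cos (2 * Real.pi * inner ℝ z.2 (b i)))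
    {w : Fin n → CotangentCover n} (hw : ∀ j, inner ℝ (w j).2 v = 0) :
    Matrix.det (Matrix.of fun i j : Fin n => fderiv ℝ (degreeMap b x₀ l i) z (w j)) = 0 := by
  rw [← Matrix.exists_vecMul_eq_zero_iff]
  have hpi := Real.pi_ne_zero
  have hne : b.repr v ≠ 0 := fun h => hv0 (b.repr.map_eq_zero_iff.1 h)
  refine ⟨fun i => b.repr v i / (2 * Real.pi * Real.cos (2 * Real.pi * inner ℝ z.2 (b i))),
    fun h0 => hne (Finsupp.ext fun i => ?_), ?_⟩
  · rw [Finsupp.zero_apply]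
    rcases le_or_gt i l with hi | hi
    · exact hv i hi
    · have := congrFun h0 i
      simpa [hpi, (hcos i hi).ne'] using this
  · ext j
    have hsum : ∑ i, b.repr v i * inner ℝ (w j).2 (b i) = 0 := by
      rw [← hw j]
      conv_rhs => rw [← b.sum_repr v]
      rw [inner_sum]
      simp [inner_smul_right]
    refine Eq.trans ?_ hsum
    rw [Matrix.vecMul, dotProduct]
    refine Finset.sum_congr rfl fun i _ => ?_
    simp only [Matrix.of_apply]
    rcases le_or_gt i l with hi | hi
    · rw [hv i hi]
      simp
    · rw [fderiv_degreeMap_of_gt b x₀ l hi]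
      have := (hcos i hi).ne'
      field_simp

end Sign

/-! ### Rays transverse to a facet -/

section Ray

variable {n : ℕ} (b : Module.Basis (Fin n) ℝ (BaseSpace n)) (x₀ : BaseSpace n) (l : Fin n)

/-- The point `q` lies on the open ray through `x₀` in the direction `v`, modulo the span of the
`b i`, `i < l`. -/
def IsOnRay (v q : BaseSpace n) : Prop :=
  ∃ s : ℝ, 0 < s ∧ ∀ i, l ≤ i → baseCoord b x₀ i q = s * b.repr v i

/-- The span of `v` and the `b i`, `i < l`. -/
noncomputable def raySpan (v : BaseSpace n) : Submodule ℝ (BaseSpace n) where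
  carrier := {u | ∃ σ : ℝ, ∀ i, l ≤ i → b.repr u i = σ * b.repr v i}
  zero_mem' := ⟨0, by simp⟩
  add_mem' := by
    rintro u u' ⟨σ, hσ⟩ ⟨σ', hσ'⟩
    exact ⟨σ + σ', fun i hi => by rw [map_add, Finsupp.add_apply, hσ i hi, hσ' i hi]; ring⟩
  smul_mem' := by
    rintro r u ⟨σ, hσ⟩
    exact ⟨r * σ, fun i hi => by rw [map_smul, Finsupp.smul_apply, hσ i hi, smul_eq_mul]; ring⟩

theorem basis_mem_raySpan (v : BaseSpace n) {i : Fin n} (hi : i < l) : b i ∈ raySpan b l v :=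
  ⟨0, fun j hj => by simp [(hi.trans_le hj).ne]⟩

theorem self_mem_raySpan (v : BaseSpace n) : v ∈ raySpan b l v :=
  ⟨1, fun i _ => by simp⟩

variable {b l x₀}

theorem transverseSq_zero (v : BaseSpace n) :
    transverseSq b 0 l v = ∑ i ∈ Finset.Ici l, b.repr v i ^ 2 := by
  simp [transverseSq, baseCoord]

theorem transverseSq_eq_sq_mul {v q : BaseSpace n} {s : ℝ}
    (h : ∀ i, l ≤ i → baseCoord b x₀ i q = s * b.repr v i) :
    transverseSq b x₀ l q = s ^ 2 * transverseSq b 0 l v := by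
  rw [transverseSq_zero, transverseSq, Finset.mul_sum]
  refine Finset.sum_congr rfl fun i hi => ?_
  rw [h i (Finset.mem_Ici.1 hi), mul_pow]

theorem transverseSq_zero_pos {v : BaseSpace n} (hv : ∃ i, l ≤ i ∧ b.repr v i ≠ 0) :
    0 < transverseSq b 0 l v := by
  obtain ⟨i, hi, h0⟩ := hv
  rw [transverseSq_zero]
  exact Finset.sum_pos' (fun _ _ => sq_nonneg _) ⟨i, Finset.mem_Ici.2 hi, by positivity⟩

/-- Away from the affine subspace where all transverse coordinates vanish, the rays are closed. -/
theorem isOnRay_iff {v q : BaseSpace n} (hv : ∃ i, l ≤ i ∧ b.repr v i ≠ 0)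
    (hq : 0 < transverseSq b x₀ l q) : IsOnRay b x₀ l v q ↔
      ∀ i, l ≤ i → baseCoord b x₀ i q * √(transverseSq b 0 l v) =
        √(transverseSq b x₀ l q) * b.repr v i := by
  have hv' := transverseSq_zero_pos hv
  constructor
  · rintro ⟨s, hs, h⟩ i hi
    rw [transverseSq_eq_sq_mul h, Real.sqrt_mul (sq_nonneg s), Real.sqrt_sq hs.le, h i hi]
    ring
  · intro h
    have h1 : 0 < √(transverseSq b 0 l v) := Real.sqrt_pos.2 hv'
    refine ⟨√(transverseSq b x₀ l q) / √(transverseSq b 0 l v),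
      div_pos (Real.sqrt_pos.2 hq) h1, fun i hi => ?_⟩
    rw [div_mul_eq_mul_div, ← h i hi, mul_div_cancel_right₀ _ h1.ne']

theorem eventually_not_isOnRay {v q : BaseSpace n} (hv : ∃ i, l ≤ i ∧ b.repr v i ≠ 0)
    (hq : 0 < transverseSq b x₀ l q) (h : ¬ IsOnRay b x₀ l v q) :
    ∀ᶠ q' in nhds q, ¬ IsOnRay b x₀ l v q' := by
  have hN : Continuous (transverseSq b x₀ l) := (contDiff_transverseSq b x₀ l).continuous
  rw [isOnRay_iff hv hq] at h
  push Not at h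
  obtain ⟨i, hi, hne⟩ := h
  have hc1 : Continuous fun q => baseCoord b x₀ i q * √(transverseSq b 0 l v) :=
    (contDiff_baseCoord b x₀ i).continuous.mul continuous_const
  have hc2 : Continuous fun q => √(transverseSq b x₀ l q) * b.repr v i :=
    hN.sqrt.mul continuous_const
  filter_upwards [hN.continuousAt.eventually (lt_mem_nhds hq),
    (isOpen_ne_fun hc1 hc2).mem_nhds hne] with q' h1 h2 h3
  exact h2 ((isOnRay_iff hv h1).1 h3 i hi)

theorem IsOnRay.sub_mem_raySpan {v q q' : BaseSpace n} (h : IsOnRay b x₀ l v q)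
    (h' : IsOnRay b x₀ l v q') : q' - q ∈ raySpan b l v := by
  obtain ⟨s, -, hs⟩ := h
  obtain ⟨s', -, hs'⟩ := h'
  refine ⟨s' - s, fun i hi => ?_⟩
  have h1 := hs i hi
  have h2 := hs' i hi
  rw [baseCoord] at h1 h2
  rw [← sub_sub_sub_cancel_right q' q x₀, map_sub, Finsupp.sub_apply, h1, h2]
  ring

variable (b x₀ l) in
/-- An open subset of the complement of the affine subspace through `x₀` spanned by the `b i`,
`i < l`. It contains the region `yᵢ² < 2c`, `c ≤ transverseSq ≤ 2c` of the base over which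
`cutoffCoeff` is supported. -/
def shell (c : ℝ) : Set (BaseSpace n) :=
  {q | (∀ i, i < l → baseCoord b x₀ i q ^ 2 < 2 * c) ∧ c / 2 < transverseSq b x₀ l q ∧
    transverseSq b x₀ l q < 3 * c}

theorem isOpen_shell (c : ℝ) : IsOpen (shell b x₀ l c) := by
  have hN : Continuous (transverseSq b x₀ l) := (contDiff_transverseSq b x₀ l).continuous
  have hb : ∀ i, Continuous (baseCoord b x₀ i) := fun i => (contDiff_baseCoord b x₀ i).continuous
  have h1 : IsOpen {q | ∀ i, i < l → baseCoord b x₀ i q ^ 2 < 2 * c} := by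
    simp only [Set.ofPred_forall]
    exact isOpen_iInter_of_finite fun i => isOpen_iInter_of_finite fun _ =>
      isOpen_lt ((hb i).pow 2) continuous_const
  exact h1.inter ((isOpen_lt continuous_const hN).inter (isOpen_lt hN continuous_const))

theorem transverseSq_pos_of_mem_shell {c : ℝ} (hc : 0 < c) {q : BaseSpace n}
    (hq : q ∈ shell b x₀ l c) : 0 < transverseSq b x₀ l q := by
  linarith [hq.2.1]

variable (b x₀ l) in
theorem exists_pos_forall_dist_lt_of_transverseSq_lt {r : ℝ} (hr : 0 < r) :
    ∃ c > 0, ∀ q, (∀ i, i < l → baseCoord b x₀ i q ^ 2 ≤ 3 * c) →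
      transverseSq b x₀ l q ≤ 3 * c → dist q x₀ < r := by
  have hcont : Continuous fun y : Fin n → ℝ => b.equivFun.symm y :=
    b.equivFun.symm.toLinearMap.continuous_of_finiteDimensional
  obtain ⟨δ, hδ, hball⟩ := Metric.continuousAt_iff.1 (hcont.continuousAt (x := 0)) r hr
  refine ⟨δ ^ 2 / 4, by positivity, fun q h1 h2 => ?_⟩
  have hsq : ∀ i, baseCoord b x₀ i q ^ 2 ≤ 3 * (δ ^ 2 / 4) := by
    intro i
    rcases lt_or_ge i l with hi | hi
    · exact h1 i hi
    · refine le_trans ?_ h2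
      exact Finset.single_le_sum (f := fun j => baseCoord b x₀ j q ^ 2)
        (fun _ _ => sq_nonneg _) (Finset.mem_Ici.2 hi)
  have hlt : dist (b.equivFun (q - x₀)) 0 < δ := by
    rw [dist_pi_lt_iff hδ]
    intro i
    rw [Pi.zero_apply, Real.dist_0_eq_abs]
    refine abs_lt_of_sq_lt_sq ?_ hδ.le
    have := hsq i
    rw [baseCoord] at this
    rw [Module.Basis.equivFun_apply]
    nlinarith [pow_pos hδ 2]
  have := hball hlt
  rwa [LinearEquiv.symm_apply_apply, map_zero, dist_zero_right, ← dist_eq_norm] at this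

variable (b x₀ l) in
/-- The shell stays away from the points with vanishing transverse coordinates. -/
theorem exists_pos_forall_dist_transverseSq_lt {c : ℝ} (hc : 0 < c) :
    ∃ ε > 0, ∀ q w, (∀ i, l ≤ i → baseCoord b x₀ i w = 0) → dist q w < ε →
      transverseSq b x₀ l q < c := by
  have hN : Continuous (transverseSq b 0 l) := (contDiff_transverseSq b 0 l).continuous
  have h0 : transverseSq b 0 l 0 = 0 := by simp [transverseSq_zero]
  have hev := hN.continuousAt.eventually (gt_mem_nhds (h0 ▸ hc))
  obtain ⟨ε, hε, hball⟩ := Metric.eventually_nhds_iff.1 hev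
  refine ⟨ε, hε, fun q w hw hqw => ?_⟩
  have h1 : transverseSq b x₀ l q = transverseSq b 0 l (q - w) := by
    rw [transverseSq_zero, transverseSq]
    refine Finset.sum_congr rfl fun i hi => ?_
    have := hw i (Finset.mem_Ici.1 hi)
    rw [baseCoord] at this
    rw [← sub_sub_sub_cancel_right q w x₀, map_sub b.repr (q - x₀), Finsupp.sub_apply, this,
      sub_zero]
    rfl
  rw [h1]
  exact hball (by simpa [dist_eq_norm] using hqw)

end Ray

/-! ### Polyhedra with a given facet as half-spaces bounded by rays -/

section HalfSpace

variable {n : ℕ} {b : Module.Basis (Fin n) ℝ (BaseSpace n)} {x₀ : BaseSpace n} {l : Fin n}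
  {W P : Set (BaseSpace n)} {v : BaseSpace n}

theorem mem_periodizedConormal_iff {z : CotangentCover n} :
    coverMap z ∈ periodizedConormal P ↔ z.1 ∈ intrinsicInterior ℝ P ∧
      ∃ ζ ∈ integralVectors n, ∀ u ∈ vectorSpan ℝ P, inner ℝ (z.2 - ζ) u = 0 := by
  constructor
  · rintro ⟨z', ⟨h1, h2⟩, h3⟩
    obtain ⟨h4, h5⟩ := coverMap_eq_coverMap_iff.1 h3.symm
    exact ⟨h4 ▸ h1, z.2 - z'.2, h5, fun u hu => by rw [sub_sub_cancel]; exact h2 u hu⟩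
  · rintro ⟨h1, ζ, hζ, h2⟩
    refine ⟨(z.1, z.2 - ζ), ⟨h1, h2⟩, coverMap_eq_coverMap_iff.2 ⟨rfl, ?_⟩⟩
    simpa using neg_mem hζ

theorem IsInwardNormal.vectorSpan_eq (h : IsInwardNormal W P x₀ v) (hWP : W ⊆ P)
    (hW : ∀ u, u ∈ vectorSpan ℝ W ↔ ∀ j, l ≤ j → b.repr u j = 0) :
    vectorSpan ℝ P = raySpan b l v := by
  ext u
  constructor
  · intro hu
    obtain ⟨τ, hτ, σ, rfl⟩ := h.exists_eq_add_smul u hu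
    refine ⟨σ, fun i hi => ?_⟩
    rw [map_add, map_smul, Finsupp.add_apply, (hW τ).1 hτ i hi]
    simp
  · rintro ⟨σ, hσ⟩
    have h1 : u - σ • v ∈ vectorSpan ℝ W := (hW _).2 fun j hj => by
      rw [map_sub, map_smul, Finsupp.sub_apply, hσ j hj]
      simp
    have := add_mem (vectorSpan_mono ℝ hWP h1) (Submodule.smul_mem _ σ h.mem_vectorSpan)
    simpa using this

theorem IsInwardNormal.exists_repr_ne_zero (h : IsInwardNormal W P x₀ v)
    (hW : ∀ u, u ∈ vectorSpan ℝ W ↔ ∀ j, l ≤ j → b.repr u j = 0) :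
    ∃ i, l ≤ i ∧ b.repr v i ≠ 0 := by
  by_contra! hne
  exact h.notMem_vectorSpan ((hW v).2 hne)

/-- Near `x₀`, the polyhedron is the half-space of its affine span bounded by the facet. -/
theorem IsInwardNormal.exists_pos_isOnRay (h : IsInwardNormal W P x₀ v) (hx₀ : x₀ ∈ P)
    (hW : ∀ u, u ∈ vectorSpan ℝ W ↔ ∀ j, l ≤ j → b.repr u j = 0) :
    ∃ r > 0, ∀ q, dist q x₀ < r → 0 < transverseSq b x₀ l q →
      (q ∈ P → IsOnRay b x₀ l v q) ∧ (IsOnRay b x₀ l v q → q ∈ intrinsicInterior ℝ P) := by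
  obtain ⟨r, hr, hloc⟩ := h.exists_pos
  refine ⟨r, hr, fun q hq hN => ⟨fun hqP => ?_, ?_⟩⟩
  · obtain ⟨τ, hτ, σ, hσ⟩ := h.exists_eq_add_smul _ (vsub_mem_vectorSpan ℝ hqP hx₀)
    rw [vsub_eq_sub] at hσ
    have hcoord : ∀ i, l ≤ i → baseCoord b x₀ i q = σ * b.repr v i := fun i hi => by
      rw [baseCoord, hσ, map_add, map_smul, Finsupp.add_apply, (hW τ).1 hτ i hi]
      simp
    have h1 := (hloc τ hτ σ (by rwa [← hσ, ← dist_eq_norm])).1 (by rwa [← hσ, add_sub_cancel])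
    refine ⟨σ, lt_of_le_of_ne h1 ?_, hcoord⟩
    rintro rfl
    rw [transverseSq_eq_sq_mul hcoord] at hN
    simp at hN
  · rintro ⟨s, hs, hcoord⟩
    have hτ : q - x₀ - s • v ∈ vectorSpan ℝ W := (hW _).2 fun j hj => by
      have := hcoord j hj
      rw [baseCoord] at this
      rw [map_sub, map_smul, Finsupp.sub_apply, this]
      simp
    have := (hloc _ hτ s (by rwa [sub_add_cancel, ← dist_eq_norm])).2 hs
    rwa [sub_add_cancel, add_sub_cancel] at this

/-- The coordinates of index at least `l` of a primitive normal vector have no common divisor. -/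
theorem IsInwardNormal.isUnit_of_dvd (h : IsInwardNormal W P x₀ v) (hb : IsLatticeBasis b)
    (hWP : W ⊆ P) (hW : ∀ u, u ∈ vectorSpan ℝ W ↔ ∀ j, l ≤ j → b.repr u j = 0) {d : ℤ}
    (hd : ∀ i, l ≤ i → ∃ m : ℤ, b.repr v i = d * m) : IsUnit d := by
  obtain ⟨i₀, hi₀, hne⟩ := h.exists_repr_ne_zero hW
  have hd0 : (d : ℝ) ≠ 0 := by
    intro h0
    obtain ⟨m, hm⟩ := hd i₀ hi₀
    exact hne (by rw [hm, h0, zero_mul])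
  choose! m hm using hd
  set u : BaseSpace n := ∑ i ∈ Finset.Ici l, (m i : ℝ) • b i with hu
  have hrepr : ∀ i, l ≤ i → b.repr u i = m i := by
    intro i hi
    simp [hu, map_sum, Finsupp.finsetSum_apply, Finsupp.single_apply, hi]
  have huP : u ∈ vectorSpan ℝ P := by
    rw [h.vectorSpan_eq hWP hW]
    refine ⟨(d : ℝ)⁻¹, fun i hi => ?_⟩
    rw [hrepr i hi, hm i hi]
    field_simp
  refine h.isUnit u ⟨huP, ?_⟩ d ((hW _).2 fun j hj => ?_)
  · exact sum_mem fun i _ => int_smul_mem_integralVectors (hb.mem_integralVectors i) _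
  · rw [map_sub, map_smul, Finsupp.sub_apply, hm j hj, Finsupp.smul_apply, hrepr j hj]
    simp

end HalfSpace

/-! ### The Lagrangian near a relative interior point of a facet -/

section Model

/-- The situation near a relative interior point `x₀` of a facet spanned by the lattice vectors
`b i`, `i < l`: over the shell around `x₀`, the oriented Lagrangian `L` is the union of the
periodized conormal bundles of the half-spaces generated by the `b i`, `i < l`, and one of the
primitive normal vectors `v t`. -/
structure IsRayModel {n : ℕ} {ι : Type*} (L : OrientedLagrangian.{u} n)
    (b : Module.Basis (Fin n) ℝ (BaseSpace n)) (x₀ : BaseSpace n) (l : Fin n) (c : ℝ)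
    (S : Finset ι) (v : ι → BaseSpace n) : Prop where
  latticeBasis : IsLatticeBasis b
  pos : 0 < c
  mem_integralVectors : ∀ t ∈ S, v t ∈ integralVectors n
  repr_eq_zero : ∀ t ∈ S, ∀ i, i < l → b.repr (v t) i = 0
  exists_repr_ne_zero : ∀ t ∈ S, ∃ i, l ≤ i ∧ b.repr (v t) i ≠ 0
  isUnit : ∀ t ∈ S, ∀ d : ℤ, (∀ i, l ≤ i → ∃ m : ℤ, b.repr (v t) i = d * m) → IsUnit d
  eq_of_isOnRay : ∀ t ∈ S, ∀ t' ∈ S, ∀ q ∈ shell b x₀ l c,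
    IsOnRay b x₀ l (v t) q → IsOnRay b x₀ l (v t') q → t = t'
  coverMap_mem_range : ∀ z : CotangentCover n, z.1 ∈ shell b x₀ l c →
    (coverMap z ∈ Set.range L.toFun ↔ ∃ t ∈ S, IsOnRay b x₀ l (v t) z.1 ∧
      ∃ ζ ∈ integralVectors n, ∀ u ∈ raySpan b l (v t), inner ℝ (z.2 - ζ) u = 0)
  injOn : Set.InjOn L.toFun {x | (L.toFun x).1 ∈ shell b x₀ l c}
  orientation : ∀ e ∈ atlas (EuclideanSpace ℝ (Fin n)) L.carrier, ∀ O F,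
    IsLocalLift L.toFun e O F → ∀ y ∈ O, (F y).1 ∈ shell b x₀ l c →
      ∀ t ∈ S, IsOnRay b x₀ l (v t) (F y).1 →
        ∀ b' : Module.Basis (Fin n) ℝ (BaseSpace n), b'.orientation = b.orientation →
          (∀ i : Fin n, (i : ℕ) < l + 1 → b' i ∈ raySpan b l (v t)) →
            0 < conormalForm (l + 1) b' fun j => fderiv ℝ F y (EuclideanSpace.single j 1)

variable {n k : ℕ} {ι : Type*} {V : ι → Set (BaseSpace n)}

/-- Near a relative interior point of a facet, a small enough shell and a member of the family
close enough to the union of the conormal bundles form an instance of `IsRayModel`. -/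
theorem exists_isRayModel (hV : IsRationalPolyhedralComplex k V)
    {o : Orientation ℝ (BaseSpace n) (Fin n)} {L : Set.Ioi (0 : ℝ) → OrientedLagrangian.{u} n}
    (hL : IsLagrangianLift o k V L) {s : ι} {W : Set (BaseSpace n)} (hW : IsFacet W (V s))
    {x₀ : BaseSpace n} (hx₀ : x₀ ∈ intrinsicInterior ℝ W) {l : Fin n} (hl : (l : ℕ) + 1 = k)
    {b : Module.Basis (Fin n) ℝ (BaseSpace n)} (hb : IsLatticeBasis b) (hbo : b.orientation = o)
    (hbW : ∀ u, u ∈ vectorSpan ℝ W ↔ ∀ j, l ≤ j → b.repr u j = 0)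
    {S : Finset ι} (hS : ∀ t, t ∈ S ↔ W ⊆ V t) {v : ι → BaseSpace n}
    (hv : ∀ t ∈ S, IsInwardNormal W (V t) x₀ (v t))
    (hv0 : ∀ t ∈ S, ∀ i, i < l → b.repr (v t) i = 0) :
    ∃ ε c, IsRayModel (L ε) b x₀ l c S v := by
  have hxW := intrinsicInterior_subset hx₀
  obtain ⟨r₁, hr₁, hnear, hstrata⟩ := hV.exists_pos_forall_dist_lt hW hx₀
  have hev : ∀ᶠ q in nhds x₀, dist q x₀ < r₁ / 2 ∧ ∀ t ∈ S, 0 < transverseSq b x₀ l q →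
      (q ∈ V t → IsOnRay b x₀ l (v t) q) ∧
        (IsOnRay b x₀ l (v t) q → q ∈ intrinsicInterior ℝ (V t)) := by
    refine Filter.Eventually.and (Metric.ball_mem_nhds x₀ (half_pos hr₁)) ?_
    rw [Filter.eventually_all_finset]
    intro t ht
    obtain ⟨r, hr, h⟩ := (hv t ht).exists_pos_isOnRay ((hS t).1 ht hxW) hbW
    exact Metric.eventually_nhds_iff.2 ⟨r, hr, fun q hq => h q hq⟩
  obtain ⟨r, hr, hball⟩ := Metric.eventually_nhds_iff.1 hev
  obtain ⟨c, hc, hdist⟩ := exists_pos_forall_dist_lt_of_transverseSq_lt b x₀ l hr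
  obtain ⟨ε₁, hε₁, hfar⟩ := exists_pos_forall_dist_transverseSq_lt b x₀ l (half_pos hc)
  have hε : 0 < min ε₁ (r₁ / 2) := lt_min hε₁ (half_pos hr₁)
  have hloc : ∀ q ∈ shell b x₀ l c, dist q x₀ < r₁ / 2 ∧ ∀ t ∈ S,
      (q ∈ V t → IsOnRay b x₀ l (v t) q) ∧
        (IsOnRay b x₀ l (v t) q → q ∈ intrinsicInterior ℝ (V t)) := by
    intro q hq
    have h := hball (hdist q (fun i hi => by linarith [hq.1 i hi]) hq.2.2.le)
    exact ⟨h.1, fun t ht => h.2 t ht (transverseSq_pos_of_mem_shell hc hq)⟩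
  have hmemS : ∀ q ∈ shell b x₀ l c, ∀ t, q ∈ V t → t ∈ S := fun q hq t hqt =>
    (hS t).2 (hnear q t (by linarith [(hloc q hq).1]) hqt)
  -- near `x₀` the complex has no facet other than `W`, where all transverse coordinates vanish
  have hthick : ∀ q ∈ shell b x₀ l c,
      q ∉ Metric.thickening (min ε₁ (r₁ / 2)) (codimOneStrata V) := by
    intro q hq hmem
    obtain ⟨w, hw, hqw⟩ := Metric.mem_thickening_iff.1 hmem
    have h1 : dist w x₀ < r₁ := by
      have := dist_triangle_left w x₀ q
      linarith [(hloc q hq).1, hqw.trans_le (min_le_right _ _)]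
    have h2 := hfar q w (fun i hi => (hbW _).1 (vsub_mem_vectorSpan ℝ (hstrata w hw h1) hxW) i hi)
      (hqw.trans_le (min_le_left _ _))
    linarith [hq.2.1]
  have hspan : ∀ t ∈ S, vectorSpan ℝ (V t) = raySpan b l (v t) := fun t ht =>
    (hv t ht).vectorSpan_eq ((hS t).1 ht) hbW
  have hray : ∀ q ∈ shell b x₀ l c, ∀ t ∈ S, IsOnRay b x₀ l (v t) q → q ∈ V t :=
    fun q hq t ht h => intrinsicInterior_subset (((hloc q hq).2 t ht).2 h)
  refine ⟨⟨_, hε⟩, c, hb, hc, fun t ht => (hv t ht).mem_integralVectors, hv0,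
    fun t ht => (hv t ht).exists_repr_ne_zero hbW,
    fun t ht d hd => (hv t ht).isUnit_of_dvd hb ((hS t).1 ht) hbW hd, ?_, ?_, ?_, ?_⟩
  · intro t ht t' ht' q hq h h'
    exact hV.eq_of_mem_intrinsicInterior (((hloc q hq).2 t ht).2 h) (hray q hq t' ht' h')
  · intro z hz
    have himage := Set.ext_iff.1 (hL.image_eq ⟨_, hε⟩) (coverMap z)
    have hnot : coverMap z ∉ Prod.fst ⁻¹' Metric.thickening (min ε₁ (r₁ / 2))
        (codimOneStrata V) := hthick z.1 hz
    rw [Set.mem_sdiff, Set.mem_sdiff, and_iff_left hnot, and_iff_left hnot, Set.mem_iUnion]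
      at himage
    rw [himage]
    simp only [mem_periodizedConormal_iff]
    constructor
    · rintro ⟨t, h1, h2⟩
      have ht := hmemS z.1 hz t (intrinsicInterior_subset h1)
      refine ⟨t, ht, ((hloc z.1 hz).2 t ht).1 (intrinsicInterior_subset h1), ?_⟩
      rwa [← hspan t ht]
    · rintro ⟨t, ht, h1, h2⟩
      refine ⟨t, ((hloc z.1 hz).2 t ht).2 h1, ?_⟩
      rwa [hspan t ht]
  · exact (hL.injOn ⟨_, hε⟩).mono fun x hx => hthick _ hx
  · intro e he O F hF y hy hq t ht h b' hb' hmem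
    rw [hl] at hmem ⊢
    refine hL.orientation ⟨_, hε⟩ e he O F hF y hy (hthick _ hq) t (hray _ hq t ht h) b'
      (hb'.trans hbo) fun i hi => ?_
    rw [hspan t ht]
    exact hmem i hi

end Model

/-! ### Tangent vectors of the Lagrangian over the shell -/

theorem exists_int_inner_eq {n : ℕ} {p u : BaseSpace n} (hp : p ∈ integralVectors n)
    (hu : u ∈ integralVectors n) : ∃ m : ℤ, inner ℝ p u = m := by
  choose w hw using hp
  choose w' hw' using hu
  refine ⟨∑ j, w' j * w j, ?_⟩
  rw [PiLp.inner_apply]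
  push_cast
  refine Finset.sum_congr rfl fun j _ => ?_
  rw [hw, hw']
  rfl

theorem inner_eq_sum_repr {n : ℕ} (b : Module.Basis (Fin n) ℝ (BaseSpace n)) (p u : BaseSpace n) :
    inner ℝ p u = ∑ i, b.repr u i * inner ℝ p (b i) := by
  conv_lhs => rw [← b.sum_repr u]
  rw [inner_sum]
  simp [inner_smul_right]

section LocalLift

variable {n : ℕ} {M : Type u} [TopologicalSpace M] {f : M → XA n}
  {e : OpenPartialHomeomorph M (EuclideanSpace ℝ (Fin n))} {O : Set (EuclideanSpace ℝ (Fin n))}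
  {F : EuclideanSpace ℝ (Fin n) → CotangentCover n} {y : EuclideanSpace ℝ (Fin n)}

theorem IsLocalLift.apply_fderiv_eq_zero (hF : IsLocalLift f e O F) (hy : y ∈ O)
    (g : CotangentCover n →L[ℝ] ℝ) (hg : ∀ᶠ y' in nhds y, g (F y') = g (F y))
    (a : EuclideanSpace ℝ (Fin n)) : g (fderiv ℝ F y a) = 0 := by
  have h1 : HasFDerivAt (fun y' => g (F y')) (g.comp (fderiv ℝ F y)) y :=
    g.hasFDerivAt.comp y (hF.differentiableAt hy).hasFDerivAt
  have h2 : HasFDerivAt (fun y' => g (F y')) (0 : EuclideanSpace ℝ (Fin n) →L[ℝ] ℝ) y :=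
    (hasFDerivAt_const (g (F y)) y).congr_of_eventuallyEq hg
  have := congrArg (fun A : EuclideanSpace ℝ (Fin n) →L[ℝ] ℝ => A a) (h1.unique h2)
  simpa using this

end LocalLift

section Tangent

variable {n : ℕ} {ι : Type*} {L : OrientedLagrangian.{u} n}
  {b : Module.Basis (Fin n) ℝ (BaseSpace n)} {x₀ : BaseSpace n} {l : Fin n} {c : ℝ}
  {S : Finset ι} {v : ι → BaseSpace n}
  {e : OpenPartialHomeomorph L.carrier (EuclideanSpace ℝ (Fin n))}
  {O : Set (EuclideanSpace ℝ (Fin n))} {F : EuclideanSpace ℝ (Fin n) → CotangentCover n}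
  {y : EuclideanSpace ℝ (Fin n)} {t : ι}

theorem IsRayModel.exists_isOnRay_of_isLocalLift (h : IsRayModel L b x₀ l c S v)
    (hF : IsLocalLift L.toFun e O F) (hy : y ∈ O) (hq : (F y).1 ∈ shell b x₀ l c) :
    ∃ t ∈ S, IsOnRay b x₀ l (v t) (F y).1 ∧
      ∃ ζ ∈ integralVectors n, ∀ u ∈ raySpan b l (v t), inner ℝ ((F y).2 - ζ) u = 0 :=
  (h.coverMap_mem_range _ hq).1 ⟨e.symm y, (hF.lift y hy).symm⟩

/-- Since the rays are closed in the shell, the Lagrangian stays locally over the same ray. -/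
theorem IsRayModel.eventually_isOnRay (h : IsRayModel L b x₀ l c S v)
    (hF : IsLocalLift L.toFun e O F) (hy : y ∈ O) (hq : (F y).1 ∈ shell b x₀ l c) (ht : t ∈ S)
    (hray : IsOnRay b x₀ l (v t) (F y).1) :
    ∀ᶠ y' in nhds y, y' ∈ O ∧ (F y').1 ∈ shell b x₀ l c ∧ IsOnRay b x₀ l (v t) (F y').1 := by
  have hcont : ContinuousAt (fun y' => (F y').1) y :=
    continuous_fst.continuousAt.comp (hF.differentiableAt hy).continuousAt
  have hothers : ∀ᶠ q in nhds (F y).1, ∀ t' ∈ S, t' ≠ t → ¬ IsOnRay b x₀ l (v t') q := by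
    rw [Filter.eventually_all_finset]
    intro t' ht'
    by_cases hne : t' = t
    · simp [hne]
    · refine (eventually_not_isOnRay (h.exists_repr_ne_zero t' ht')
        (transverseSq_pos_of_mem_shell h.pos hq) fun h' => hne ?_).mono fun _ h' _ => h'
      exact h.eq_of_isOnRay t' ht' t ht _ hq h' hray
  filter_upwards [hF.eventually_mem hy, hcont.eventually ((isOpen_shell c).mem_nhds hq),
    hcont.eventually hothers] with y' h1 h2 h3
  obtain ⟨t', ht', h4, -⟩ := h.exists_isOnRay_of_isLocalLift hF h1 h2
  by_cases hne : t' = t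
  · exact ⟨h1, h2, hne ▸ h4⟩
  · exact absurd h4 (h3 t' ht' hne)

/-- Along a conormal bundle, the pairing of the covector with an integral tangent vector of the
base is integral, hence locally constant. -/
theorem IsRayModel.eventually_inner_eq (h : IsRayModel L b x₀ l c S v)
    (hF : IsLocalLift L.toFun e O F) (hy : y ∈ O) (hq : (F y).1 ∈ shell b x₀ l c) (ht : t ∈ S)
    (hray : IsOnRay b x₀ l (v t) (F y).1) {u : BaseSpace n} (hu : u ∈ integralVectors n)
    (hus : u ∈ raySpan b l (v t)) :
    ∀ᶠ y' in nhds y, inner ℝ (F y').2 u = inner ℝ (F y).2 u := by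
  have hcont : ContinuousAt (fun y' => inner ℝ (F y').2 u) y :=
    (continuous_snd.inner continuous_const).continuousAt.comp (hF.differentiableAt hy).continuousAt
  have hint : ∀ᶠ y' in nhds y, ∃ m : ℤ, inner ℝ (F y').2 u = m := by
    filter_upwards [h.eventually_isOnRay hF hy hq ht hray] with y' ⟨h1, h2, h3⟩
    obtain ⟨t', ht', h4, ζ, hζ, h5⟩ := h.exists_isOnRay_of_isLocalLift hF h1 h2
    obtain rfl := h.eq_of_isOnRay t' ht' t ht _ h2 h4 h3
    obtain ⟨m, hm⟩ := exists_int_inner_eq hζ hu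
    have := h5 u hus
    rw [inner_sub_left] at this
    exact ⟨m, by linarith⟩
  obtain ⟨m, hm⟩ := hint.self_of_nhds
  filter_upwards [hint, hcont.eventually (Metric.ball_mem_nhds _ one_pos)] with y' ⟨m', hm'⟩ h1
  rw [hm, hm', Int.dist_cast_real, Int.dist_eq] at h1
  have h2 : |m' - m| < 1 := by exact_mod_cast h1
  rw [Int.abs_lt_one_iff, sub_eq_zero] at h2
  rw [hm, hm', h2]

theorem IsRayModel.fderiv_fst_mem_raySpan (h : IsRayModel L b x₀ l c S v)
    (hF : IsLocalLift L.toFun e O F) (hy : y ∈ O) (hq : (F y).1 ∈ shell b x₀ l c) (ht : t ∈ S)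
    (hray : IsOnRay b x₀ l (v t) (F y).1) (a : EuclideanSpace ℝ (Fin n)) :
    (fderiv ℝ F y a).1 ∈ raySpan b l (v t) := by
  rw [← Submodule.orthogonal_orthogonal (raySpan b l (v t)), Submodule.mem_orthogonal]
  intro u hu
  have := hF.apply_fderiv_eq_zero hy
    ((innerSL ℝ u).comp (ContinuousLinearMap.fst ℝ (BaseSpace n) (BaseSpace n))) ?_ a
  · simpa using this
  · filter_upwards [h.eventually_isOnRay hF hy hq ht hray] with y' ⟨_, _, h1⟩
    have h2 := (Submodule.mem_orthogonal' _ u).1 hu _ (hray.sub_mem_raySpan h1)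
    rw [inner_sub_right] at h2
    simp only [ContinuousLinearMap.comp_apply, ContinuousLinearMap.coe_fst', innerSL_apply_apply]
    linarith

theorem IsRayModel.inner_fderiv_snd_eq_zero (h : IsRayModel L b x₀ l c S v)
    (hF : IsLocalLift L.toFun e O F) (hy : y ∈ O) (hq : (F y).1 ∈ shell b x₀ l c) (ht : t ∈ S)
    (hray : IsOnRay b x₀ l (v t) (F y).1) (a : EuclideanSpace ℝ (Fin n)) :
    inner ℝ (fderiv ℝ F y a).2 (v t) = 0 := by
  have := hF.apply_fderiv_eq_zero hy
    ((innerSL ℝ (v t)).comp (ContinuousLinearMap.snd ℝ (BaseSpace n) (BaseSpace n))) ?_ a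
  · simpa [real_inner_comm] using this
  · filter_upwards [h.eventually_inner_eq hF hy hq ht hray (h.mem_integralVectors t ht)
      (self_mem_raySpan b l _)] with y' h1
    simpa [real_inner_comm] using h1

end Tangent

/-! ### The sheets of the Lagrangian over the shell -/

/-- A sheet of the Lagrangian `L` over the shell: the points over the half-space with normal vector
`v` having a covector which vanishes on the `b i`, `i < l`, is small on the `b i`, `l < i`, and
takes the value `r` on `v`. -/
def sheet {n : ℕ} (L : OrientedLagrangian.{u} n) (b : Module.Basis (Fin n) ℝ (BaseSpace n))
    (x₀ : BaseSpace n) (l : Fin n) (c : ℝ) (v : BaseSpace n) (r : ℝ) : Set L.carrier :=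
  {x | ∃ z : CotangentCover n, coverMap z = L.toFun x ∧ z.1 ∈ shell b x₀ l c ∧
    IsOnRay b x₀ l v z.1 ∧ (∀ i, i < l → inner ℝ z.2 (b i) = 0) ∧
    (∀ i, l < i → |inner ℝ z.2 (b i)| < 1 / 4) ∧ inner ℝ z.2 v = r}

section Sheet

variable {n : ℕ} {ι : Type*} {L : OrientedLagrangian.{u} n}
  {b : Module.Basis (Fin n) ℝ (BaseSpace n)} {x₀ : BaseSpace n} {l : Fin n} {c : ℝ}
  {S : Finset ι} {v : ι → BaseSpace n} {t : ι}

/-- Membership in a sheet is an open condition because the values of the covector on the integral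
tangent vectors of the base are locally constant. -/
theorem IsRayModel.isOpen_sheet (h : IsRayModel L b x₀ l c S v) (ht : t ∈ S) (r : ℝ) :
    IsOpen (sheet L b x₀ l c (v t) r) := by
  rw [isOpen_iff_mem_nhds]
  rintro x ⟨z, hz, hq, hray, hlt, hgt, hr⟩
  set e := chartAt (EuclideanSpace ℝ (Fin n)) x with he
  have hx : x ∈ e.source := mem_chart_source _ x
  obtain ⟨O, F, hy, hF⟩ := L.smooth e (chart_mem_atlas _ x) (e x) (e.map_source hx)
  have hlift := hF.lift (e x) hy
  rw [e.left_inv hx, ← hz] at hlift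
  obtain ⟨h1, h2⟩ := coverMap_eq_coverMap_iff.1 hlift
  obtain ⟨ζ, hζ⟩ : ∃ ζ, ζ = (F (e x)).2 - z.2 := ⟨_, rfl⟩
  rw [← hζ] at h2
  have hz2 : z.2 = (F (e x)).2 - ζ := by simp [hζ]
  rw [← h1] at hq hray
  rw [hz2] at hlt hgt hr
  have hcont : ∀ i, ContinuousAt (fun y' => |inner ℝ ((F y').2 - ζ) (b i)|) (e x) := fun i =>
    (continuous_abs.comp ((continuous_snd.sub continuous_const).inner
      continuous_const)).continuousAt.comp (hF.differentiableAt hy).continuousAt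
  have hev : ∀ᶠ y' in nhds (e x), (y' ∈ O ∧ (F y').1 ∈ shell b x₀ l c ∧
      IsOnRay b x₀ l (v t) (F y').1) ∧ (∀ i, i < l → inner ℝ ((F y').2 - ζ) (b i) = 0) ∧
      (∀ i, l < i → |inner ℝ ((F y').2 - ζ) (b i)| < 1 / 4) ∧
      inner ℝ ((F y').2 - ζ) (v t) = r := by
    refine (h.eventually_isOnRay hF hy hq ht hray).and (Filter.Eventually.and ?_
      (Filter.Eventually.and ?_ ?_))
    · refine Filter.eventually_all.2 fun i => Filter.eventually_imp_distrib_left.2 fun hi => ?_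
      filter_upwards [h.eventually_inner_eq hF hy hq ht hray
        (h.latticeBasis.mem_integralVectors i) (basis_mem_raySpan b l _ hi)] with y' hy'
      rw [← hlt i hi, inner_sub_left, inner_sub_left, hy']
    · refine Filter.eventually_all.2 fun i => Filter.eventually_imp_distrib_left.2 fun hi => ?_
      exact (hcont i).eventually (gt_mem_nhds (hgt i hi))
    · filter_upwards [h.eventually_inner_eq hF hy hq ht hray (h.mem_integralVectors t ht)
        (self_mem_raySpan b l _)] with y' hy'
      rw [← hr, inner_sub_left, inner_sub_left, hy']
  filter_upwards [e.open_source.mem_nhds hx, (e.continuousAt hx).eventually hev] with x' hx' hev'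
  obtain ⟨⟨hO, h3, h4⟩, h5, h6, h7⟩ := hev'
  refine ⟨((F (e x')).1, (F (e x')).2 - ζ), ?_, h3, h4, h5, h6, h7⟩
  rw [← e.left_inv hx', ← hF.lift _ hO, e.right_inv (e.map_source hx'), coverMap_eq_coverMap_iff]
  exact ⟨rfl, by simpa using neg_mem h2⟩

end Sheet

section SheetProperties

variable {n : ℕ} {ι : Type*} {L : OrientedLagrangian.{u} n}
  {b : Module.Basis (Fin n) ℝ (BaseSpace n)} {x₀ : BaseSpace n} {l : Fin n} {c : ℝ}
  {S : Finset ι} {v : ι → BaseSpace n} {t : ι}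

theorem exists_forall_inner_eq (b : Module.Basis (Fin n) ℝ (BaseSpace n)) (y : Fin n → ℝ) :
    ∃ p : BaseSpace n, ∀ i, inner ℝ p (b i) = y i := by
  refine ⟨(InnerProductSpace.toDual ℝ (BaseSpace n)).symm
    (LinearMap.toContinuousLinearMap (b.constr ℝ y)), fun i => ?_⟩
  rw [InnerProductSpace.toDual_symm_apply]
  simp

theorem inner_eq_mul_of_mem_raySpan {p u w : BaseSpace n} {σ : ℝ}
    (hσ : ∀ i, l ≤ i → b.repr u i = σ * b.repr w i)
    (hp : ∀ i, i < l → inner ℝ p (b i) = 0) : inner ℝ p u = σ * inner ℝ p w := by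
  rw [inner_eq_sum_repr b p u, inner_eq_sum_repr b p w, Finset.mul_sum]
  refine Finset.sum_congr rfl fun i _ => ?_
  rcases lt_or_ge i l with hi | hi
  · rw [hp i hi, mul_zero, mul_zero, mul_zero]
  · rw [hσ i hi]
    ring

/-- The value of a covector on `u` is determined by its values on the `b i`, `i ≠ l`, up to a
multiple of the `l`-th coordinate of `u`. -/
theorem inner_eq_repr_mul_inner {p u : BaseSpace n} (hp : ∀ i, i ≠ l → inner ℝ p (b i) = 0) :
    inner ℝ p u = b.repr u l * inner ℝ p (b l) := by
  rw [inner_eq_sum_repr b p u]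
  exact Finset.sum_eq_single l (fun i _ hi => by rw [hp i hi, mul_zero]) (by simp)

theorem eq_of_forall_baseCoord_eq {q q' : BaseSpace n}
    (h : ∀ i, baseCoord b x₀ i q = baseCoord b x₀ i q') : q = q' := by
  have : b.repr (q - x₀) = b.repr (q' - x₀) := Finsupp.ext h
  simpa using b.repr.injective this

theorem IsRayModel.descend_degreeMap (h : IsRayModel L b x₀ l c S v) {x : L.carrier}
    {z : CotangentCover n} (hz : coverMap z = L.toFun x) (i : Fin n) :
    descend (degreeMap b x₀ l i) (L.toFun x) = degreeMap b x₀ l i z := by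
  rw [← hz, (h.latticeBasis.isFibrePeriodic_degreeMap x₀ l i).descend_coverMap]

/-- On a sheet, the components of `degreeMap` determine the base point, which lies on a ray, the
fibre coordinates of index different from `l`, and, by means of the value on `v t`, the fibre
coordinate of index `l`. -/
theorem IsRayModel.injOn_sheet (h : IsRayModel L b x₀ l c S v) (ht : t ∈ S)
    (hvl : b.repr (v t) l ≠ 0) (r : ℝ) :
    Set.InjOn (fun x => WithLp.toLp 2 fun i => descend (degreeMap b x₀ l i) (L.toFun x))
      (sheet L b x₀ l c (v t) r) := by
  rintro x ⟨z, hz, hq, ⟨s, hs, hray⟩, hlt, hgt, hr⟩ x' ⟨z', hz', hq', ⟨s', hs', hray'⟩, hlt', hgt',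
    hr'⟩ heq
  have hG : ∀ i, degreeMap b x₀ l i z = degreeMap b x₀ l i z' := by
    intro i
    have := congrFun (congrArg WithLp.ofLp heq) i
    simpa [h.descend_degreeMap hz, h.descend_degreeMap hz'] using this
  have hss : s = s' := by
    have h1 := hG l
    simp only [degreeMap_self] at h1
    rw [transverseSq_eq_sq_mul hray, transverseSq_eq_sq_mul hray'] at h1
    have h2 := mul_right_cancel₀ (transverseSq_zero_pos (h.exists_repr_ne_zero t ht)).ne' h1
    nlinarith
  subst hss
  have hfst : z.1 = z'.1 := eq_of_forall_baseCoord_eq fun i => by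
    rcases lt_or_ge i l with hi | hi
    · simpa [degreeMap_of_lt b x₀ hi] using hG i
    · rw [hray i hi, hray' i hi]
  have hne : ∀ i, i ≠ l → inner ℝ (z.2 - z'.2) (b i) = 0 := by
    intro i hi
    rw [inner_sub_left, sub_eq_zero]
    rcases lt_or_gt_of_ne hi with hi | hi
    · rw [hlt i hi, hlt' i hi]
    · have h1 := hG i
      simp only [degreeMap_of_gt b x₀ hi] at h1
      have hpi := Real.pi_pos
      have h2 := abs_lt.1 (hgt i hi)
      have h3 := abs_lt.1 (hgt' i hi)
      have h4 := Real.injOn_sin (by constructor <;> nlinarith) (by constructor <;> nlinarith) h1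
      exact mul_left_cancel₀ (by positivity) h4
  have hl : inner ℝ (z.2 - z'.2) (b l) = 0 := by
    have h1 := inner_eq_repr_mul_inner (u := v t) hne
    rw [inner_sub_left, hr, hr', sub_self] at h1
    exact (mul_eq_zero.1 h1.symm).resolve_left hvl
  have hsnd : z.2 - z'.2 = 0 := InnerProductSpace.ext_inner_right_basis b fun i => by
    rw [inner_zero_left]
    by_cases hi : i = l
    · rw [hi, hl]
    · exact hne i hi
  have hzz : z = z' := Prod.ext hfst (sub_eq_zero.1 hsnd)
  refine h.injOn ?_ ?_ (by rw [← hz, ← hz', hzz])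
  · rw [Set.mem_ofPred_eq, ← hz]
    exact hq
  · rw [Set.mem_ofPred_eq, ← hz']
    exact hq'

/-- Since the normal vectors are primitive modulo the facet, some integral covector which vanishes
on the facet takes the value `1` on them. -/
theorem IsRayModel.exists_inner_eq_int (h : IsRayModel L b x₀ l c S v) (ht : t ∈ S) (r : ℤ) :
    ∃ ζ ∈ integralVectors n, (∀ i, i < l → inner ℝ ζ (b i) = 0) ∧ inner ℝ ζ (v t) = r := by
  choose m hm using h.latticeBasis.repr_eq_int (v t) (h.mem_integralVectors t ht)
  have hspan : Ideal.span (Set.range m) = ⊤ := by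
    obtain ⟨d, hd⟩ := (IsPrincipalIdealRing.principal (Ideal.span (Set.range m))).principal
    rw [Ideal.submodule_span_eq] at hd
    rw [hd, Ideal.span_singleton_eq_top]
    refine h.isUnit t ht d fun i _ => ?_
    have : m i ∈ Ideal.span {d} := hd ▸ Ideal.subset_span (Set.mem_range_self i)
    obtain ⟨a, ha⟩ := Ideal.mem_span_singleton.1 this
    exact ⟨a, by rw [hm, ha]; push_cast; rfl⟩
  have h1 : r ∈ Ideal.span (Set.range m) := hspan ▸ Submodule.mem_top
  obtain ⟨a, ha⟩ := Ideal.mem_span_range_iff_exists_fun.1 h1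
  obtain ⟨ζ, hζ, hζa⟩ := h.latticeBasis.exists_inner_eq fun i => if i < l then 0 else a i
  refine ⟨ζ, hζ, fun i hi => by simp [hζa, hi], ?_⟩
  rw [inner_eq_sum_repr b, ← ha]
  push_cast
  refine Finset.sum_congr rfl fun i _ => ?_
  rw [hζa]
  rcases lt_or_ge i l with hi | hi
  · have h2 := h.repr_eq_zero t ht i hi
    rw [hm] at h2
    rw [hm, h2, zero_mul, mul_zero]
  · rw [if_neg hi.not_gt, hm, mul_comm]

/-- The image of each sheet under `degreeMap` contains the support of the density. -/
theorem IsRayModel.exists_mem_sheet (h : IsRayModel L b x₀ l c S v) (ht : t ∈ S)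
    (hvl : b.repr (v t) l ≠ 0) (r : ℤ) {w : EuclideanSpace ℝ (Fin n)}
    (hw : degreeDensity l c w ≠ 0) : ∃ x ∈ sheet L b x₀ l c (v t) r,
      WithLp.toLp 2 (fun i => descend (degreeMap b x₀ l i) (L.toFun x)) = w := by
  have hc := h.pos
  obtain ⟨hw1, ⟨hw2, hw2'⟩, hw3⟩ := bounds_of_degreeDensity_ne_zero hc hw
  have hQ := transverseSq_zero_pos (h.exists_repr_ne_zero t ht)
  set Q := transverseSq b 0 l (v t) with hQdef
  have hwl : 0 < w l := hc.trans_le hw2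
  -- the base point lies on the ray, at the distance prescribed by the `l`-th component of `w`
  obtain ⟨s, hs, hsQ⟩ : ∃ s : ℝ, 0 < s ∧ s ^ 2 * Q = w l := by
    refine ⟨√(w l / Q), Real.sqrt_pos.2 (div_pos hwl hQ), ?_⟩
    rw [Real.sq_sqrt (div_pos hwl hQ).le, div_mul_cancel₀ _ hQ.ne']
  set q : BaseSpace n :=
    x₀ + b.equivFun.symm (fun i => if i < l then w i else s * b.repr (v t) i) with hq
  have hbase : ∀ i, baseCoord b x₀ i q = if i < l then w i else s * b.repr (v t) i := by
    intro i
    rw [baseCoord, hq, add_sub_cancel_left, ← Module.Basis.equivFun_apply,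
      LinearEquiv.apply_symm_apply]
  have hcoord : ∀ i, l ≤ i → baseCoord b x₀ i q = s * b.repr (v t) i := fun i hi => by
    rw [hbase, if_neg hi.not_gt]
  have hN : transverseSq b x₀ l q = w l := by rw [transverseSq_eq_sq_mul hcoord, ← hsQ]
  have hqs : q ∈ shell b x₀ l c := by
    refine ⟨fun i hi => ?_, by rw [hN]; linarith, by rw [hN]; linarith⟩
    rw [hbase, if_pos hi]
    exact hw1 i hi
  -- the `l`-th fibre coordinate is determined by the value on the normal vector
  set A : ℝ := ∑ i ∈ Finset.univ.erase l,
    b.repr (v t) i * (Real.arcsin (w i) / (2 * Real.pi)) with hA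
  obtain ⟨p, hp⟩ := exists_forall_inner_eq b fun i => if i < l then 0 else
    if i = l then (r - A) / b.repr (v t) l else Real.arcsin (w i) / (2 * Real.pi)
  have hplt : ∀ i, i < l → inner ℝ p (b i) = 0 := fun i hi => by rw [hp, if_pos hi]
  have hpgt : ∀ i, l < i → inner ℝ p (b i) = Real.arcsin (w i) / (2 * Real.pi) := fun i hi => by
    rw [hp, if_neg hi.not_gt, if_neg hi.ne']
  have hpv : inner ℝ p (v t) = r := by
    rw [inner_eq_sum_repr b, ← Finset.add_sum_erase _ _ (Finset.mem_univ l), hp l,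
      if_neg (lt_irrefl _), if_pos rfl, mul_div_cancel₀ _ hvl]
    rw [sub_add_eq_add_sub, add_sub_assoc, add_eq_left, sub_eq_zero]
    refine Finset.sum_congr rfl fun i hi => ?_
    rcases lt_or_gt_of_ne (Finset.ne_of_mem_erase hi) with hi | hi
    · rw [h.repr_eq_zero t ht i hi, zero_mul, zero_mul]
    · rw [hpgt i hi]
  have hpi := Real.pi_pos
  obtain ⟨ζ, hζ, hζ1, hζ2⟩ := h.exists_inner_eq_int ht r
  have hray : IsOnRay b x₀ l (v t) q := ⟨s, hs, hcoord⟩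
  obtain ⟨x, hx⟩ := (h.coverMap_mem_range (q, p) hqs).2 ⟨t, ht, hray, ζ, hζ, fun u ⟨σ, hσ⟩ => by
    rw [inner_eq_mul_of_mem_raySpan hσ fun i hi => by
      rw [inner_sub_left, hζ1 i hi, hplt i hi, sub_zero]]
    rw [inner_sub_left, hζ2, hpv, sub_self, mul_zero]⟩
  have hsq : ∀ i, l < i → -1 < w i ∧ w i < 1 := fun i hi => by
    have := hw3 i hi
    constructor <;> nlinarith
  refine ⟨x, ⟨(q, p), hx.symm, hqs, hray, hplt, fun i hi => ?_, hpv⟩, ?_⟩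
  · rw [hpgt i hi, abs_div, abs_of_pos (by positivity : 0 < 2 * Real.pi),
      div_lt_iff₀ (by positivity), abs_lt]
    have h1 := Real.neg_pi_div_two_lt_arcsin.2 (hsq i hi).1
    have h2 := Real.arcsin_lt_pi_div_two.2 (hsq i hi).2
    constructor <;> linarith
  · ext i
    simp only [h.descend_degreeMap hx.symm]
    rcases lt_trichotomy i l with hi | rfl | hi
    · rw [degreeMap_of_lt b x₀ hi]
      exact (hbase i).trans (if_pos hi)
    · rw [degreeMap_self]
      exact hN
    · simp only [degreeMap_of_gt b x₀ hi]
      rw [hpgt i hi, mul_div_cancel₀ _ (by positivity),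
        Real.sin_arcsin (hsq i hi).1.le (hsq i hi).2.le]

theorem cos_pos_of_abs_lt {x : ℝ} (hx : |x| < 1 / 4) : 0 < Real.cos (2 * Real.pi * x) := by
  have h1 := abs_lt.1 hx
  have hpi := Real.pi_pos
  exact Real.cos_pos_of_mem_Ioo ⟨by nlinarith, by nlinarith⟩

theorem IsLatticeBasis.cos_inner_eq (hb : IsLatticeBasis b) {z z' : CotangentCover n}
    (hz : coverMap z = coverMap z') (i : Fin n) :
    Real.cos (2 * Real.pi * inner ℝ z.2 (b i)) = Real.cos (2 * Real.pi * inner ℝ z'.2 (b i)) := by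
  obtain ⟨m, hm⟩ := hb.exists_inner_sub_eq_int (coverMap_eq_coverMap_iff.1 hz).2 i
  rw [hm, show 2 * Real.pi * (inner ℝ z'.2 (b i) + (m : ℝ)) =
    2 * Real.pi * inner ℝ z'.2 (b i) + m * (2 * Real.pi) by ring, Real.cos_add_int_mul_two_pi]

/-- On the sheets over the half-space with normal vector `v t`, the Jacobian determinant of
`degreeMap` has the sign of the `l`-th coordinate of `v t`. -/
theorem IsRayModel.sign_mul_chartJacobian_pos (h : IsRayModel L b x₀ l c S v) (ht : t ∈ S)
    (hvl : b.repr (v t) l ≠ 0) {r : ℝ}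
    {e : OpenPartialHomeomorph L.carrier (EuclideanSpace ℝ (Fin n))}
    (he : e ∈ atlas (EuclideanSpace ℝ (Fin n)) L.carrier) {y : EuclideanSpace ℝ (Fin n)}
    (hy : y ∈ e.target) (hmem : e.symm y ∈ sheet L b x₀ l c (v t) r) :
    0 < (SignType.sign (b.repr (v t) l) : ℝ) *
      chartJacobian (fun i x => descend (degreeMap b x₀ l i) (L.toFun x)) e y := by
  obtain ⟨z, hz, hq, hray, hlt, hgt, hr⟩ := hmem
  obtain ⟨O, F, hyO, hF⟩ := L.smooth e he y hy
  have hFz : coverMap (F y) = coverMap z := by rw [hF.lift y hyO, hz]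
  have h1 := (coverMap_eq_coverMap_iff.1 hFz).1
  rw [← h1] at hq hray
  obtain ⟨s, hs, hcoord⟩ := id hray
  rw [chartJacobian_degreeMap x₀ l h.latticeBasis hF hyO]
  refine sign_mul_det_fderiv_degreeMap_pos b x₀ l rfl (T := raySpan b l (v t))
    (fun i hi => basis_mem_raySpan b l _ hi) (self_mem_raySpan b l _) (h.repr_eq_zero t ht)
    (fun u hu => hu) hs hcoord (fun i hi => ?_)
    (fun j => h.fderiv_fst_mem_raySpan hF hyO hq ht hray _)
    (h.orientation e he O F hF y hyO hq t ht hray) hvl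
  rw [h.latticeBasis.cos_inner_eq hFz]
  exact cos_pos_of_abs_lt (hgt i hi)

theorem IsRayModel.chartJacobian_eq_zero (h : IsRayModel L b x₀ l c S v) (ht : t ∈ S)
    (hvl : b.repr (v t) l = 0)
    {e : OpenPartialHomeomorph L.carrier (EuclideanSpace ℝ (Fin n))}
    {O : Set (EuclideanSpace ℝ (Fin n))} {F : EuclideanSpace ℝ (Fin n) → CotangentCover n}
    (hF : IsLocalLift L.toFun e O F) {y : EuclideanSpace ℝ (Fin n)} (hy : y ∈ O)
    (hq : (F y).1 ∈ shell b x₀ l c) (hray : IsOnRay b x₀ l (v t) (F y).1)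
    (hcos : ∀ i, l < i → 0 < Real.cos (2 * Real.pi * inner ℝ (F y).2 (b i))) :
    chartJacobian (fun i x => descend (degreeMap b x₀ l i) (L.toFun x)) e y = 0 := by
  rw [chartJacobian_degreeMap x₀ l h.latticeBasis hF hy]
  refine det_fderiv_degreeMap_eq_zero b x₀ l (v := v t) ?_ (fun i hi => ?_) hcos
    fun j => h.inner_fderiv_snd_eq_zero hF hy hq ht hray _
  · rintro h0
    obtain ⟨i, -, hi⟩ := h.exists_repr_ne_zero t ht
    exact hi (by rw [h0]; simp)
  · rcases hi.lt_or_eq with hi | rfl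
    · exact h.repr_eq_zero t ht i hi
    · exact hvl

end SheetProperties

/-! ### Decomposition of the Lagrangian into sheets -/

section Decomposition

variable {n : ℕ} {ι : Type*} {L : OrientedLagrangian.{u} n}
  {b : Module.Basis (Fin n) ℝ (BaseSpace n)} {x₀ : BaseSpace n} {l : Fin n} {c : ℝ}
  {S : Finset ι} {v : ι → BaseSpace n} {t : ι}

theorem eq_zero_of_abs_intCast_lt_one {m : ℤ} (h : |(m : ℝ)| < 1) : m = 0 :=
  Int.abs_lt_one_iff.1 (by exact_mod_cast h)

/-- The sheets with parameters in a set of representatives modulo the `l`-th coordinate of the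
normal vector are pairwise disjoint. -/
theorem IsRayModel.eq_of_mem_sheet (h : IsRayModel L b x₀ l c S v) {m : ℤ}
    (hm : b.repr (v t) l = m) {r r' : ℕ} (hr : r < m.natAbs) (hr' : r' < m.natAbs)
    {x : L.carrier} (hx : x ∈ sheet L b x₀ l c (v t) r)
    (hx' : x ∈ sheet L b x₀ l c (v t) r') : r = r' := by
  obtain ⟨z, hz, -, -, hlt, hgt, hzr⟩ := hx
  obtain ⟨z', hz', -, -, hlt', hgt', hzr'⟩ := hx'
  have h2 := (coverMap_eq_coverMap_iff.1 (hz.trans hz'.symm)).2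
  have hne : ∀ i, i ≠ l → inner ℝ (z.2 - z'.2) (b i) = 0 := by
    intro i hi
    rcases lt_or_gt_of_ne hi with hi | hi
    · rw [inner_sub_left, hlt i hi, hlt' i hi, sub_zero]
    · obtain ⟨k, hk⟩ := exists_int_inner_eq h2 (h.latticeBasis.mem_integralVectors i)
      have h3 : |(k : ℝ)| < 1 := by
        rw [← hk, inner_sub_left]
        have := abs_sub (inner ℝ z.2 (b i)) (inner ℝ z'.2 (b i))
        linarith [hgt i hi, hgt' i hi]
      rw [hk, eq_zero_of_abs_intCast_lt_one h3, Int.cast_zero]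
  obtain ⟨k, hk⟩ := exists_int_inner_eq h2 (h.latticeBasis.mem_integralVectors l)
  have h4 := inner_eq_repr_mul_inner (u := v t) hne
  rw [inner_sub_left, hzr, hzr', hm, hk] at h4
  have h5 : (r : ℤ) - r' = m * k := by exact_mod_cast h4
  have h6 : ((r : ℤ) - r').natAbs < m.natAbs := by omega
  have h7 : (r : ℤ) - r' = 0 := Int.eq_zero_of_dvd_of_natAbs_lt_natAbs ⟨k, h5⟩ h6
  omega

theorem exists_int_abs_sub_lt {x : ℝ} (hx : 0 < Real.cos (2 * Real.pi * x)) :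
    ∃ k : ℤ, |x - k| < 1 / 4 := by
  refine ⟨round x, ?_⟩
  by_contra hge
  have h1 := abs_sub_round x
  have hpi := Real.pi_pos
  have h2 : Real.cos (2 * Real.pi * x) = Real.cos (2 * Real.pi * |x - round x|) := by
    rw [← abs_of_pos (by positivity : 0 < 2 * Real.pi), ← abs_mul, abs_of_pos
      (by positivity : 0 < 2 * Real.pi), Real.cos_abs, mul_sub, mul_comm _ (round x : ℝ),
      Real.cos_sub_int_mul_two_pi]
  rw [h2] at hx
  exact absurd hx (not_lt.2 (Real.cos_nonpos_of_pi_div_two_le_of_le (by nlinarith) (by nlinarith)))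

/-- The sheets cover the part of the Lagrangian over the half-space with normal vector `v t` where
the fibre coordinates of index greater than `l` have positive cosine: the fibre coordinate of
index `l` can be changed by an integer so as to reduce the value on `v t` modulo the `l`-th
coordinate of `v t`. -/
theorem IsRayModel.exists_mem_sheet_of_cos_pos (h : IsRayModel L b x₀ l c S v) (ht : t ∈ S)
    {m : ℤ} (hm : b.repr (v t) l = m) (hm0 : m ≠ 0) {x : L.carrier} {z : CotangentCover n}
    (hz : coverMap z = L.toFun x) (hq : z.1 ∈ shell b x₀ l c)
    (hray : IsOnRay b x₀ l (v t) z.1)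
    (hcos : ∀ i, l < i → 0 < Real.cos (2 * Real.pi * inner ℝ z.2 (b i))) :
    ∃ r ∈ Finset.range m.natAbs, x ∈ sheet L b x₀ l c (v t) r := by
  obtain ⟨t', ht', hray', ζ, hζ, hζu⟩ := (h.coverMap_mem_range z hq).1 ⟨x, hz.symm⟩
  obtain rfl := h.eq_of_isOnRay t' ht' t ht _ hq hray' hray
  choose! a ha using fun i hi => exists_int_abs_sub_lt (hcos i hi)
  choose μ hμ using fun i => exists_int_inner_eq hζ (h.latticeBasis.mem_integralVectors i)
  choose w hw using h.latticeBasis.repr_eq_int (v t') (h.mem_integralVectors t' ht')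
  obtain ⟨ν, hν⟩ := exists_int_inner_eq hζ (h.mem_integralVectors t' ht')
  -- the covector obtained with the value `0` for the free integer takes the value `B` on `v t'`
  set B : ℤ := ν - ∑ i ∈ Finset.univ.erase l, w i * (if i < l then μ i else a i) - m * μ l with hB
  obtain ⟨ξ, hξ, hξb⟩ := h.latticeBasis.exists_inner_eq fun i =>
    if i < l then μ i else if i = l then μ l + B / m else a i
  have hzv : inner ℝ z.2 (v t') = ν := by
    have := hζu _ (self_mem_raySpan b l _)
    rw [inner_sub_left, hν] at this
    linarith
  have hξv : inner ℝ ξ (v t') = ((ν - B % m : ℤ) : ℝ) := by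
    rw [inner_eq_sum_repr b, ← Finset.add_sum_erase _ _ (Finset.mem_univ l), hξb,
      if_neg (lt_irrefl _), if_pos rfl, hm]
    have h1 : ∑ i ∈ Finset.univ.erase l, b.repr (v t') i * inner ℝ ξ (b i) =
        ((∑ i ∈ Finset.univ.erase l, w i * (if i < l then μ i else a i) : ℤ) : ℝ) := by
      push_cast
      refine Finset.sum_congr rfl fun i hi => ?_
      rw [hw, hξb, if_neg (Finset.ne_of_mem_erase hi)]
      push_cast
      rfl
    rw [h1]
    have h2 := Int.mul_ediv_add_emod B m
    have h3 : m * (μ l + B / m) +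
        ∑ i ∈ Finset.univ.erase l, w i * (if i < l then μ i else a i) = ν - B % m := by
      linarith
    exact_mod_cast h3
  have hmod := Int.emod_nonneg B hm0
  have hmod' := Int.emod_lt_abs B hm0
  rw [← Int.natCast_natAbs] at hmod'
  refine ⟨(B % m).toNat, Finset.mem_range.2 (by omega), (z.1, z.2 - ξ), ?_, hq, hray,
    fun i hi => ?_, fun i hi => ?_, ?_⟩
  · rw [← hz, coverMap_eq_coverMap_iff]
    exact ⟨rfl, by simpa using neg_mem hξ⟩
  · have h1 := hζu _ (basis_mem_raySpan b l _ hi)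
    rw [inner_sub_left, hμ] at h1
    rw [inner_sub_left, hξb, if_pos hi]
    exact h1
  · rw [inner_sub_left, hξb, if_neg hi.not_gt, if_neg hi.ne']
    exact ha i hi
  · have h1 : (((B % m).toNat : ℤ) : ℝ) = ((B % m : ℤ) : ℝ) := by rw [Int.toNat_of_nonneg hmod]
    rw [Int.cast_natCast] at h1
    rw [inner_sub_left, hzv, hξv, h1]
    push_cast
    ring

theorem bounds_of_cutoffCoeff_ne_zero (hc : 0 < c) {z : CotangentCover n}
    (hz : cutoffCoeff b x₀ l c z ≠ 0) : z.1 ∈ shell b x₀ l c ∧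
      ∀ i, l < i → 0 < Real.cos (2 * Real.pi * inner ℝ z.2 (b i)) := by
  have h1 := left_ne_zero_of_mul hz
  have h2 := mem_Icc_of_deriv_profile_ne_zero hc (right_ne_zero_of_mul hz)
  rw [Finset.prod_ne_zero_iff] at h1
  refine ⟨⟨fun i hi => ?_, by linarith [h2.1], by linarith [h2.2]⟩, fun i hi => ?_⟩
  · have := h1 i (Finset.mem_erase.2 ⟨hi.ne, Finset.mem_univ _⟩)
    rw [cutoffFactor_of_lt b x₀ c hi] at this
    exact sq_lt_of_profile_ne_zero hc this
  · have := h1 i (Finset.mem_erase.2 ⟨hi.ne', Finset.mem_univ _⟩)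
    rw [cutoffFactor_of_gt b x₀ c hi] at this
    by_contra h0
    exact this (Real.smoothTransition.zero_of_nonpos (by linarith))

/-- The integrand in Stokes' theorem is the sum of the pullbacks of the density by the restrictions
of `degreeMap` to the sheets. -/
theorem IsRayModel.chartJacobian_update_eq_sum (h : IsRayModel L b x₀ l c S v) {m : ι → ℤ}
    (hm : ∀ t ∈ S, b.repr (v t) l = m t)
    {e : OpenPartialHomeomorph L.carrier (EuclideanSpace ℝ (Fin n))}
    (he : e ∈ atlas (EuclideanSpace ℝ (Fin n)) L.carrier) {y : EuclideanSpace ℝ (Fin n)}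
    (hy : y ∈ e.target) :
    chartJacobian (Function.update (fun i x => descend (degreeMap b x₀ l i) (L.toFun x)) l
        fun x => descend (fun z => ∏ i, cutoffFactor b x₀ l c i z) (L.toFun x)) e y =
      ∑ j ∈ S.sigma fun t => Finset.range (m t).natAbs,
        (sheet L b x₀ l c (v j.1) (j.2 : ℕ)).indicator (fun x => degreeDensity l c
          (WithLp.toLp 2 fun i => descend (degreeMap b x₀ l i) (L.toFun x))) (e.symm y) *
        chartJacobian (fun i x => descend (degreeMap b x₀ l i) (L.toFun x)) e y := by
  obtain ⟨O, F, hyO, hF⟩ := L.smooth e he y hy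
  have hlift := hF.lift y hyO
  rw [chartJacobian_update_cutoff x₀ l c h.latticeBasis hF hyO]
  by_cases hex : ∃ j ∈ S.sigma fun t => Finset.range (m t).natAbs,
      e.symm y ∈ sheet L b x₀ l c (v j.1) (j.2 : ℕ)
  · obtain ⟨⟨t, r⟩, hj, hmem⟩ := hex
    obtain ⟨ht, hr⟩ := Finset.mem_sigma.1 hj
    rw [Finset.sum_eq_single_of_mem _ hj]
    · rw [Set.indicator_of_mem hmem]
      obtain ⟨z, hz, -, -, -, hgt, -⟩ := hmem
      congr 1
      simp only [h.descend_degreeMap hlift]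
      refine (degreeDensity_degreeMap l c b x₀ fun i hi => ?_).symm
      rw [h.latticeBasis.cos_inner_eq (hlift.trans hz.symm)]
      exact (cos_pos_of_abs_lt (hgt i hi)).le
    · rintro ⟨t', r'⟩ hj' hne
      rw [Set.indicator_of_notMem, zero_mul]
      intro hmem'
      obtain ⟨ht', hr'⟩ := Finset.mem_sigma.1 hj'
      simp only [Finset.mem_range] at hr hr'
      obtain ⟨z, hz, hq, hray, -⟩ := id hmem
      obtain ⟨z', hz', hq', hray', -⟩ := id hmem'
      have h1 := (coverMap_eq_coverMap_iff.1 (hz.trans hz'.symm)).1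
      rw [← h1] at hray'
      obtain rfl := h.eq_of_isOnRay t ht t' ht' _ hq hray hray'
      obtain rfl := h.eq_of_mem_sheet (hm t ht) hr hr' hmem hmem'
      exact hne rfl
  · rw [Finset.sum_eq_zero fun j hj => by
      rw [Set.indicator_of_notMem fun hmem => hex ⟨j, hj, hmem⟩, zero_mul]]
    by_contra hne
    obtain ⟨hq, hcos⟩ := bounds_of_cutoffCoeff_ne_zero h.pos (left_ne_zero_of_mul hne)
    obtain ⟨t, ht, hray, -⟩ := h.exists_isOnRay_of_isLocalLift hF hyO hq
    by_cases hmt : m t = 0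
    · refine right_ne_zero_of_mul hne (h.chartJacobian_eq_zero ht ?_ hF hyO hq hray hcos)
      rw [hm t ht, hmt, Int.cast_zero]
    · obtain ⟨r, hr, hmem⟩ := h.exists_mem_sheet_of_cos_pos ht (hm t ht) hmt hlift hq hray hcos
      exact hex ⟨⟨t, r⟩, Finset.mem_sigma.2 ⟨ht, hr⟩, hmem⟩

end Decomposition

/-! ### The degree computation -/

section Degree

variable {n : ℕ} {ι : Type*} {L : OrientedLagrangian.{u} n}
  {b : Module.Basis (Fin n) ℝ (BaseSpace n)} {x₀ : BaseSpace n} {l : Fin n} {c : ℝ}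
  {S : Finset ι} {v : ι → BaseSpace n}

/-- Properness confines the relevant part of the Lagrangian to a compact set. -/
theorem exists_isCompact_of_bounds (L : OrientedLagrangian.{u} n)
    (b : Module.Basis (Fin n) ℝ (BaseSpace n)) (x₀ : BaseSpace n) (l : Fin n) (c : ℝ)
    (hc : 0 < c) : ∃ K : Set L.carrier, IsCompact K ∧
      ∀ x, (∀ i, i < l → baseCoord b x₀ i (L.toFun x).1 ^ 2 ≤ 2 * c) →
        transverseSq b x₀ l (L.toFun x).1 ≤ 2 * c → x ∈ K := by
  have hcont : Continuous fun y : Fin n → ℝ => x₀ + b.equivFun.symm y :=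
    continuous_const.add b.equivFun.symm.toLinearMap.continuous_of_finiteDimensional
  have hK : IsCompact ((fun y : Fin n → ℝ => x₀ + b.equivFun.symm y) ''
      Set.pi Set.univ fun _ => Set.Icc (-(2 * c + 1)) (2 * c + 1)) :=
    (isCompact_univ_pi fun _ => isCompact_Icc).image hcont
  refine ⟨_, L.proper.isCompact_preimage (hK.prod isCompact_univ), fun x h1 h2 =>
    ⟨⟨b.equivFun ((L.toFun x).1 - x₀), fun i _ => ?_, ?_⟩, Set.mem_univ _⟩⟩
  swap
  · simp only [LinearEquiv.symm_apply_apply, add_sub_cancel]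
  have hsq : baseCoord b x₀ i (L.toFun x).1 ^ 2 ≤ 2 * c := by
    rcases lt_or_ge i l with hi | hi
    · exact h1 i hi
    · refine le_trans ?_ h2
      exact Finset.single_le_sum (f := fun j => baseCoord b x₀ j (L.toFun x).1 ^ 2)
        (fun _ _ => sq_nonneg _) (Finset.mem_Ici.2 hi)
  rw [baseCoord] at hsq
  rw [Module.Basis.equivFun_apply]
  constructor <;> nlinarith

/-- The degree computation: the integral of an exact form over the Lagrangian vanishes, and the
sheets over the half-space with normal vector `v t` contribute a fixed nonzero integral, times the
number of sheets and the sign of the Jacobian, hence times the `l`-th coordinate of `v t`. -/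
theorem IsRayModel.sum_repr_eq_zero (h : IsRayModel L b x₀ l c S v) :
    ∑ t ∈ S, b.repr (v t) l = 0 := by
  have hc := h.pos
  have hb := h.latticeBasis
  have := ChartedSpace.locallyCompactSpace (EuclideanSpace ℝ (Fin n)) L.carrier
  choose! m hm using fun t ht => hb.repr_eq_int (v t) (h.mem_integralVectors t ht) l
  set G : Fin n → L.carrier → ℝ := fun i x => descend (degreeMap b x₀ l i) (L.toFun x) with hG
  set R : L.carrier → ℝ := fun x =>
    descend (fun z => ∏ i, cutoffFactor b x₀ l c i z) (L.toFun x) with hR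
  have hGs : ∀ i, ContMDiff (𝓡 n) 𝓘(ℝ, ℝ) ∞ (G i) := fun i =>
    L.contMDiff_descend (hb.isFibrePeriodic_degreeMap x₀ l i) (contDiff_degreeMap b x₀ l i)
  have hRs : ContMDiff (𝓡 n) 𝓘(ℝ, ℝ) ∞ R :=
    L.contMDiff_descend (hb.isFibrePeriodic_prod_cutoffFactor x₀ l c)
      (contDiff_prod_cutoffFactor x₀ l c)
  obtain ⟨K, hK, hKmem⟩ := exists_isCompact_of_bounds L b x₀ l c hc
  have hRK : Function.support R ⊆ K := by
    intro x hx
    obtain ⟨z, hz⟩ := coverMap_surjective (L.toFun x)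
    have hx' : ∏ i, cutoffFactor b x₀ l c i z ≠ 0 := by
      rw [Function.mem_support] at hx
      simpa only [hR, ← hz, (hb.isFibrePeriodic_prod_cutoffFactor x₀ l c).descend_coverMap] using hx
    rw [Finset.prod_ne_zero_iff] at hx'
    have hz1 : (L.toFun x).1 = z.1 := by rw [← hz]; rfl
    refine hKmem x (fun i hi => ?_) ?_
    · have := hx' i (Finset.mem_univ i)
      rw [cutoffFactor_of_lt b x₀ c hi] at this
      rw [hz1]
      exact (sq_lt_of_profile_ne_zero hc this).le
    · have := hx' l (Finset.mem_univ l)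
      rw [cutoffFactor_self] at this
      rw [hz1]
      exact (sq_lt_of_profile_ne_zero hc this).le
  obtain ⟨α, ⟨P⟩⟩ := exists_chartPartition (n := n) hK
  have hstokes := sum_chartIntegral_update_eq_zero L.oriented hGs l hRs
    (HasCompactSupport.intro hK fun x hx => by_contra fun h0 => hx (hRK h0)) hRK P
  set T := S.sigma fun t => Finset.range (m t).natAbs with hT
  have hvl : ∀ j ∈ T, b.repr (v j.1) l ≠ 0 := by
    intro j hj h0
    obtain ⟨ht, hr⟩ := Finset.mem_sigma.1 hj
    rw [hm _ ht, Int.cast_eq_zero] at h0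
    simp [h0] at hr
  have hφ : MeasureTheory.Integrable (degreeDensity l c) :=
    (continuous_degreeDensity l c).integrable_of_hasCompactSupport
      (hasCompactSupport_degreeDensity l hc)
  have hsheet := fun j (hj : j ∈ T) => by
    have ht := (Finset.mem_sigma.1 hj).1
    refine sum_chartIntegral_indicator (h.isOpen_sheet ht (j.2 : ℕ)) hGs
      (h.injOn_sheet ht (hvl j hj) _) (σ := (SignType.sign (b.repr (v j.1) l) : ℝ)) ?_
      (fun e he y hy hmem => h.sign_mul_chartJacobian_pos ht (hvl j hj) he hy hmem) hφ
      (fun w hw => ?_) (fun x hx hne => ?_) P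
    · rcases lt_or_gt_of_ne (hvl j hj) with h0 | h0
      · simp [sign_neg h0]
      · simp [sign_pos h0]
    · have := h.exists_mem_sheet ht (hvl j hj) (j.2 : ℕ) hw
      rwa [Int.cast_natCast] at this
    · obtain ⟨z, hz, -⟩ := hx
      have hz1 : (L.toFun x).1 = z.1 := by rw [← hz]; rfl
      obtain ⟨h1, h2, -⟩ := bounds_of_degreeDensity_ne_zero hc hne
      simp only [hG, h.descend_degreeMap hz] at h1 h2
      rw [degreeMap_self] at h2
      refine hKmem x (fun i hi => ?_) (hz1 ▸ h2.2)
      have := h1 i hi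
      rw [degreeMap_of_lt b x₀ hi] at this
      exact hz1 ▸ this.le
  have hexp : ∀ a, chartIntegral (P.chart a) (P.weight a) (Function.update G l R) =
      ∑ j ∈ T, chartIntegral (P.chart a) (fun x => P.weight a x *
        (sheet L b x₀ l c (v j.1) (j.2 : ℕ)).indicator (fun x => degreeDensity l c
          (WithLp.toLp 2 fun i => G i x)) x) G := by
    intro a
    unfold chartIntegral
    rw [← MeasureTheory.integral_finsetSum T fun j hj => (hsheet j hj).1 a]
    refine MeasureTheory.setIntegral_congr_fun (P.chart a).open_target.measurableSet fun y hy => ?_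
    simp only
    rw [h.chartJacobian_update_eq_sum hm (P.chart_mem a) hy, Finset.mul_sum]
    exact Finset.sum_congr rfl fun j _ => (mul_assoc _ _ _).symm
  rw [Finset.sum_congr rfl fun a _ => hexp a, Finset.sum_comm,
    Finset.sum_congr rfl fun j hj => (hsheet j hj).2, ← Finset.sum_mul] at hstokes
  have hsum := (mul_eq_zero.1 hstokes).resolve_right (integral_degreeDensity_ne_zero l hc)
  rw [hT, Finset.sum_sigma] at hsum
  rw [← hsum]
  refine Finset.sum_congr rfl fun t ht => ?_
  simp only [Finset.sum_const, Finset.card_range]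
  rw [nsmul_eq_mul, hm t ht, Nat.cast_natAbs, Int.cast_abs,
    mul_comm, sign_mul_abs]

end Degree

/-! ### Lattice bases adapted to a facet -/

section AdaptedBasis

variable {n : ℕ}

theorem repr_eq_or_eq_neg_of_apply_eq {b b' : Module.Basis (Fin n) ℝ (BaseSpace n)}
    (h : ∀ i, b' i = b i ∨ b' i = -b i) (u : BaseSpace n) (i : Fin n) :
    b'.repr u i = b.repr u i ∨ b'.repr u i = -b.repr u i := by
  have hb : ∀ j, b j = b' j ∨ b j = -b' j := fun j =>
    (h j).imp Eq.symm fun hj => by rw [hj, neg_neg]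
  have key : b'.repr u i = b.repr u i * b'.repr (b i) i := by
    conv_lhs => rw [← b.sum_repr u]
    rw [map_sum, Finsupp.finsetSum_apply, Finset.sum_eq_single i]
    · rw [map_smul, Finsupp.smul_apply, smul_eq_mul]
    · intro j _ hji
      rcases hb j with hj | hj <;> simp [hj, hji]
    · simp
  rw [key]
  rcases hb i with hi | hi
  · left
    simp [hi]
  · right
    simp [hi]

theorem IsLatticeBasis.of_apply_eq_or_eq_neg {b b' : Module.Basis (Fin n) ℝ (BaseSpace n)}
    (hb : IsLatticeBasis b) (h : ∀ i, b' i = b i ∨ b' i = -b i) : IsLatticeBasis b' where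
  mem_integralVectors i := by
    rcases h i with hi | hi <;> rw [hi]
    · exact hb.mem_integralVectors i
    · exact neg_mem (hb.mem_integralVectors i)
  repr_eq_int u hu i := by
    obtain ⟨m, hm⟩ := hb.repr_eq_int u hu i
    rcases repr_eq_or_eq_neg_of_apply_eq h u i with hi | hi
    · exact ⟨m, by rw [hi, hm]⟩
    · exact ⟨-m, by rw [hi, hm, Int.cast_neg]⟩

theorem finrank_of_forall_mem_iff {b : Module.Basis (Fin n) ℝ (BaseSpace n)}
    {p : Submodule ℝ (BaseSpace n)} {J : Finset (Fin n)}
    (h : ∀ u, u ∈ p ↔ ∀ j ∈ J, b.repr u j = 0) : Module.finrank ℝ p + J.card = n := by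
  have hp : p = Submodule.span ℝ (Set.range fun i : {i // i ∉ J} => b i) := by
    refine le_antisymm (fun u hu => ?_) (Submodule.span_le.2 ?_)
    · exact mem_submodule_of_repr_eq_zero (J : Set (Fin n)) ((h u).1 hu) _ fun i hi =>
        Submodule.subset_span ⟨⟨i, hi⟩, rfl⟩
    · rintro _ ⟨⟨i, hi⟩, rfl⟩
      refine (h _).2 fun j hj => ?_
      rw [b.repr_self, Finsupp.single_eq_of_ne]
      rintro rfl
      exact hi hj
  have hli : LinearIndependent ℝ fun i : {i // i ∉ J} => b i :=
    b.linearIndependent.comp _ Subtype.val_injective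
  rw [hp, finrank_span_eq_card hli, Fintype.card_subtype_compl, Fintype.card_fin,
    Fintype.card_coe]
  have := Finset.card_le_univ J
  rw [Fintype.card_fin] at this
  omega

/-- A lattice basis adapted to a subspace can be reordered so that the vectors spanning the
subspace come first, followed by any other prescribed vector. -/
theorem exists_perm_of_card_eq {J : Finset (Fin n)} {l : Fin n} (hJ : (l : ℕ) + J.card = n)
    {j : Fin n} (hj : j ∈ J) :
    ∃ e : Equiv.Perm (Fin n), e j = l ∧ ∀ i, i ∈ J ↔ l ≤ e i := by
  have hcard : Fintype.card {i // i ∈ J} = Fintype.card {i // l ≤ i} := by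
    rw [Fintype.card_coe, Fintype.card_subtype]
    have : Finset.filter (fun i => l ≤ i) Finset.univ = Finset.Ici l := by
      ext
      simp
    rw [this, Fin.card_Ici]
    omega
  set f : {i // i ∈ J} ≃ {i // l ≤ i} := Fintype.equivOfCardEq hcard with hf
  refine ⟨(f.trans (Equiv.swap (f ⟨j, hj⟩) ⟨l, le_rfl⟩)).extendSubtype, ?_, fun i => ?_⟩
  · rw [Equiv.extendSubtype_apply_of_mem _ _ hj]
    simp
  · refine ⟨fun hi => Equiv.extendSubtype_mem _ _ hi, fun hi => ?_⟩
    by_contra hne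
    exact Equiv.extendSubtype_not_mem _ _ hne hi

end AdaptedBasis

/-! ### The balancing condition -/

/-- The coordinates of the sum of the normal vectors vanish in each direction transverse to the
facet: a lattice basis can be reordered so that any of these directions has index `l`. -/
theorem IsLagrangianLift.isBalanced {n k : ℕ} {ι : Type*} {V : ι → Set (BaseSpace n)}
    (hV : IsRationalPolyhedralComplex k V) {o : Orientation ℝ (BaseSpace n) (Fin n)}
    {L : Set.Ioi (0 : ℝ) → OrientedLagrangian.{u} n} (hL : IsLagrangianLift o k V L) :
    IsBalanced V fun _ => 1 := by
  classical
  intro s W hW S hS v hv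
  simp only [one_smul]
  obtain ⟨x₀, hx₀⟩ := hW.1.intrinsicInterior (hW.2.1.convex (hV.polyhedron s).convex)
  have hin : ∀ t ∈ S, IsInwardNormal W (V t) x₀ (v t) := fun t ht =>
    (hv t ht).isInwardNormal (hV.polyhedron t) (hV.isFacet_of_subset hW ((hS t).1 ht)) hx₀
  refine ⟨?_, sum_mem fun t ht => (hin t ht).mem_integralVectors⟩
  obtain ⟨b, hb, J', hJ'⟩ := (hV.polyhedron s).exists_isLatticeBasis_face hW.2.1 hW.1
  obtain ⟨J, rfl⟩ : ∃ J : Finset (Fin n), J' = J := ⟨J'.toFinset, by simp⟩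
  change _ ∈ vectorSpan ℝ W
  rw [hJ']
  intro j hj
  have hfin := finrank_of_forall_mem_iff hJ'
  have hdim := hW.2.2
  rw [hV.dim_eq, polyDim] at hdim
  have hJpos : 0 < J.card := Finset.card_pos.2 ⟨j, hj⟩
  set l : Fin n := ⟨Module.finrank ℝ (vectorSpan ℝ W), by omega⟩ with hl
  obtain ⟨e, hej, he⟩ := exists_perm_of_card_eq (l := l) hfin hj
  have : Nonempty (Fin n) := ⟨l⟩
  set b' := (b.reindex e).adjustToOrientation o with hb'
  have hsign : ∀ i, b' i = b.reindex e i ∨ b' i = -b.reindex e i := fun i =>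
    (b.reindex e).adjustToOrientation_apply_eq_or_eq_neg o i
  have hb'L : IsLatticeBasis b' := (hb.reindex e).of_apply_eq_or_eq_neg hsign
  have hzero : ∀ u i, b'.repr u i = 0 ↔ b.repr u (e.symm i) = 0 := by
    intro u i
    rcases repr_eq_or_eq_neg_of_apply_eq hsign u i with h | h <;> rw [h] <;> simp
  have hW' : ∀ u, u ∈ vectorSpan ℝ W ↔ ∀ i, l ≤ i → b'.repr u i = 0 := by
    intro u
    rw [hJ']
    refine ⟨fun h i hi => (hzero u i).2 (h _ ?_), fun h i hi => ?_⟩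
    · exact (he _).2 (by simpa using hi)
    · have := (hzero u (e i)).1 (h _ ((he i).1 hi))
      simpa using this
  -- subtracting a vector tangent to the facet makes the coordinates of index less than `l` vanish
  set w : ι → BaseSpace n := fun t => ∑ i ∈ Finset.Iio l, b'.repr (v t) i • b' i with hw
  have hwrepr : ∀ t i, b'.repr (w t) i = if i < l then b'.repr (v t) i else 0 := by
    intro t i
    simp [hw, map_sum, Finsupp.finsetSum_apply, Finsupp.single_apply]
  have hwW : ∀ t ∈ S, w t ∈ tangentLattice W := by
    intro t ht
    refine ⟨(hW' _).2 fun i hi => by rw [hwrepr, if_neg hi.not_gt], sum_mem fun i _ => ?_⟩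
    obtain ⟨m, hm⟩ := hb'L.repr_eq_int (v t) (hin t ht).mem_integralVectors i
    rw [hm]
    exact int_smul_mem_integralVectors (hb'L.mem_integralVectors i) m
  obtain ⟨ε, c, hmodel⟩ := exists_isRayModel hV hL hW hx₀ (l := l) hdim hb'L
    ((b.reindex e).orientation_adjustToOrientation o) hW' hS
    (v := fun t => v t - w t) (fun t ht => (hin t ht).sub ((hS t).1 ht) (hwW t ht))
    (fun t _ i hi => by rw [map_sub, Finsupp.sub_apply, hwrepr, if_pos hi, sub_self])
  have hsum := hmodel.sum_repr_eq_zero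
  have h1 : b'.repr (∑ t ∈ S, v t) l = 0 := by
    rw [map_sum, Finsupp.finsetSum_apply, ← hsum]
    refine Finset.sum_congr rfl fun t _ => ?_
    rw [map_sub, Finsupp.sub_apply, hwrepr, if_neg (lt_irrefl l), sub_zero]
  have := (hzero _ l).1 h1
  rwa [← hej, Equiv.symm_apply_apply] at this

theorem mainTheorem11 {n k : ℕ} {ι : Type*} (V : ι → Set (BaseSpace n))
    (hV : IsRationalPolyhedralComplex k V)
    (o : Orientation ℝ (BaseSpace n) (Fin n))
    (L : Set.Ioi (0 : ℝ) → OrientedLagrangian.{u} n)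
    (hL : IsLagrangianLift o k V L) :
    IsTropicalSubvariety k V (fun _ => 1) :=
  ⟨hV, hL.isBalanced hV⟩
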